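/- Let $\mathbb N=\{0,1,2,\dots\}$, $\mathbb N^*=\{1,2,\dots\}$. For a family $c=(c(a,m))_{a\in\mathbb N,\,m\in\mathbb N^*}$ of non-negative numbers ($c(a,m)$ is the concentration of particles with $a$ arms and mass $m$) and $f:\mathbb N\to[0,\infty)$ write $\langle c,f\rangle=\sum_{a\ge 0,\,m\ge1} f(a)\,c(a,m)\in[0,\infty]$. **Equation.** Let $c_0(a,m)\ge 0$. A family $(c_t)_{t\ge0}$ of non-negative concentrations, equal to $c_0$ at $t=0$, is a *solution of Smoluchowski's equation with arms* started from $c_0$ if * $\int_0^t\langle c_s,a\rangle^2\,ds<\infty$ for every $t>0$; * for all $a\in\mathbb N$, $m\in\mathbb N^*$, $t>0$ (the time integrals existing as Lebesgue integrals) $$c_t(a,m)=c_0(a,m)+\int_0^t\frac12\sum_{a'=1}^{a+1}\sum_{m'=1}^{m-1}a'(a+2-a')\,c_s(a',m')\,c_s(a+2-a',m-m')\,ds-\int_0^t\sum_{a'\ge1}\sum_{m'\ge1}aa'\,c_s(a,m)\,c_s(a',m')\,ds;$$ * if $\langle c_0,a^2\rangle<\infty$, then $t\mapsto\langle c_t,a^2\rangle$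 is bounded in a right neighbourhood of $0$. **Theorem.** Let $c_0(a,m)\ge 0$ with $\langle c_0,1\rangle<\infty$, $A_0:=\langle c_0,a\rangle\in(0,\infty]$ and $K:=\langle c_0,a(a-1)\rangle\in[0,\infty]$. Then $K=\infty$ whenever $A_0=\infty$. Let $$T_{\rm gel}=\begin{cases}\frac1{K-A_0}&\text{if }A_0<K<\infty,\\ 0&\text{if }K=\infty,\\ +\infty&\text{if }K\le A_0<\infty.\end{cases}$$ Then there is a unique solution $(c_t)_{t\ge0}$ on $[0,\infty)$ started from $c_0$. Write, for $t\ge0$ and $x,y\in[0,1]$, $$A_t=\langle c_t,a\rangle,\quad \alpha_t=\exp\Big(\int_0^tA_s\,ds\Big),\quad \beta_t=\int_0^t\frac{ds}{\alpha_s^2},\quad k_t(x,y)=\sum_{a\ge1}\sum_{m\ge1}a\,c_t(a,m)\,x^{a-1}y^m\in[0,\infty],$$ $$\phi_t(x,y)=\alpha_t\big(x-\beta_t k_0(x,y)\big)\in[-\infty,\infty),\qquad 0\cdot\infty:=0,$$ and $k_0(x):=k_0(x,1)$. If $T_{\rm gel}<\infty$, the following hold. 1. $t\mapsto A_t\in[0,\infty]$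 is continuous and strictly decreasing on $[0,\infty)$, and for $t>0$ $$A_t\le\frac{A_0}{1+tA_0}\ \text{ if }A_0<\infty,\qquad A_t\le\frac1t\ \text{ if }A_0=\infty.$$ On $(0,1)$, $k_0$ is finite and differentiable with $k_0'>0$. The function $G(x)=x-k_0(x)/k_0'(x)$, $x\in(0,1)$, has limits $G(0):=G(0^+)\in[-\infty,0]$ and $G(1):=G(1^-)>0$, where $G(1)=1-A_0/K$ if $A_0<\infty$ and $G(1)=1$ if $A_0=\infty$. It is strictly increasing and maps $[0,1)$ bijectively onto $[G(0),G(1))$; let $H:[G(0),G(1))\to[0,1)$ be its (right) inverse. The function $$\Gamma(x)=1+A_0T_{\rm gel}+\int_{1+A_0T_{\rm gel}}^x\frac{dr}{k_0(H(1/r))},\qquad x\ge1+A_0T_{\rm gel}$$ (with $A_0T_{\rm gel}:=0$ if $A_0=\infty$), is finite and is a bijection of $[1+A_0T_{\rm gel},\infty)$ onto itself. Moreover $\alpha_t=1+A_0t$ for $t<T_{\rm gel}$, and for $t\ge T_{\rm gel}$ $$\alpha_t=\begin{cases}\Gamma^{-1}(1+A_0T_{\rm gel}+t-T_{\rm gel})&\text{if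 }A_0<\infty,\\ \Gamma^{-1}(1+t)&\text{if }A_0=\infty.\end{cases}$$ 2. For every $t\ge0$, $\phi_t(\cdot,1)$ attains its maximum over $[0,1]$ at a point $\ell_t$ with $\phi_t(\ell_t,1)=1$. For $t\le T_{\rm gel}$, $\ell_t=1$. For $t>T_{\rm gel}$, $0<\ell_t<1$, $\frac{\partial\phi_t}{\partial x}(\ell_t,1)=0$, and $\ell_t=H(1/\alpha_t)$ (with $1/\alpha_t$ in the domain of $H$). For all $t\ge0$ and $y\in[0,1]$, $\phi_t(\cdot,y)$ has a right inverse $h_t(\cdot,y):[0,1]\to[0,1]$, i.e. $\phi_t(h_t(x,y),y)=x$ for $x\in[0,1]$; namely, $h_t(x,y)$ can be taken to be the smallest $z\in[0,1]$ with $\phi_t(z,y)=x$. 3. With this choice of $h_t$, for all $t\ge0$ and $x,y\in[0,1]$, $$k_t(x,y)=\frac1{\alpha_t}\,k_0(h_t(x,y),y).$$ In particular, for $t>0$, $$\alpha_tA_t=\alpha_tk_t(1,1)=k_0(\ell_t),\qquad A_t=\frac{k_0(\ell_t)}{1+\int_0^tk_0(\ell_s)\,ds}.$$ 4. $\langle c_t,a^2\rangle$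 is finite for $t\in[0,T_{\rm gel})$ and infinite for $t\in[T_{\rm gel},\infty)$. -/

import Mathlib

open Set Filter Topology MeasureTheory
open scoped NNReal ENNReal

noncomputable section

namespace ArmsCoag

/-- Concentrations: `c a m` is the concentration of particles with `a ∈ {0,1,2,…}` arms and mass
`m ∈ {1,2,…}`. -/
abbrev Conc := ℕ → ℕ+ → ℝ≥0

/-- `⟨c, f⟩ = ∑_{a,m} f(a) c(a,m)` for a non-negative function `f` of the number of arms. -/
def pairing (c : Conc) (f : ℕ → ℕ) : ℝ≥0∞ :=
  ∑' (a : ℕ) (m : ℕ+), (f a : ℝ≥0∞) * (c a m : ℝ≥0∞)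

/-- The number of arms `A = ⟨c, a⟩ ∈ [0,∞]`. -/
def arms (c : Conc) : ℝ≥0∞ := pairing c (fun a => a)

/-- `⟨c, a²⟩ ∈ [0,∞]`. -/
def secondMoment (c : Conc) : ℝ≥0∞ := pairing c (fun a => a ^ 2)

/-- `K = ⟨c, a(a-1)⟩ ∈ [0,∞]` (the truncated subtraction only concerns `a = 0`, where the product
vanishes anyway). -/
def factorialMoment (c : Conc) : ℝ≥0∞ := pairing c (fun a => a * (a - 1))

/-- The gain term
`½ ∑_{a'=1}^{a+1} ∑_{m'=1}^{m-1} a' (a+2-a') c(a',m') c(a+2-a',m-m')`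
(both subtractions are genuine in the range of summation). -/
def gain (c : Conc) (a : ℕ) (m : ℕ+) : ℝ :=
  (1 / 2 : ℝ) * ∑ a' ∈ Finset.Icc 1 (a + 1), ∑ m' ∈ Finset.Ico 1 m,
    (a' : ℝ) * ((a + 2 - a' : ℕ) : ℝ) * (c a' m' : ℝ) * (c (a + 2 - a') (m - m') : ℝ)

/-- The loss term `∑_{a',m' ≥ 1} a a' c(a,m) c(a',m') = a c(a,m) ⟨c, a⟩`. (For a solution,
`⟨c_s, a⟩` is finite for almost every `s`.) -/
def loss (c : Conc) (a : ℕ) (m : ℕ+) : ℝ :=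
  (a : ℝ) * (c a m : ℝ) * (arms c).toReal

/-- Solutions on `[0,∞)` of Smoluchowski's equation with arms, started from `c₀`. The values of `c`
at negative times play no role. The two integrability fields express that the time integrals
in the equation are genuine Lebesgue integrals. -/
structure IsSolution (c₀ : Conc) (c : ℝ → Conc) : Prop where
  initial : c 0 = c₀
  arms_sq : ∀ t : ℝ, 0 < t → ∫⁻ s in Ioc 0 t, (arms (c s)) ^ 2 < ⊤
  gain_integrable : ∀ (a : ℕ) (m : ℕ+) (t : ℝ), 0 < t →
    IntervalIntegrable (fun s => gain (c s) a m) volume 0 t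
  loss_integrable : ∀ (a : ℕ) (m : ℕ+) (t : ℝ), 0 < t →
    IntervalIntegrable (fun s => loss (c s) a m) volume 0 t
  equation : ∀ (a : ℕ) (m : ℕ+) (t : ℝ), 0 < t →
    (c t a m : ℝ) = (c₀ a m : ℝ) + (∫ s in (0 : ℝ)..t, gain (c s) a m)
      - ∫ s in (0 : ℝ)..t, loss (c s) a m
  second_moment : secondMoment c₀ < ⊤ →
    ∃ ε : ℝ, 0 < ε ∧ ∃ C : ℝ≥0, ∀ t ∈ Icc 0 ε, secondMoment (c t) ≤ (C : ℝ≥0∞)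

/-- The gelation time. -/
def tGel (c₀ : Conc) : ℝ≥0∞ :=
  if factorialMoment c₀ = ⊤ then 0
  else if arms c₀ < factorialMoment c₀ then (factorialMoment c₀ - arms c₀)⁻¹
  else ⊤

/-- The generating function `k(x,y) = ∑_{a,m ≥ 1} a c(a,m) x^{a-1} y^m ∈ [0,∞]`, for
`x, y ∈ [0,1]` (the term `a = 0` vanishes). -/
def genFun (c : Conc) (x y : ℝ) : ℝ≥0∞ :=
  ∑' (a : ℕ) (m : ℕ+), (a : ℝ≥0∞) * (c a m : ℝ≥0∞) * ENNReal.ofReal x ^ (a - 1)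
    * ENNReal.ofReal y ^ (m : ℕ)

/-- The real-valued function `k(·,1)`. -/
def genFunOne (c : Conc) (x : ℝ) : ℝ := (genFun c x 1).toReal

/-- `α_t = exp ∫_0^t A_s ds`. -/
def alpha (c : ℝ → Conc) (t : ℝ) : ℝ := Real.exp (∫ s in (0 : ℝ)..t, (arms (c s)).toReal)

/-- `β_t = ∫_0^t α_s^{-2} ds`. -/
def beta (c : ℝ → Conc) (t : ℝ) : ℝ := ∫ s in (0 : ℝ)..t, 1 / (alpha c s) ^ 2

/-- `φ_t(x,y) = α_t (x - β_t k_0(x,y))`, for `x, y ∈ [0,1]`. If `k_0(1,y) = ∞` then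
`φ_t(1,y) = -∞` for `t > 0`, and `φ_0(1,y) = 1` by the convention `0 · ∞ = 0`. -/
def phi (c₀ : Conc) (c : ℝ → Conc) (t x y : ℝ) : EReal :=
  (alpha c t : EReal) * ((x : EReal) - (beta c t : EReal) * (genFun c₀ x y : EReal))

/-- `x - k_0(x,1) / k_0'(x,1)`, for `x ∈ (0,1)`. -/
def preG (c₀ : Conc) (x : ℝ) : ℝ := x - genFunOne c₀ x / deriv (genFunOne c₀) x

/-- The function `G` on `[0,1]`, extended to the end points by `G(0) = G(0+)` (possibly `-∞`) and
`G(1) = G(1-)`. -/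
def fnG (c₀ : Conc) (x : ℝ) : EReal :=
  if x = 0 then limUnder (𝓝[>] (0 : ℝ)) (fun z => (preG c₀ z : EReal))
  else if x = 1 then limUnder (𝓝[<] (1 : ℝ)) (fun z => (preG c₀ z : EReal))
  else (preG c₀ x : EReal)

/-- `H : [G(0),G(1)) → [0,1)`, the (right) inverse of `G : [0,1) → [G(0),G(1))`. -/
def fnH (c₀ : Conc) : EReal → ℝ := Function.invFunOn (fnG c₀) (Ico 0 1)

/-- `1 + A_0 T_gel`, which is `1` if `T_gel = 0` (in particular if `A_0 = ∞`). -/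
def startPoint (c₀ : Conc) : ℝ := 1 + (arms c₀ * tGel c₀).toReal

/-- The integrand `1 / k_0(H(1/r),1)` in the definition of `Γ`. -/
def integrandΓ (c₀ : Conc) (r : ℝ) : ℝ := 1 / genFunOne c₀ (fnH c₀ ((1 / r : ℝ) : EReal))

/-- `Γ(x) = 1 + A_0 T_gel + ∫_{1 + A_0 T_gel}^x dr / k_0(H(1/r),1)`, for `x ≥ 1 + A_0 T_gel`. -/
def fnΓ (c₀ : Conc) (x : ℝ) : ℝ := startPoint c₀ + ∫ r in (startPoint c₀)..x, integrandΓ c₀ r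

/-- The inverse of `Γ : [1 + A_0 T_gel, ∞) → [1 + A_0 T_gel, ∞)`. -/
def invΓ (c₀ : Conc) : ℝ → ℝ := Function.invFunOn (fnΓ c₀) (Ici (startPoint c₀))

end ArmsCoag

end

open ArmsCoag

/-!
The equation is solved by separating the loss term. With `α_t = exp ∫ A_s ds` and
`β_t = ∫ α_s⁻² ds`, the numbers `α_t^a c_t(a,m)`, read in the time `β`, satisfy the system without
loss term. There a mass `m` is produced by smaller masses only, so that its solution is a family of
polynomials `P_{a,m}(β)`, and every solution of the original equation has the form
`c_t(a,m) = P_{a,m}(β_t) / α_t^a` (`IsSolution.eq_gainPoly`). The only unknown left is the scalar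
function `α`.

The generating function of the system without loss term solves the inviscid Burgers equation
formally, whence it is `k₀ ∘ h`, where `h` is the *least* solution in `[0,∞]` of `h = z + β k₀(h)`
(`ev_gainSeries`). All sums being sums in `[0,∞]`, no convergence question arises. For `c_t` this
gives `k_t(x,y) = α_t⁻¹ k₀(h_t(x,y), y)`, where `h_t(x,y)` is the least solution of `φ_t(h,y) = x`.

Write `κ = k₀(·,1)` and `M(b) = max_{x ∈ [0,1]} (x - b κ(x))`. Along any solution `1/α_t = M(β_t)`
(`IsSolution.inv_alpha_eq`): if `1/α` were smaller than `M(β)`, the fixed point would lie to the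
left of a point of `[0,1)`, which makes `A`, hence the decrease of `1/α`, too small; if it were
larger, the fixed point would exceed `1`, and `1/α` would decrease too fast. So `β` solves the
autonomous equation `β' = M(β)²`. As `M` is Lipschitz away from `0`, positive at `0`, and not larger
than a linear function near its first zero, this equation has exactly one global solution, the
inverse of the hitting time `b ↦ ∫_0^b M⁻²`. This proves uniqueness (`IsSolution.eq_sol`).
Conversely, the family `P_{a,m}(β_t) / α_t^a` built from this `β` and `α = 1/M(β)` is a solution
(`isSolution_sol`): by the envelope theorem `M' = -κ(ℓ)` at the least maximizer `ℓ`, away from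
countably many points, which gives `α' = κ(ℓ) = α A`; and counting particles with weights `x^a`,
`x ↑ 1`, bounds `∫ A²`.

Suppose that the gelation time is finite, and let `K = κ'(1)`. For `b ≤ 1/K` the maximum defining
`M(b)` is attained at `1` only, so that `M(b) = 1 - b A₀`; the flow needs the time `1/(K - A₀)` to
reach `1/K`, and this is the gelation time. For `b > 1/K` the maximizer `ℓ` lies in `(0,1)`, and
`b κ'(ℓ) = 1`, so that `M(b) = ℓ - κ(ℓ)/κ'(ℓ) = G(ℓ)`; this is `ℓ_t = H(1/α_t)`. It follows that
`α' = κ(H(1/α))` after gelation, and the substitution `r = α_s` in `Γ` gives `Γ(α_t) = α_T + t - T`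
for `T = T_gel` (`integrandΓ_integral`). The limit of `G` at `1` is `M(1/K)`, because `M` is
continuous. The number of arms `A = κ(ℓ)/α` is strictly decreasing and lower semicontinuous, hence
right continuous; on the left continuity is read off from the formulas.

Before gelation `⟨c_t, a(a-1)⟩ ≤ K / (1 - β_t K)` by the mean value inequality
(`factorialMoment_sol_le`). From gelation on `φ_t(·,1)` has slope zero at `ℓ_t` (from the left), so
that its inverse `h_t(·,1)`, and with it `k_t(·,1)`, has infinite slope at `1`
(`factorialMoment_sol_eq_top`).
-/

noncomputable section

namespace ArmsCoag

/-! ### Power series with coefficients in `[0,∞]` -/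

/-- The sum `∑ w_j u^j` in `[0,∞]` of a power series with coefficients in `[0,∞]`. -/
def kser (w : ℕ → ℝ≥0∞) (u : ℝ≥0∞) : ℝ≥0∞ := ∑' j, w j * u ^ j

lemma kser_mono (w : ℕ → ℝ≥0∞) : Monotone (kser w) := fun u v h =>
  ENNReal.tsum_le_tsum fun j => by gcongr

lemma tsum_sum_antidiagonal (F : ℕ × ℕ → ℝ≥0∞) :
    ∑' n, ∑ p ∈ Finset.HasAntidiagonal.antidiagonal n, F p = ∑' p : ℕ × ℕ, F p := by
  rw [← Finset.HasAntidiagonal.sigmaAntidiagonalEquivProd.tsum_eq F, ENNReal.tsum_sigma']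
  refine tsum_congr fun n => ?_
  rw [← Finset.tsum_subtype]
  rfl

/-- Value at `z` of a formal power series over `[0,∞]`. -/
def ev1 (z : ℝ≥0∞) (f : PowerSeries ℝ≥0∞) : ℝ≥0∞ := ∑' j, PowerSeries.coeff j f * z ^ j

/-- Value at `(β, z)` of a formal power series in two variables over `[0,∞]`, encoded as a power
series in the first variable whose coefficients are power series in the second one. -/
def ev (β z : ℝ≥0∞) (F : PowerSeries (PowerSeries ℝ≥0∞)) : ℝ≥0∞ :=
  ∑' n, ev1 z (PowerSeries.coeff n F) * β ^ n

lemma ev1_add (z : ℝ≥0∞) (f g : PowerSeries ℝ≥0∞) : ev1 z (f + g) = ev1 z f + ev1 z g := by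
  simp [ev1, add_mul, ENNReal.tsum_add]

lemma ev1_zero (z : ℝ≥0∞) : ev1 z 0 = 0 := by simp [ev1]

lemma ev1_sum {ι : Type*} (z : ℝ≥0∞) (s : Finset ι) (f : ι → PowerSeries ℝ≥0∞) :
    ev1 z (∑ i ∈ s, f i) = ∑ i ∈ s, ev1 z (f i) := by
  classical
  induction s using Finset.induction_on with
  | empty => simp [ev1_zero]
  | insert a s ha ih => rw [Finset.sum_insert ha, Finset.sum_insert ha, ev1_add, ih]

lemma ev1_mul (z : ℝ≥0∞) (f g : PowerSeries ℝ≥0∞) : ev1 z (f * g) = ev1 z f * ev1 z g := by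
  have h : ∀ n, PowerSeries.coeff n (f * g) * z ^ n = ∑ p ∈ Finset.HasAntidiagonal.antidiagonal n,
      (PowerSeries.coeff p.1 f * z ^ p.1) * (PowerSeries.coeff p.2 g * z ^ p.2) := by
    intro n
    rw [PowerSeries.coeff_mul, Finset.sum_mul]
    refine Finset.sum_congr rfl fun p hp => ?_
    rw [← Finset.HasAntidiagonal.mem_antidiagonal.1 hp, pow_add]
    ring
  unfold ev1
  rw [tsum_congr h, tsum_sum_antidiagonal (fun p =>
    (PowerSeries.coeff p.1 f * z ^ p.1) * (PowerSeries.coeff p.2 g * z ^ p.2)),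
    ENNReal.tsum_prod']
  simp_rw [ENNReal.tsum_mul_left, ENNReal.tsum_mul_right]

lemma ev_add (β z : ℝ≥0∞) (F G : PowerSeries (PowerSeries ℝ≥0∞)) :
    ev β z (F + G) = ev β z F + ev β z G := by
  simp [ev, ev1_add, add_mul, ENNReal.tsum_add]

lemma ev_mul (β z : ℝ≥0∞) (F G : PowerSeries (PowerSeries ℝ≥0∞)) :
    ev β z (F * G) = ev β z F * ev β z G := by
  have h : ∀ n, ev1 z (PowerSeries.coeff n (F * G)) * β ^ n =
      ∑ p ∈ Finset.HasAntidiagonal.antidiagonal n,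
        (ev1 z (PowerSeries.coeff p.1 F) * β ^ p.1) *
          (ev1 z (PowerSeries.coeff p.2 G) * β ^ p.2) := by
    intro n
    rw [PowerSeries.coeff_mul, ev1_sum, Finset.sum_mul]
    refine Finset.sum_congr rfl fun p hp => ?_
    rw [← Finset.HasAntidiagonal.mem_antidiagonal.1 hp, pow_add, ev1_mul]
    ring
  unfold ev
  rw [tsum_congr h, tsum_sum_antidiagonal (fun p =>
    (ev1 z (PowerSeries.coeff p.1 F) * β ^ p.1) * (ev1 z (PowerSeries.coeff p.2 G) * β ^ p.2)),
    ENNReal.tsum_prod']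
  simp_rw [ENNReal.tsum_mul_left, ENNReal.tsum_mul_right]

lemma ev_C (β z : ℝ≥0∞) (f : PowerSeries ℝ≥0∞) : ev β z (PowerSeries.C f) = ev1 z f := by
  unfold ev
  rw [tsum_eq_single 0]
  · simp
  · intro n hn
    simp [PowerSeries.coeff_C, hn, ev1_zero]

lemma ev1_X (z : ℝ≥0∞) : ev1 z PowerSeries.X = z := by
  unfold ev1
  rw [tsum_eq_single 1]
  · simp
  · intro n hn
    simp [PowerSeries.coeff_X, hn]

lemma ev1_one (z : ℝ≥0∞) : ev1 z 1 = 1 := by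
  unfold ev1
  rw [tsum_eq_single 0]
  · simp
  · intro n hn
    simp [PowerSeries.coeff_one, hn]

lemma ev_one (β z : ℝ≥0∞) : ev β z 1 = 1 := by
  rw [← map_one (PowerSeries.C (R := PowerSeries ℝ≥0∞)), ev_C, ev1_one]

lemma ev_X (β z : ℝ≥0∞) : ev β z PowerSeries.X = β := by
  unfold ev
  rw [tsum_eq_single 1]
  · simp [ev1_one]
  · intro n hn
    simp [PowerSeries.coeff_X, hn, ev1_zero]

lemma ev_pow (β z : ℝ≥0∞) (F : PowerSeries (PowerSeries ℝ≥0∞)) (i : ℕ) :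
    ev β z (F ^ i) = ev β z F ^ i := by
  induction i with
  | zero => simp [ev_one]
  | succ i ih => rw [pow_succ, pow_succ, ev_mul, ih]

/-- Formal derivative in the second variable. -/
def dz (F : PowerSeries (PowerSeries ℝ≥0∞)) : PowerSeries (PowerSeries ℝ≥0∞) :=
  PowerSeries.mk fun n => PowerSeries.derivative ℝ≥0∞ (PowerSeries.coeff n F)

lemma dz_add (F G : PowerSeries (PowerSeries ℝ≥0∞)) : dz (F + G) = dz F + dz G := by
  ext1 n
  simp [dz]

lemma dz_mul (F G : PowerSeries (PowerSeries ℝ≥0∞)) : dz (F * G) = F * dz G + dz F * G := by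
  ext1 n
  simp only [dz, PowerSeries.coeff_mk, PowerSeries.coeff_mul, map_sum, Derivation.leibniz, map_add,
    smul_eq_mul, Finset.sum_add_distrib]
  congr 1
  exact Finset.sum_congr rfl fun p _ => mul_comm _ _

lemma derivative_mul {S : Type*} [CommSemiring S] (F G : PowerSeries S) :
    PowerSeries.derivative S (F * G) =
      F * PowerSeries.derivative S G + PowerSeries.derivative S F * G := by
  rw [Derivation.leibniz, smul_eq_mul, smul_eq_mul, mul_comm G]

lemma dz_one : dz 1 = 0 := by
  ext1 n
  simp only [dz, PowerSeries.coeff_mk, PowerSeries.coeff_one]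
  split_ifs <;> simp

/-- The formal change of variable `u = z + β B`. -/
def shift (B : PowerSeries (PowerSeries ℝ≥0∞)) : PowerSeries (PowerSeries ℝ≥0∞) :=
  PowerSeries.C PowerSeries.X + PowerSeries.X * B

lemma ev_shift (β z : ℝ≥0∞) (B : PowerSeries (PowerSeries ℝ≥0∞)) :
    ev β z (shift B) = z + β * ev β z B := by
  rw [shift, ev_add, ev_mul, ev_C, ev1_X, ev_X]

local notation "dβ" => PowerSeries.derivative (PowerSeries ℝ≥0∞)

/-- If `B` solves the inviscid Burgers equation then `u = z + βB` is transported by `B`. -/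
lemma derivative_shift {B : PowerSeries (PowerSeries ℝ≥0∞)} (hB : dβ B = B * dz B) :
    dβ (shift B) = B * dz (shift B) := by
  have h1 : dz (PowerSeries.C PowerSeries.X) = 1 := by
    ext1 n
    simp only [dz, PowerSeries.coeff_mk, PowerSeries.coeff_C, PowerSeries.coeff_one]
    split_ifs <;> simp
  have h2 : dz PowerSeries.X = 0 := by
    ext1 n
    simp only [dz, PowerSeries.coeff_mk, PowerSeries.coeff_X]
    split_ifs <;> simp
  rw [shift, dz_add, dz_mul, h1, h2, map_add, PowerSeries.derivative_C, derivative_mul,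
    PowerSeries.derivative_X, hB]
  ring

lemma derivative_shift_pow {B : PowerSeries (PowerSeries ℝ≥0∞)} (hB : dβ B = B * dz B) (i : ℕ) :
    dβ (shift B ^ i) = B * dz (shift B ^ i) := by
  induction i with
  | zero => rw [pow_zero, dz_one, PowerSeries.derivative_one, mul_zero]
  | succ i ih =>
    rw [pow_succ, derivative_mul, dz_mul, ih, derivative_shift hB]
    ring

/-- Coefficients of a solution of the transport equation `∂_β F = B ∂_z F`. -/
lemma coeff_transport {B F : PowerSeries (PowerSeries ℝ≥0∞)} (hF : dβ F = B * dz F) (n j : ℕ) :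
    PowerSeries.coeff j (PowerSeries.coeff (n + 1) F) * ((n : ℝ≥0∞) + 1) =
      ∑ p ∈ Finset.HasAntidiagonal.antidiagonal n, ∑ r ∈ Finset.HasAntidiagonal.antidiagonal j,
        PowerSeries.coeff r.1 (PowerSeries.coeff p.1 B) *
          (PowerSeries.coeff (r.2 + 1) (PowerSeries.coeff p.2 F) * ((r.2 : ℝ≥0∞) + 1)) := by
  have h := congrArg (fun G => PowerSeries.coeff j (PowerSeries.coeff n G)) hF
  simp only [PowerSeries.coeff_derivative, PowerSeries.coeff_mul, dz, PowerSeries.coeff_mk,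
    map_sum] at h
  rw [← h]
  have h3 : ((n : PowerSeries ℝ≥0∞) + 1) = PowerSeries.C ((n : ℝ≥0∞) + 1) := by simp
  rw [← PowerSeries.coeff_mul_C, ← h3, PowerSeries.coeff_mul]

/-- `B = ∑ w_i u^i` coefficientwise: both sides have the same initial value and solve the transport
equation `∂_β F = B ∂_z F`, which determines the coefficients recursively. -/
lemma coeff_eq_tsum_coeff_shift_pow {B : PowerSeries (PowerSeries ℝ≥0∞)}
    (hB : dβ B = B * dz B) {w : ℕ → ℝ≥0∞}
    (hw : ∀ j, PowerSeries.coeff j (PowerSeries.coeff 0 B) = w j) (n : ℕ) : ∀ j,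
    PowerSeries.coeff j (PowerSeries.coeff n B) =
      ∑' i, w i * PowerSeries.coeff j (PowerSeries.coeff n (shift B ^ i)) := by
  induction n using Nat.strong_induction_on with
  | _ n ih =>
    intro j
    cases n with
    | zero =>
      have h : ∀ i, PowerSeries.coeff 0 (shift B ^ i) = PowerSeries.X ^ i := by
        intro i
        rw [PowerSeries.coeff_zero_eq_constantCoeff_apply, map_pow]
        simp [shift]
      simp_rw [h, PowerSeries.coeff_X_pow]
      rw [hw, tsum_eq_single j]
      · simp
      · intro i hi
        simp [hi.symm]
    | succ n =>
      have hn : ((n : ℝ≥0∞) + 1) ≠ 0 := by simp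
      have hn' : ((n : ℝ≥0∞) + 1) ≠ ⊤ := by simp
      refine (ENNReal.mul_left_inj hn hn').1 ?_
      rw [coeff_transport hB, ← ENNReal.tsum_mul_right]
      simp_rw [mul_assoc, coeff_transport (derivative_shift_pow hB _), Finset.mul_sum]
      rw [Summable.tsum_finsetSum fun _ _ => ENNReal.summable]
      refine Finset.sum_congr rfl fun p hp => ?_
      rw [Summable.tsum_finsetSum fun _ _ => ENNReal.summable]
      refine Finset.sum_congr rfl fun r _ => ?_
      rw [ih p.2 (by have := Finset.HasAntidiagonal.mem_antidiagonal.1 hp; omega),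
        ← ENNReal.tsum_mul_right, ← ENNReal.tsum_mul_left]
      exact tsum_congr fun i => by ring

/-- A formal solution of the inviscid Burgers equation satisfies `B = k(z + βB)`, where `k` is its
initial value. -/
theorem ev_eq_kser_shift {B : PowerSeries (PowerSeries ℝ≥0∞)}
    (hB : dβ B = B * dz B) {w : ℕ → ℝ≥0∞}
    (hw : ∀ j, PowerSeries.coeff j (PowerSeries.coeff 0 B) = w j) (β z : ℝ≥0∞) :
    ev β z B = kser w (z + β * ev β z B) := by
  conv_lhs => unfold ev ev1
  simp_rw [coeff_eq_tsum_coeff_shift_pow hB hw, kser, ← ev_shift, ← ev_pow, ev, ev1,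
    ← ENNReal.tsum_mul_right, ← ENNReal.tsum_mul_left]
  have h : ∀ n : ℕ, ∑' (i : ℕ) (j : ℕ),
      w j * PowerSeries.coeff i (PowerSeries.coeff n (shift B ^ j)) * z ^ i * β ^ n =
      ∑' (j : ℕ) (i : ℕ),
        w j * (PowerSeries.coeff i (PowerSeries.coeff n (shift B ^ j)) * z ^ i * β ^ n) := by
    intro n
    rw [ENNReal.tsum_comm]
    simp only [mul_assoc]
  rw [tsum_congr h, ENNReal.tsum_comm]

/-- The part of `B` of degree less than `n` in the first variable. -/
def cut (n : ℕ) (B : PowerSeries (PowerSeries ℝ≥0∞)) : PowerSeries (PowerSeries ℝ≥0∞) :=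
  PowerSeries.mk fun i => if i < n then PowerSeries.coeff i B else 0

/-- The factor `β` in `u = z + β B` makes the coefficients of `u^i` up to `β^n` depend on those of
`B` below `β^n` only. -/
lemma coeff_shift_pow_cut (B : PowerSeries (PowerSeries ℝ≥0∞)) (n i : ℕ) : ∀ p ≤ n,
    PowerSeries.coeff p (shift B ^ i) = PowerSeries.coeff p (shift (cut n B) ^ i) := by
  induction i with
  | zero => simp
  | succ i ih =>
    intro p hp
    rw [pow_succ, pow_succ, PowerSeries.coeff_mul, PowerSeries.coeff_mul]
    refine Finset.sum_congr rfl fun r hr => ?_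
    have hr := Finset.HasAntidiagonal.mem_antidiagonal.1 hr
    rw [ih r.1 (by omega)]
    congr 1
    rw [shift, shift, map_add, map_add]
    congr 1
    rcases h2 : r.2 with _ | s
    · simp
    · rw [PowerSeries.coeff_succ_X_mul, PowerSeries.coeff_succ_X_mul, cut, PowerSeries.coeff_mk,
        if_pos (by omega)]

/-- A formal solution of the inviscid Burgers equation is bounded by any pre-fixed point of
`h ↦ z + β k(h)`. -/
theorem shift_le_of_prefixed {B : PowerSeries (PowerSeries ℝ≥0∞)}
    (hB : dβ B = B * dz B) {w : ℕ → ℝ≥0∞}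
    (hw : ∀ j, PowerSeries.coeff j (PowerSeries.coeff 0 B) = w j) {β z h : ℝ≥0∞}
    (hh : z + β * kser w h ≤ h) : z + β * ev β z B ≤ h := by
  -- the truncations in `β` are bounded one after the other
  have key : ∀ n, z + β * ev β z (cut n B) ≤ h := by
    intro n
    induction n with
    | zero =>
      have : ev β z (cut 0 B) = 0 := by simp [ev, cut, ev1_zero]
      rw [this, mul_zero, add_zero]
      exact le_self_add.trans hh
    | succ n ih =>
      have h1 : ev β z (cut (n + 1) B) ≤ kser w (z + β * ev β z (cut n B)) := by
        have h2 : kser w (z + β * ev β z (cut n B)) =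
            ∑' n' : ℕ, ∑' j : ℕ, ∑' i : ℕ, w i *
              PowerSeries.coeff j (PowerSeries.coeff n' (shift (cut n B) ^ i)) * z ^ j *
                β ^ n' := by
          simp_rw [kser, ← ev_shift, ← ev_pow, ev, ev1, ← ENNReal.tsum_mul_right,
            ← ENNReal.tsum_mul_left]
          rw [ENNReal.tsum_comm]
          refine tsum_congr fun p => ?_
          rw [ENNReal.tsum_comm]
          simp only [mul_assoc]
        rw [h2]
        unfold ev ev1
        refine ENNReal.tsum_le_tsum fun p => ?_
        rw [cut, PowerSeries.coeff_mk]
        split_ifs with hp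
        · rw [← ENNReal.tsum_mul_right]
          refine ENNReal.tsum_le_tsum fun j => ?_
          rw [coeff_eq_tsum_coeff_shift_pow hB hw, ← ENNReal.tsum_mul_right,
            ← ENNReal.tsum_mul_right]
          refine ENNReal.tsum_le_tsum fun i => ?_
          rw [coeff_shift_pow_cut B n i p (by omega)]
        · simp
      calc z + β * ev β z (cut (n + 1) B) ≤ z + β * kser w h := by
            gcongr
            exact h1.trans (kser_mono w ih)
        _ ≤ h := hh
  rcases eq_or_ne h ⊤ with rfl | hfin
  · exact le_top
  have hsup : ev β z B = ⨆ n, ev β z (cut n B) := by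
    unfold ev
    rw [ENNReal.tsum_eq_iSup_nat]
    apply le_antisymm
    · refine iSup_mono fun n => ?_
      refine le_trans (le_of_eq ?_) (ENNReal.sum_le_tsum (Finset.range n))
      refine Finset.sum_congr rfl fun i hi => ?_
      rw [cut, PowerSeries.coeff_mk, if_pos (Finset.mem_range.1 hi)]
    · refine iSup_le fun n => ?_
      rw [ENNReal.tsum_eq_iSup_nat]
      refine iSup_mono fun m => Finset.sum_le_sum fun i _ => ?_
      rw [cut, PowerSeries.coeff_mk]
      split_ifs
      · exact le_rfl
      · simp [ev1_zero]
  rw [hsup, ENNReal.mul_iSup, ENNReal.add_iSup]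
  exact iSup_le key

/-! ### The coagulation system without loss term -/

/-- Coefficients, in powers of time, of the solution of the system in which the loss term is
dropped: `gainCoeff c₀ n a m` collects the ways to build a particle with `a` arms and mass `m` in
`n` coagulations. -/
def gainCoeff (c₀ : Conc) : ℕ → Conc
  | 0 => c₀
  | n + 1 => fun a m => (2 * ((n : ℝ≥0) + 1))⁻¹ * ∑ i : Fin (n + 1),
      ∑ a' ∈ Finset.Icc 1 (a + 1), ∑ m' ∈ Finset.Ico 1 m,
        (a' : ℝ≥0) * ((a + 2 - a' : ℕ) : ℝ≥0) * gainCoeff c₀ i a' m' *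
          gainCoeff c₀ (n - i) (a + 2 - a') (m - m')

lemma gainCoeff_zero (c₀ : Conc) : gainCoeff c₀ 0 = c₀ := by rw [gainCoeff]

lemma gainCoeff_succ (c₀ : Conc) (n a : ℕ) (m : ℕ+) :
    2 * (((n : ℝ≥0) + 1) * gainCoeff c₀ (n + 1) a m) =
      ∑ p ∈ Finset.HasAntidiagonal.antidiagonal n,
        ∑ a' ∈ Finset.Icc 1 (a + 1), ∑ m' ∈ Finset.Ico 1 m,
        (a' : ℝ≥0) * ((a + 2 - a' : ℕ) : ℝ≥0) * gainCoeff c₀ p.1 a' m' *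
          gainCoeff c₀ p.2 (a + 2 - a') (m - m') := by
  rw [gainCoeff, ← mul_assoc, mul_inv_cancel_left₀ (by positivity)]
  rw [Finset.Nat.sum_antidiagonal_eq_sum_range_succ (fun i j =>
    ∑ a' ∈ Finset.Icc 1 (a + 1), ∑ m' ∈ Finset.Ico 1 m,
        (a' : ℝ≥0) * ((a + 2 - a' : ℕ) : ℝ≥0) * gainCoeff c₀ i a' m' *
          gainCoeff c₀ j (a + 2 - a') (m - m')), ← Fin.sum_univ_eq_sum_range (fun i =>
    ∑ a' ∈ Finset.Icc 1 (a + 1), ∑ m' ∈ Finset.Ico 1 m,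
        (a' : ℝ≥0) * ((a + 2 - a' : ℕ) : ℝ≥0) * gainCoeff c₀ i a' m' *
          gainCoeff c₀ (n - i) (a + 2 - a') (m - m'))]

/-- A particle of mass `m` arises from fewer than `m` coagulations. -/
lemma gainCoeff_eq_zero (c₀ : Conc) (n : ℕ) : ∀ (a : ℕ) (m : ℕ+), (m : ℕ) ≤ n →
    gainCoeff c₀ n a m = 0 := by
  induction n using Nat.strong_induction_on with
  | _ n ih =>
    intro a m hm
    cases n with
    | zero => exact absurd hm (by have := m.pos; omega)
    | succ n =>
      have h := gainCoeff_succ c₀ n a m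
      rw [Finset.sum_eq_zero] at h
      · have : ((n : ℝ≥0) + 1) ≠ 0 := by positivity
        simpa [this] using h
      · intro p hp
        have hp := Finset.HasAntidiagonal.mem_antidiagonal.1 hp
        refine Finset.sum_eq_zero fun a' _ => Finset.sum_eq_zero fun m' hm' => ?_
        have hm' := (Finset.mem_Ico.1 hm').2
        have h1 : ((m - m' : ℕ+) : ℕ) = m - m' := by rw [PNat.sub_coe, if_pos hm']
        have h2 : (m' : ℕ) < m := hm'
        by_cases h3 : (m' : ℕ) ≤ p.1
        · rw [ih p.1 (by omega) a' m' h3]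
          ring
        · rw [ih p.2 (by omega) (a + 2 - a') (m - m') (by omega)]
          ring

/-- The solution of the system without loss term, as a polynomial in time. -/
def gainPoly (c₀ : Conc) (a : ℕ) (m : ℕ+) : Polynomial ℝ :=
  ∑ n ∈ Finset.range m, Polynomial.monomial n (gainCoeff c₀ n a m : ℝ)

lemma coeff_gainPoly (c₀ : Conc) (a : ℕ) (m : ℕ+) (n : ℕ) :
    (gainPoly c₀ a m).coeff n = gainCoeff c₀ n a m := by
  rw [gainPoly, Polynomial.finsetSum_coeff]
  simp_rw [Polynomial.coeff_monomial]
  rw [Finset.sum_ite_eq']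
  split_ifs with h
  · rfl
  · rw [gainCoeff_eq_zero c₀ n a m (by simpa using h), NNReal.coe_zero]

lemma derivative_gainPoly (c₀ : Conc) (a : ℕ) (m : ℕ+) :
    (gainPoly c₀ a m).derivative = Polynomial.C (1 / 2) *
      ∑ a' ∈ Finset.Icc 1 (a + 1), ∑ m' ∈ Finset.Ico 1 m,
        Polynomial.C ((a' : ℝ) * ((a + 2 - a' : ℕ) : ℝ)) *
          (gainPoly c₀ a' m' * gainPoly c₀ (a + 2 - a') (m - m')) := by
  ext n
  have h := congrArg (fun x : ℝ≥0 => (x : ℝ)) (gainCoeff_succ c₀ n a m)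
  simp only [NNReal.coe_mul, NNReal.coe_sum, NNReal.coe_add, NNReal.coe_natCast, NNReal.coe_ofNat,
    NNReal.coe_one] at h
  rw [Polynomial.coeff_derivative, coeff_gainPoly, Polynomial.coeff_C_mul,
    Polynomial.finsetSum_coeff]
  simp_rw [Polynomial.finsetSum_coeff, Polynomial.coeff_C_mul, Polynomial.coeff_mul,
    coeff_gainPoly, Finset.mul_sum]
  rw [mul_comm, ← mul_right_inj' (two_ne_zero (α := ℝ)), h, Finset.sum_comm, Finset.mul_sum]
  refine Finset.sum_congr rfl fun a' _ => ?_
  rw [Finset.sum_comm, Finset.mul_sum]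
  refine Finset.sum_congr rfl fun m' _ => ?_
  rw [Finset.mul_sum]
  refine Finset.sum_congr rfl fun p _ => ?_
  ring

lemma eval_gainPoly (c₀ : Conc) (a : ℕ) (m : ℕ+) (β : ℝ) :
    (gainPoly c₀ a m).eval β = ∑ n ∈ Finset.range m, (gainCoeff c₀ n a m : ℝ) * β ^ n := by
  rw [gainPoly, Polynomial.eval_finsetSum]
  simp_rw [Polynomial.eval_monomial]

lemma eval_gainPoly_nonneg (c₀ : Conc) (a : ℕ) (m : ℕ+) {β : ℝ} (hβ : 0 ≤ β) :
    0 ≤ (gainPoly c₀ a m).eval β := by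
  rw [eval_gainPoly]
  positivity

lemma eval_gainPoly_zero (c₀ : Conc) (a : ℕ) (m : ℕ+) :
    (gainPoly c₀ a m).eval 0 = c₀ a m := by
  rw [← Polynomial.coeff_zero_eq_eval_zero, coeff_gainPoly, gainCoeff_zero]

/-! ### Summation over masses -/

lemma tsum_pnat_conv (F : ℕ+ → ℕ+ → ℝ≥0∞) :
    ∑' m : ℕ+, ∑ m' ∈ Finset.Ico 1 m, F m' (m - m') = ∑' (m' : ℕ+) (k : ℕ+), F m' k := by
  have h1 : ∀ m : ℕ+, ∑ m' ∈ Finset.Ico 1 m, F m' (m - m') =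
      ∑' m' : ℕ+, if m' < m then F m' (m - m') else 0 := by
    intro m
    rw [tsum_eq_sum (s := Finset.Ico 1 m)]
    · exact Finset.sum_congr rfl fun m' hm' => by rw [if_pos (Finset.mem_Ico.1 hm').2]
    · intro m' hm'
      rw [if_neg]
      exact fun h => hm' (Finset.mem_Ico.2 ⟨one_le, h⟩)
  rw [tsum_congr h1, ENNReal.tsum_comm]
  refine tsum_congr fun m' => ?_
  have hinj : Function.Injective (fun k : ℕ+ => m' + k) := fun a b h => by simpa using h
  rw [← hinj.tsum_eq]
  · refine tsum_congr fun k => ?_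
    rw [if_pos (PNat.lt_add_right m' k), add_comm m' k, PNat.add_sub]
  · intro m hm
    by_cases h : m' < m
    · exact ⟨m - m', PNat.add_sub_of_lt h⟩
    · simp [h] at hm

lemma sum_antidiagonal_eq_sum_Icc {M : Type*} [AddCommMonoid M] (f : ℕ → ℕ → M) (n : ℕ) :
    ∑ r ∈ Finset.HasAntidiagonal.antidiagonal n, f (r.1 + 1) (r.2 + 1) =
      ∑ a ∈ Finset.Icc 1 (n + 1), f a (n + 2 - a) := by
  rw [Finset.Nat.sum_antidiagonal_eq_sum_range_succ (fun i j => f (i + 1) (j + 1)),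
    Finset.range_eq_Ico]
  have : Finset.Icc 1 (n + 1) = Finset.Ico (0 + 1) (n + 1 + 1) := by
    ext; simp only [Finset.mem_Icc, Finset.mem_Ico]; omega
  rw [this, ← Finset.sum_Ico_add' (fun a => f a (n + 2 - a)) 0 (n + 1) 1]
  refine Finset.sum_congr rfl fun i hi => ?_
  have := (Finset.mem_Ico.1 hi).2
  congr 1
  omega

/-- `∑_m y^m c(a,m)` for the coefficients of the system without loss term. -/
def massSum (c₀ : Conc) (y : ℝ≥0∞) (n a : ℕ) : ℝ≥0∞ :=
  ∑' m : ℕ+, (gainCoeff c₀ n a m : ℝ≥0∞) * y ^ (m : ℕ)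

lemma massSum_succ (c₀ : Conc) (y : ℝ≥0∞) (n a : ℕ) :
    2 * (((n : ℝ≥0∞) + 1) * massSum c₀ y (n + 1) a) =
      ∑ p ∈ Finset.HasAntidiagonal.antidiagonal n, ∑ r ∈ Finset.HasAntidiagonal.antidiagonal a,
        (((r.1 + 1 : ℕ) : ℝ≥0∞) * massSum c₀ y p.1 (r.1 + 1)) *
          (((r.2 + 1 : ℕ) : ℝ≥0∞) * massSum c₀ y p.2 (r.2 + 1)) := by
  have h : ∀ m : ℕ+, 2 * (((n : ℝ≥0∞) + 1) * ((gainCoeff c₀ (n + 1) a m : ℝ≥0∞) * y ^ (m : ℕ))) =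
      ∑ p ∈ Finset.HasAntidiagonal.antidiagonal n, ∑ a' ∈ Finset.Icc 1 (a + 1),
        ∑ m' ∈ Finset.Ico 1 m,
        ((a' : ℝ≥0∞) * ((gainCoeff c₀ p.1 a' m' : ℝ≥0∞) * y ^ (m' : ℕ))) *
          (((a + 2 - a' : ℕ) : ℝ≥0∞) *
            ((gainCoeff c₀ p.2 (a + 2 - a') (m - m') : ℝ≥0∞) * y ^ ((m - m' : ℕ+) : ℕ))) := by
    intro m
    have h1 := congrArg (fun x : ℝ≥0 => (x : ℝ≥0∞)) (gainCoeff_succ c₀ n a m)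
    simp only [ENNReal.coe_mul, ENNReal.ofNNReal_finsetSum, ENNReal.coe_add, ENNReal.coe_natCast,
      ENNReal.coe_ofNat, ENNReal.coe_one] at h1
    rw [← mul_assoc (_ + _), ← mul_assoc, h1, Finset.sum_mul]
    refine Finset.sum_congr rfl fun p _ => ?_
    rw [Finset.sum_mul]
    refine Finset.sum_congr rfl fun a' _ => ?_
    rw [Finset.sum_mul]
    refine Finset.sum_congr rfl fun m' hm' => ?_
    have h3 : (m : ℕ) = m' + (m - m' : ℕ+) := by
      rw [← PNat.add_coe, PNat.add_sub_of_lt (Finset.mem_Ico.1 hm').2]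
    rw [h3, pow_add]
    ring
  rw [massSum, ← ENNReal.tsum_mul_left, ← ENNReal.tsum_mul_left, tsum_congr h,
    Summable.tsum_finsetSum fun _ _ => ENNReal.summable]
  refine Finset.sum_congr rfl fun p _ => ?_
  rw [Summable.tsum_finsetSum fun _ _ => ENNReal.summable,
    sum_antidiagonal_eq_sum_Icc (fun i j => ((i : ℝ≥0∞) * massSum c₀ y p.1 i) *
      ((j : ℝ≥0∞) * massSum c₀ y p.2 j))]
  refine Finset.sum_congr rfl fun a' _ => ?_
  rw [tsum_pnat_conv (fun m' k => ((a' : ℝ≥0∞) * ((gainCoeff c₀ p.1 a' m' : ℝ≥0∞) * y ^ (m' : ℕ))) *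
          (((a + 2 - a' : ℕ) : ℝ≥0∞) *
            ((gainCoeff c₀ p.2 (a + 2 - a') k : ℝ≥0∞) * y ^ (k : ℕ))))]
  simp_rw [ENNReal.tsum_mul_left, ENNReal.tsum_mul_right, ENNReal.tsum_mul_left]
  rfl

/-- The generating function of the system without loss term, as a formal power series in time and
in the variable dual to the number of arms. -/
def gainSeries (c₀ : Conc) (y : ℝ≥0∞) : PowerSeries (PowerSeries ℝ≥0∞) :=
  PowerSeries.mk fun n => PowerSeries.mk fun j => ((j + 1 : ℕ) : ℝ≥0∞) * massSum c₀ y n (j + 1)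

/-- The system without loss term amounts to the inviscid Burgers equation. -/
lemma derivative_gainSeries (c₀ : Conc) (y : ℝ≥0∞) :
    PowerSeries.derivative (PowerSeries ℝ≥0∞) (gainSeries c₀ y) =
      gainSeries c₀ y * dz (gainSeries c₀ y) := by
  have h2 : gainSeries c₀ y * dz (gainSeries c₀ y) + gainSeries c₀ y * dz (gainSeries c₀ y) =
      dz (gainSeries c₀ y * gainSeries c₀ y) := by
    rw [dz_mul]
    ring
  ext n j
  have h3 := congrArg (fun G => PowerSeries.coeff j (PowerSeries.coeff n G)) h2
  refine (ENNReal.mul_right_inj (two_ne_zero) (ENNReal.ofNat_ne_top (n := 2))).1 ?_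
  simp only [map_add] at h3
  rw [two_mul (PowerSeries.coeff j (PowerSeries.coeff n (gainSeries c₀ y * dz (gainSeries c₀ y)))),
    h3, dz, PowerSeries.coeff_mk, PowerSeries.coeff_derivative, PowerSeries.coeff_derivative]
  have h4 : ((n : PowerSeries ℝ≥0∞) + 1) = PowerSeries.C ((n : ℝ≥0∞) + 1) := by simp
  rw [h4, PowerSeries.coeff_mul_C, PowerSeries.coeff_mul n (gainSeries c₀ y), map_sum]
  simp only [gainSeries, PowerSeries.coeff_mk, PowerSeries.coeff_mul]
  have h5 := massSum_succ c₀ y n (j + 1)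
  rw [← h5]
  push_cast
  ring

/-- The generating function of arms as a power series `∑ w_j x^j` at a given mass variable `y`. -/
def armCoeff (c : Conc) (y : ℝ≥0∞) (j : ℕ) : ℝ≥0∞ :=
  ((j + 1 : ℕ) : ℝ≥0∞) * ∑' m : ℕ+, (c (j + 1) m : ℝ≥0∞) * y ^ (m : ℕ)

lemma genFun_eq_kser (c : Conc) (x y : ℝ) :
    genFun c x y = kser (armCoeff c (ENNReal.ofReal y)) (ENNReal.ofReal x) := by
  rw [genFun, tsum_eq_zero_add' ENNReal.summable]
  simp only [Nat.cast_zero, zero_mul, tsum_zero, zero_add, Nat.add_sub_cancel]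
  refine tsum_congr fun j => ?_
  rw [armCoeff, mul_assoc, ← ENNReal.tsum_mul_right, ← ENNReal.tsum_mul_left]
  exact tsum_congr fun m => by ring

lemma coeff_coeff_zero_gainSeries (c₀ : Conc) (y : ℝ≥0∞) (j : ℕ) :
    PowerSeries.coeff j (PowerSeries.coeff 0 (gainSeries c₀ y)) = armCoeff c₀ y j := by
  simp [gainSeries, massSum, armCoeff, gainCoeff_zero]

/-- Generating function of the concentrations `α^{-a} P_{a,m}(β)`, where `P` solves the system
without loss term. -/
lemma genFun_eq_ev {c₀ c : Conc} {α β : ℝ} (hα : 0 < α) (hβ : 0 ≤ β)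
    (hc : ∀ a m, (c a m : ℝ) = (gainPoly c₀ a m).eval β / α ^ a) (x y : ℝ) :
    genFun c x y = (ENNReal.ofReal α)⁻¹ *
      ev (ENNReal.ofReal β) (ENNReal.ofReal x / ENNReal.ofReal α)
        (gainSeries c₀ (ENNReal.ofReal y)) := by
  set A := ENNReal.ofReal α with hA
  have hA0 : A ≠ 0 := by simpa [hA] using hα
  have hAt : A ≠ ⊤ := ENNReal.ofReal_ne_top
  have h1 : ∀ a m, (c a m : ℝ≥0∞) =
      A⁻¹ ^ a * ∑' n, (gainCoeff c₀ n a m : ℝ≥0∞) * ENNReal.ofReal β ^ n := by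
    intro a m
    rw [← ENNReal.ofReal_coe_nnreal, hc, div_eq_inv_mul, eval_gainPoly,
      ENNReal.ofReal_mul (by positivity), ← inv_pow, ENNReal.ofReal_pow (by positivity),
      ENNReal.ofReal_inv_of_pos hα, ENNReal.ofReal_sum_of_nonneg (fun _ _ => by positivity)]
    congr 1
    rw [tsum_eq_sum (s := Finset.range m)]
    · refine Finset.sum_congr rfl fun n _ => ?_
      rw [ENNReal.ofReal_mul (by positivity), ENNReal.ofReal_pow hβ, ENNReal.ofReal_coe_nnreal]
    · intro n hn
      rw [gainCoeff_eq_zero c₀ n a m (by simpa using hn)]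
      simp
  rw [genFun_eq_kser, kser, ev]
  simp only [ev1, ← ENNReal.tsum_mul_right]
  rw [ENNReal.tsum_comm, ← ENNReal.tsum_mul_left]
  refine tsum_congr fun j => ?_
  simp only [armCoeff, h1, gainSeries, PowerSeries.coeff_mk, massSum, ← ENNReal.tsum_mul_right,
    ← ENNReal.tsum_mul_left]
  rw [ENNReal.tsum_comm]
  refine tsum_congr fun n => tsum_congr fun m => ?_
  rw [div_eq_mul_inv, mul_pow]
  ring

/-! ### The least solution of `h = z + β k(h)` -/

/-- The least solution `h ∈ [0,∞]` of `h = z + β k(h)`. -/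
def lfix (w : ℕ → ℝ≥0∞) (z β : ℝ≥0∞) : ℝ≥0∞ :=
  OrderHom.lfp ⟨fun h => z + β * kser w h, fun _ _ h => by
    have := kser_mono w h
    dsimp only
    gcongr⟩

lemma lfix_eq (w : ℕ → ℝ≥0∞) (z β : ℝ≥0∞) : z + β * kser w (lfix w z β) = lfix w z β :=
  OrderHom.map_lfp ⟨fun h => z + β * kser w h, fun _ _ h => by
    have := kser_mono w h
    dsimp only
    gcongr⟩

lemma lfix_le {w : ℕ → ℝ≥0∞} {z β h : ℝ≥0∞} (hh : z + β * kser w h ≤ h) : lfix w z β ≤ h :=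
  OrderHom.lfp_le _ hh

/-- For the system without loss term, the generating function is `k` composed with the least
solution of `h = z + β k(h)`. -/
theorem ev_gainSeries (c₀ : Conc) (y β z : ℝ≥0∞) :
    ev β z (gainSeries c₀ y) = kser (armCoeff c₀ y) (lfix (armCoeff c₀ y) z β) := by
  have h1 := derivative_gainSeries c₀ y
  have h2 := coeff_coeff_zero_gainSeries c₀ y
  have h3 : lfix (armCoeff c₀ y) z β = z + β * ev β z (gainSeries c₀ y) := by
    apply le_antisymm
    · apply lfix_le
      rw [← ev_eq_kser_shift h1 h2]
    · exact shift_le_of_prefixed h1 h2 (lfix_eq _ _ _).le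
  rw [h3]
  exact ev_eq_kser_shift h1 h2 β z

/-! ### Real-valued series -/

/-- A non-zero sequence growing at most linearly: the coefficients of the generating function of
arms of a system with `⟨c, 1⟩ < ∞`. -/
structure IsArmSeries (w : ℕ → ℝ≥0∞) : Prop where
  le : ∃ N : ℝ≥0, ∀ j, w j ≤ ((j + 1 : ℕ) : ℝ≥0∞) * N
  ne : ∃ j, w j ≠ 0

lemma IsArmSeries.ne_top {w : ℕ → ℝ≥0∞} (hw : IsArmSeries w) (j : ℕ) : w j ≠ ⊤ := by
  obtain ⟨N, hN⟩ := hw.le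
  exact ((hN j).trans_lt (ENNReal.mul_lt_top (ENNReal.natCast_lt_top _) ENNReal.coe_lt_top)).ne

lemma kser_lt_top {w : ℕ → ℝ≥0∞} (hw : IsArmSeries w) {x : ℝ} (h0 : 0 ≤ x) (h1 : x < 1) :
    kser w (ENNReal.ofReal x) < ⊤ := by
  obtain ⟨N, hN⟩ := hw.le
  have h : Summable fun j : ℕ => ((j : ℝ) ^ 1 * x ^ j + x ^ j) * N := by
    refine Summable.mul_right _ (Summable.add ?_ ?_)
    · exact summable_pow_mul_geometric_of_norm_lt_one 1 (by rwa [Real.norm_of_nonneg h0])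
    · exact summable_geometric_of_lt_one h0 h1
  refine lt_of_le_of_lt ?_ h.tsum_ofReal_lt_top
  refine ENNReal.tsum_le_tsum fun j => ?_
  calc w j * ENNReal.ofReal x ^ j ≤ ((j + 1 : ℕ) : ℝ≥0∞) * N * ENNReal.ofReal x ^ j := by
        gcongr; exact hN j
    _ = _ := by
      have e : ((j : ℝ) ^ 1 * x ^ j + x ^ j) * N = ((j + 1 : ℕ) : ℝ) * N * x ^ j := by
        push_cast; ring
      rw [e, ENNReal.ofReal_mul (by positivity), ENNReal.ofReal_mul (by positivity),
        ENNReal.ofReal_natCast, ENNReal.ofReal_coe_nnreal, ENNReal.ofReal_pow h0]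

lemma kser_pos {w : ℕ → ℝ≥0∞} (hw : IsArmSeries w) {u : ℝ≥0∞} (hu : 0 < u) : 0 < kser w u := by
  obtain ⟨j, hj⟩ := hw.ne
  refine lt_of_lt_of_le ?_ (ENNReal.le_tsum j)
  exact ENNReal.mul_pos hj (pow_ne_zero _ hu.ne')

lemma lowerSemicontinuous_kser {w : ℕ → ℝ≥0∞} (hw : IsArmSeries w) :
    LowerSemicontinuous (kser w) :=
  lowerSemicontinuous_tsum fun j =>
    ((ENNReal.continuous_const_mul (hw.ne_top j)).comp
      (ENNReal.continuous_pow j)).lowerSemicontinuous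

/-- The points of `[0,1]` at which the series is finite. -/
def finSet (w : ℕ → ℝ≥0∞) : Set ℝ := {x | x ∈ Icc (0 : ℝ) 1 ∧ kser w (ENNReal.ofReal x) < ⊤}

/-- The real-valued series `κ(x)`; this is a junk value where the series diverges. -/
def kap (w : ℕ → ℝ≥0∞) (x : ℝ) : ℝ := (kser w (ENNReal.ofReal x)).toReal

lemma kap_nonneg (w : ℕ → ℝ≥0∞) (x : ℝ) : 0 ≤ kap w x := ENNReal.toReal_nonneg

lemma ofReal_kap {w : ℕ → ℝ≥0∞} {x : ℝ} (h : kser w (ENNReal.ofReal x) < ⊤) :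
    ENNReal.ofReal (kap w x) = kser w (ENNReal.ofReal x) := ENNReal.ofReal_toReal h.ne

lemma kap_mono {w : ℕ → ℝ≥0∞} {x y : ℝ} (hxy : x ≤ y) (hy : kser w (ENNReal.ofReal y) < ⊤) :
    kap w x ≤ kap w y :=
  ENNReal.toReal_mono hy.ne (kser_mono w (ENNReal.ofReal_le_ofReal hxy))

lemma mem_finSet {w : ℕ → ℝ≥0∞} (hw : IsArmSeries w) {x : ℝ} (h0 : 0 ≤ x) (h1 : x < 1) :
    x ∈ finSet w := ⟨⟨h0, h1.le⟩, kser_lt_top hw h0 h1⟩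

lemma kap_pos {w : ℕ → ℝ≥0∞} (hw : IsArmSeries w) {x : ℝ} (h0 : 0 < x)
    (h : kser w (ENNReal.ofReal x) < ⊤) : 0 < kap w x :=
  ENNReal.toReal_pos (kser_pos hw (by simpa using h0)).ne' h.ne

/-! ### The envelope `M(b) = max_x (x - b κ(x))` -/

/-- `M(b) = max (x - b κ(x))` over the points of `[0,1]` at which `κ` is finite, extended by `1` to
`b ≤ 0`. -/
def env (w : ℕ → ℝ≥0∞) (b : ℝ) : ℝ :=
  if b ≤ 0 then 1 else sSup ((fun x => x - b * kap w x) '' finSet w)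

/-- `x` is a point at which the maximum defining `M(b)` is attained. -/
structure IsMaximizer (w : ℕ → ℝ≥0∞) (b x : ℝ) : Prop where
  mem : x ∈ finSet w
  eq : env w b = x - b * kap w x

lemma env_of_nonpos {w : ℕ → ℝ≥0∞} {b : ℝ} (hb : b ≤ 0) : env w b = 1 := if_pos hb

lemma le_env {w : ℕ → ℝ≥0∞} {b x : ℝ} (hb : 0 < b) (hx : x ∈ finSet w) :
    x - b * kap w x ≤ env w b := by
  rw [env, if_neg hb.not_ge]
  refine le_csSup ⟨1, ?_⟩ ⟨x, hx, rfl⟩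
  rintro _ ⟨z, hz, rfl⟩
  have := mul_nonneg hb.le (kap_nonneg w z)
  have := hz.1.2
  dsimp only
  linarith

/-- The maximum is attained, because `x ↦ (1 - x) + b k(x)` is lower semicontinuous on the compact
interval `[0,1]`. -/
lemma exists_isMaximizer {w : ℕ → ℝ≥0∞} (hw : IsArmSeries w) {b : ℝ} (hb : 0 < b) :
    ∃ x, IsMaximizer w b x := by
  have hlsc : LowerSemicontinuous fun x : ℝ =>
      ENNReal.ofReal (1 - x) + ENNReal.ofReal b * kser w (ENNReal.ofReal x) := by
    refine LowerSemicontinuous.add (Continuous.lowerSemicontinuous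
      (ENNReal.continuous_ofReal.comp (continuous_const.sub continuous_id))) ?_
    refine (ENNReal.continuous_const_mul ENNReal.ofReal_ne_top).comp_lowerSemicontinuous
      (f := fun x : ℝ => kser w (ENNReal.ofReal x))
      (fun x y hy => ENNReal.continuous_ofReal.continuousAt.eventually
        (lowerSemicontinuous_kser hw _ y hy)) ?_
    intro u v h
    dsimp only
    gcongr
  obtain ⟨x, hx, hmin⟩ := (hlsc.lowerSemicontinuousOn (Icc 0 1)).exists_isMinOn
    ⟨0, by simp⟩ isCompact_Icc
  have hfin : kser w (ENNReal.ofReal x) < ⊤ := by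
    have h0 := hmin (a := 0) (by simp)
    have h1 : ENNReal.ofReal b * kser w (ENNReal.ofReal x) < ⊤ := by
      refine lt_of_le_of_lt (le_add_self.trans h0) ?_
      exact ENNReal.add_lt_top.2 ⟨ENNReal.ofReal_lt_top,
        ENNReal.mul_lt_top ENNReal.ofReal_lt_top (kser_lt_top hw le_rfl one_pos)⟩
    by_contra h
    rw [not_lt, top_le_iff] at h
    rw [h, ENNReal.mul_top (by simpa using hb)] at h1
    exact lt_irrefl _ h1
  have hxS : x ∈ finSet w := ⟨hx, hfin⟩
  have hval : ∀ z ∈ finSet w, ENNReal.ofReal (1 - z) + ENNReal.ofReal b * kser w (ENNReal.ofReal z)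
      = ENNReal.ofReal (1 - z + b * kap w z) := by
    intro z hz
    rw [ENNReal.ofReal_add (by linarith [hz.1.2]) (mul_nonneg hb.le (kap_nonneg w z)),
      ENNReal.ofReal_mul hb.le, ofReal_kap hz.2]
  refine ⟨x, hxS, ?_⟩
  rw [env, if_neg hb.not_ge]
  refine IsGreatest.csSup_eq ⟨⟨x, hxS, rfl⟩, ?_⟩
  rintro _ ⟨z, hz, rfl⟩
  have h1 := hmin hz.1
  simp only [mem_ofPred_eq] at h1
  rw [hval x hxS, hval z hz, ENNReal.ofReal_le_ofReal_iff
    (add_nonneg (by linarith [hz.1.2]) (mul_nonneg hb.le (kap_nonneg w z)))] at h1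
  dsimp only
  linarith

/-- `M` lies above the line through its value at `b` with slope `-κ(x)`, `x` a maximizer. -/
lemma IsMaximizer.sub_le {w : ℕ → ℝ≥0∞} {b b' x : ℝ} (hx : IsMaximizer w b x) (hb' : 0 < b') :
    env w b - (b' - b) * kap w x ≤ env w b' := by
  rw [hx.eq]
  linarith [le_env hb' hx.mem]

lemma IsMaximizer.kap_anti {w : ℕ → ℝ≥0∞} {b b' x x' : ℝ} (hb : 0 < b) (hbb' : b < b')
    (hx : IsMaximizer w b x) (hx' : IsMaximizer w b' x') : kap w x' ≤ kap w x := by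
  have h1 := hx.sub_le (hb.trans hbb')
  have h2 := hx'.sub_le hb
  refine le_of_mul_le_mul_left ?_ (sub_pos.2 hbb')
  linarith

lemma env_le_one {w : ℕ → ℝ≥0∞} (hw : IsArmSeries w) (b : ℝ) : env w b ≤ 1 := by
  rcases le_or_gt b 0 with hb | hb
  · rw [env_of_nonpos hb]
  · obtain ⟨x, hx⟩ := exists_isMaximizer hw hb
    rw [hx.eq]
    linarith [hx.mem.1.2, mul_nonneg hb.le (kap_nonneg w x)]

lemma env_antitone {w : ℕ → ℝ≥0∞} (hw : IsArmSeries w) : Antitone (env w) := by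
  intro b b' h
  rcases le_or_gt b 0 with hb | hb
  · rw [env_of_nonpos hb]
    exact env_le_one hw b'
  · obtain ⟨x, hx⟩ := exists_isMaximizer hw (hb.trans_le h)
    have := hx.sub_le hb
    nlinarith [kap_nonneg w x]

lemma continuous_env {w : ℕ → ℝ≥0∞} (hw : IsArmSeries w) : Continuous (env w) := by
  rw [continuous_iff_continuousAt]
  intro b
  rcases lt_or_ge 0 b with hb | hb
  · obtain ⟨x, hx⟩ := exists_isMaximizer hw (half_pos hb)
    have hL : LipschitzOnWith (kap w x).toNNReal (env w) (Ioi (b / 2)) := by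
      refine LipschitzOnWith.of_le_add_mul _ fun u hu v hv => ?_
      rw [Real.coe_toNNReal _ (kap_nonneg w x), Real.dist_eq]
      have hu' : 0 < u := (half_pos hb).trans hu
      have hv' : 0 < v := (half_pos hb).trans hv
      rcases le_total v u with h | h
      · exact (env_antitone hw h).trans (le_add_of_nonneg_right
          (mul_nonneg (kap_nonneg w x) (abs_nonneg _)))
      · obtain ⟨z, hz⟩ := exists_isMaximizer hw hu'
        have h1 := hz.sub_le hv'
        have h2 := hx.kap_anti (half_pos hb) hu hz
        rw [abs_of_nonpos (by linarith)]
        nlinarith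
    exact hL.continuousOn.continuousAt (Ioi_mem_nhds (by linarith))
  · have hlow : ∀ x ∈ Ico (0 : ℝ) 1, ∀ u, x - |u - b| * kap w x ≤ env w u := by
      intro x hx u
      have := mul_nonneg (abs_nonneg (u - b)) (kap_nonneg w x)
      rcases le_or_gt u 0 with hu | hu
      · rw [env_of_nonpos hu]
        linarith [hx.2]
      · refine le_trans ?_ (le_env hu (mem_finSet hw hx.1 hx.2))
        have : u ≤ |u - b| := (by linarith : u ≤ u - b).trans (le_abs_self _)
        nlinarith [kap_nonneg w x]
    rw [ContinuousAt, env_of_nonpos hb]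
    refine tendsto_order.2 ⟨fun a ha => ?_, fun a ha => ?_⟩
    · obtain ⟨x, hx0, hx1⟩ := exists_between (max_lt ha one_pos)
      have hx : x ∈ Ico (0 : ℝ) 1 := ⟨(le_max_right _ _).trans hx0.le, hx1⟩
      have hc : Tendsto (fun u => x - |u - b| * kap w x) (𝓝 b) (𝓝 x) := by
        have : ContinuousAt (fun u => x - |u - b| * kap w x) b := by fun_prop
        simpa [ContinuousAt] using this
      filter_upwards [hc.eventually_const_lt ((le_max_left _ _).trans_lt hx0)] with u hu
      exact hu.trans_le (hlow x hx u)
    · exact Eventually.of_forall fun u => (env_le_one hw u).trans_lt ha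

/-- The least maximizer for `M(b)`, as the least solution of `h = M(b) + b κ(h)`. -/
def leastMax (w : ℕ → ℝ≥0∞) (b : ℝ) : ℝ :=
  (lfix w (ENNReal.ofReal (env w b)) (ENNReal.ofReal b)).toReal

lemma lfix_le_ofReal {w : ℕ → ℝ≥0∞} {lam b x : ℝ} (hb : 0 ≤ b) (hl : 0 ≤ lam)
    (hx : kser w (ENNReal.ofReal x) < ⊤) (h : lam ≤ x - b * kap w x) :
    lfix w (ENNReal.ofReal lam) (ENNReal.ofReal b) ≤ ENNReal.ofReal x := by
  apply lfix_le
  rw [← ofReal_kap hx, ← ENNReal.ofReal_mul hb, ← ENNReal.ofReal_add hl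
    (mul_nonneg hb (kap_nonneg w x))]
  exact ENNReal.ofReal_le_ofReal (by linarith)

lemma kser_lfix_lt_top {w : ℕ → ℝ≥0∞} {lam b : ℝ} (hb : 0 < b)
    (h : lfix w (ENNReal.ofReal lam) (ENNReal.ofReal b) ≠ ⊤) :
    kser w (lfix w (ENNReal.ofReal lam) (ENNReal.ofReal b)) < ⊤ := by
  have h1 := lfix_eq w (ENNReal.ofReal lam) (ENNReal.ofReal b)
  by_contra h2
  rw [not_lt, top_le_iff] at h2
  rw [h2, ENNReal.mul_top (by simpa using hb), add_top] at h1
  exact h h1.symm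

/-- A finite least fixed point, as a real number. -/
lemma toReal_lfix {w : ℕ → ℝ≥0∞} {lam b : ℝ} (hb : 0 < b) (hl : 0 ≤ lam)
    (h : lfix w (ENNReal.ofReal lam) (ENNReal.ofReal b) ≠ ⊤) :
    lam = (lfix w (ENNReal.ofReal lam) (ENNReal.ofReal b)).toReal -
      b * kap w (lfix w (ENNReal.ofReal lam) (ENNReal.ofReal b)).toReal := by
  have h1 := congrArg ENNReal.toReal (lfix_eq w (ENNReal.ofReal lam) (ENNReal.ofReal b))
  have h2 := kser_lfix_lt_top hb h
  rw [ENNReal.toReal_add ENNReal.ofReal_ne_top (ENNReal.mul_lt_top ENNReal.ofReal_lt_top h2).ne,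
    ENNReal.toReal_mul, ENNReal.toReal_ofReal hl, ENNReal.toReal_ofReal hb.le] at h1
  rw [kap, ENNReal.ofReal_toReal h]
  linarith

lemma lfix_env_le {w : ℕ → ℝ≥0∞} {b x : ℝ} (hb : 0 < b) (he : 0 < env w b)
    (hx : IsMaximizer w b x) :
    lfix w (ENNReal.ofReal (env w b)) (ENNReal.ofReal b) ≤ ENNReal.ofReal x :=
  lfix_le_ofReal hb.le he.le hx.mem.2 hx.eq.le

lemma lfix_env_ne_top {w : ℕ → ℝ≥0∞} (hw : IsArmSeries w) {b : ℝ} (hb : 0 < b)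
    (he : 0 < env w b) : lfix w (ENNReal.ofReal (env w b)) (ENNReal.ofReal b) ≠ ⊤ := by
  obtain ⟨x, hx⟩ := exists_isMaximizer hw hb
  exact ((lfix_env_le hb he hx).trans_lt ENNReal.ofReal_lt_top).ne

lemma ofReal_leastMax {w : ℕ → ℝ≥0∞} (hw : IsArmSeries w) {b : ℝ} (hb : 0 < b)
    (he : 0 < env w b) :
    ENNReal.ofReal (leastMax w b) = lfix w (ENNReal.ofReal (env w b)) (ENNReal.ofReal b) :=
  ENNReal.ofReal_toReal (lfix_env_ne_top hw hb he)

lemma leastMax_le {w : ℕ → ℝ≥0∞} {b x : ℝ} (hb : 0 < b) (he : 0 < env w b)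
    (hx : IsMaximizer w b x) : leastMax w b ≤ x :=
  ENNReal.toReal_le_of_le_ofReal hx.mem.1.1 (lfix_env_le hb he hx)

lemma isMaximizer_leastMax {w : ℕ → ℝ≥0∞} (hw : IsArmSeries w) {b : ℝ} (hb : 0 < b)
    (he : 0 < env w b) : IsMaximizer w b (leastMax w b) := by
  obtain ⟨x, hx⟩ := exists_isMaximizer hw hb
  have ht := lfix_env_ne_top hw hb he
  refine ⟨⟨⟨ENNReal.toReal_nonneg, (leastMax_le hb he hx).trans hx.mem.1.2⟩, ?_⟩,
    toReal_lfix hb he.le ht⟩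
  rw [ofReal_leastMax hw hb he]
  exact kser_lfix_lt_top hb ht

lemma env_le_leastMax {w : ℕ → ℝ≥0∞} (hw : IsArmSeries w) {b : ℝ} (hb : 0 < b)
    (he : 0 < env w b) : env w b ≤ leastMax w b := by
  rw [(isMaximizer_leastMax hw hb he).eq]
  linarith [mul_nonneg hb.le (kap_nonneg w (leastMax w b))]

/-- `p(b) = κ(h)` at the least maximizer `h`; this is `-M'(b)` wherever `M` is differentiable. -/
def slp (w : ℕ → ℝ≥0∞) (b : ℝ) : ℝ := kap w (leastMax w b)

lemma slp_nonneg (w : ℕ → ℝ≥0∞) (b : ℝ) : 0 ≤ slp w b := kap_nonneg _ _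

lemma slp_pos {w : ℕ → ℝ≥0∞} (hw : IsArmSeries w) {b : ℝ} (hb : 0 < b)
    (he : 0 < env w b) : 0 < slp w b :=
  kap_pos hw (he.trans_le (env_le_leastMax hw hb he)) (isMaximizer_leastMax hw hb he).mem.2

/-- The positive parameters `b` at which `M` is positive. -/
def posSet (w : ℕ → ℝ≥0∞) : Set ℝ := {b | 0 < b ∧ 0 < env w b}

lemma isOpen_posSet {w : ℕ → ℝ≥0∞} (hw : IsArmSeries w) : IsOpen (posSet w) :=
  isOpen_Ioi.inter (isOpen_Ioi.preimage (continuous_env hw))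

lemma slp_antitoneOn {w : ℕ → ℝ≥0∞} (hw : IsArmSeries w) : AntitoneOn (slp w) (posSet w) := by
  intro b hb b' hb' h
  rcases h.eq_or_lt with rfl | h
  · exact le_rfl
  · exact (isMaximizer_leastMax hw hb.1 hb.2).kap_anti hb.1 h (isMaximizer_leastMax hw hb'.1 hb'.2)

lemma env_sub_le {w : ℕ → ℝ≥0∞} (hw : IsArmSeries w) {b b' : ℝ} (hb : b ∈ posSet w)
    (hb' : 0 < b') : env w b - (b' - b) * slp w b ≤ env w b' :=
  (isMaximizer_leastMax hw hb.1 hb.2).sub_le hb'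

/-- The envelope theorem: `M' = -p` where `p` is continuous, as `M` is squeezed between lines of
slopes `-p(b)` and `-p(u)`. -/
lemma hasDerivAt_env {w : ℕ → ℝ≥0∞} (hw : IsArmSeries w) {b : ℝ} (hb : b ∈ posSet w)
    (hc : ContinuousAt (slp w) b) : HasDerivAt (env w) (-slp w b) b := by
  rw [hasDerivAt_iff_isLittleO, Asymptotics.isLittleO_iff]
  intro ε hε
  filter_upwards [(isOpen_posSet hw).mem_nhds hb, Metric.continuousAt_iff'.1 hc ε hε] with u hu hd
  have h1 := env_sub_le hw hb hu.1
  have h2 := env_sub_le hw hu hb.1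
  rw [Real.dist_eq] at hd
  rw [smul_eq_mul, Real.norm_of_nonneg (by linarith), Real.norm_eq_abs]
  calc env w u - env w b - (u - b) * -slp w b ≤ (u - b) * (slp w b - slp w u) := by linarith
    _ ≤ |u - b| * |slp w b - slp w u| := by rw [← abs_mul]; exact le_abs_self _
    _ ≤ |u - b| * ε := by
      rw [abs_sub_comm (slp w b)]
      exact mul_le_mul_of_nonneg_left hd.le (abs_nonneg _)
    _ = ε * |u - b| := mul_comm _ _

lemma countable_not_continuousAt_slp {w : ℕ → ℝ≥0∞} (hw : IsArmSeries w) :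
    {b ∈ posSet w | ¬ContinuousAt (slp w) b}.Countable := by
  refine (slp_antitoneOn hw).countable_not_continuousWithinAt.mono ?_
  rintro b ⟨hb, hn⟩
  refine ⟨hb, fun h => hn (h.continuousAt ((isOpen_posSet hw).mem_nhds hb))⟩

/-- `M` becomes arbitrarily small, possibly negative. -/
lemma exists_env_lt {w : ℕ → ℝ≥0∞} (hw : IsArmSeries w) {δ : ℝ} (hδ : 0 < δ) :
    ∃ b, 0 < b ∧ ∀ b' ≥ b, env w b' < δ := by
  have hd : 0 < min (δ / 2) (1 / 2) := by positivity
  set x := min (δ / 2) (1 / 2) with hx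
  have hx1 : x < 1 := (min_le_right _ _).trans_lt (by norm_num)
  have hk : 0 < kap w x := kap_pos hw hd (kser_lt_top hw hd.le hx1)
  refine ⟨1 / kap w x, by positivity, fun b' hb' => ?_⟩
  have hb0 : 0 < b' := lt_of_lt_of_le (by positivity) hb'
  obtain ⟨z, hz⟩ := exists_isMaximizer hw hb0
  rw [hz.eq]
  rcases le_or_gt x z with h | h
  · have h1 := kap_mono h hz.mem.2
    have h2 : 1 ≤ b' * kap w x := by
      rwa [ge_iff_le, div_le_iff₀ hk] at hb'
    nlinarith [hz.mem.1.2]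
  · have := mul_nonneg hb0.le (kap_nonneg w z)
    have : x ≤ δ / 2 := min_le_left _ _
    linarith

/-! ### The differential equation `β' = M(β)²` -/

/-- Where `M` is positive. -/
def domSet (w : ℕ → ℝ≥0∞) : Set ℝ := {b | 0 < env w b}

lemma isOpen_domSet {w : ℕ → ℝ≥0∞} (hw : IsArmSeries w) : IsOpen (domSet w) :=
  isOpen_Ioi.preimage (continuous_env hw)

lemma domSet_lower {w : ℕ → ℝ≥0∞} (hw : IsArmSeries w) {b b' : ℝ} (h : b ≤ b')
    (hb' : b' ∈ domSet w) : b ∈ domSet w :=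
  lt_of_lt_of_le hb' (env_antitone hw h)

lemma ordConnected_domSet {w : ℕ → ℝ≥0∞} (hw : IsArmSeries w) : (domSet w).OrdConnected :=
  ⟨fun _ _ _ hy _ hz => domSet_lower hw hz.2 hy⟩

lemma mem_domSet_of_nonpos {w : ℕ → ℝ≥0∞} {b : ℝ} (hb : b ≤ 0) : b ∈ domSet w := by
  rw [domSet, mem_ofPred_eq, env_of_nonpos hb]
  exact one_pos

/-- The time needed to reach `b` along the flow `β' = M(β)²` started at `0`. -/
def hitTime (w : ℕ → ℝ≥0∞) (b : ℝ) : ℝ := ∫ s in (0 : ℝ)..b, 1 / (env w s) ^ 2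

lemma continuousOn_inv_env_sq {w : ℕ → ℝ≥0∞} (hw : IsArmSeries w) :
    ContinuousOn (fun s => 1 / (env w s) ^ 2) (domSet w) :=
  ContinuousOn.div continuousOn_const ((continuous_env hw).pow 2).continuousOn
    fun _ hs => pow_ne_zero 2 (ne_of_gt hs)

lemma intervalIntegrable_inv_env_sq {w : ℕ → ℝ≥0∞} (hw : IsArmSeries w) {a b : ℝ}
    (ha : a ∈ domSet w) (hb : b ∈ domSet w) :
    IntervalIntegrable (fun s => 1 / (env w s) ^ 2) volume a b :=
  ((continuousOn_inv_env_sq hw).mono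
    ((ordConnected_domSet hw).uIcc_subset ha hb)).intervalIntegrable

lemma hasDerivAt_hitTime {w : ℕ → ℝ≥0∞} (hw : IsArmSeries w) {b : ℝ} (hb : b ∈ domSet w) :
    HasDerivAt (hitTime w) (1 / (env w b) ^ 2) b := by
  have hn := (isOpen_domSet hw).mem_nhds hb
  refine intervalIntegral.integral_hasDerivAt_right
    (intervalIntegrable_inv_env_sq hw (mem_domSet_of_nonpos le_rfl) hb) ?_
    ((continuousOn_inv_env_sq hw).continuousAt hn)
  exact (continuousOn_inv_env_sq hw).stronglyMeasurableAtFilter (isOpen_domSet hw) b hb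

lemma strictMonoOn_hitTime {w : ℕ → ℝ≥0∞} (hw : IsArmSeries w) :
    StrictMonoOn (hitTime w) (domSet w) := by
  refine strictMonoOn_of_deriv_pos (ordConnected_domSet hw).convex
    (fun b hb => (hasDerivAt_hitTime hw hb).continuousAt.continuousWithinAt) fun b hb => ?_
  have hb := interior_subset hb
  rw [(hasDerivAt_hitTime hw hb).deriv]
  have : 0 < env w b := hb
  positivity

lemma hitTime_zero (w : ℕ → ℝ≥0∞) : hitTime w 0 = 0 := intervalIntegral.integral_same

lemma hitTime_of_nonpos {w : ℕ → ℝ≥0∞} {t : ℝ} (ht : t ≤ 0) : hitTime w t = t := by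
  have : hitTime w t = ∫ _ in (0 : ℝ)..t, (1 : ℝ) := by
    refine intervalIntegral.integral_congr fun s hs => ?_
    rw [uIcc_of_ge ht] at hs
    rw [env_of_nonpos hs.2]
    norm_num
  rw [this]
  simp

/-- The hitting time is unbounded: if `M` vanishes at a first point `b₁` then it vanishes at least
linearly there. -/
lemma exists_hitTime_ge {w : ℕ → ℝ≥0∞} (hw : IsArmSeries w) (t : ℝ) :
    ∃ b ∈ domSet w, t ≤ hitTime w b := by
  rcases le_or_gt t 0 with ht | ht
  · exact ⟨0, mem_domSet_of_nonpos le_rfl, by rwa [hitTime_zero]⟩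
  by_cases hall : ∀ b, 0 < env w b
  · refine ⟨t, hall t, ?_⟩
    have h1 : ∫ _ in (0 : ℝ)..t, (1 : ℝ) ≤ hitTime w t := by
      refine intervalIntegral.integral_mono_on ht.le (by simp)
        (intervalIntegrable_inv_env_sq hw (hall _) (hall _)) fun s _ => ?_
      rw [le_div_iff₀ (pow_pos (hall s) 2), one_mul]
      exact pow_le_one₀ (hall s).le (env_le_one hw s)
    simpa using h1
  · push Not at hall
    obtain ⟨b₀, hb₀⟩ := hall
    set Z := {b | env w b ≤ 0} with hZ
    have hZc : IsClosed Z := isClosed_le (continuous_env hw) continuous_const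
    have hZpos : ∀ b ∈ Z, 0 < b := by
      intro b hb
      by_contra h
      have : env w b ≤ 0 := hb
      rw [env_of_nonpos (not_lt.1 h)] at this
      linarith
    have hZb : BddBelow Z := ⟨0, fun b hb => (hZpos b hb).le⟩
    have hmem : sInf Z ∈ Z := hZc.csInf_mem ⟨b₀, hb₀⟩ hZb
    set b₁ := sInf Z with hb₁
    have h1pos := hZpos b₁ hmem
    have hlt : ∀ b < b₁, 0 < env w b := fun b hb => by
      by_contra h
      exact absurd (csInf_le hZb (not_lt.1 h)) hb.not_ge
    have hhalf : b₁ / 2 ∈ posSet w := ⟨by linarith, hlt _ (by linarith)⟩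
    set C := slp w (b₁ / 2) with hC
    have hCpos : 0 < C := slp_pos hw hhalf.1 hhalf.2
    have hbound : ∀ b ∈ Ico (b₁ / 2) b₁, env w b ≤ (b₁ - b) * C := by
      intro b hb
      have hbp : b ∈ posSet w := ⟨hhalf.1.trans_le hb.1, hlt b hb.2⟩
      have h2 := env_sub_le hw hbp h1pos
      have h3 : env w b₁ ≤ 0 := hmem
      have h4 := slp_antitoneOn hw hhalf hbp hb.1
      have h5 := mul_le_mul_of_nonneg_left h4 (sub_nonneg.2 hb.2.le)
      linarith
    -- compare with the explicit primitive of `1 / (C (b₁ - b))²`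
    have hmono : MonotoneOn (fun b => hitTime w b - (C ^ 2 * (b₁ - b))⁻¹) (Ico (b₁ / 2) b₁) := by
      have hd : ∀ b ∈ Ico (b₁ / 2) b₁, HasDerivAt (fun b => hitTime w b - (C ^ 2 * (b₁ - b))⁻¹)
          (1 / (env w b) ^ 2 - 1 / (C * (b₁ - b)) ^ 2) b := by
        intro b hb
        have h0 : b₁ - b ≠ 0 := by linarith [hb.2]
        have h1 : HasDerivAt (fun b => C ^ 2 * (b₁ - b)) (C ^ 2 * (-1)) b :=
          ((hasDerivAt_id b).const_sub b₁).const_mul _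
        have h2 := h1.inv (mul_ne_zero (pow_ne_zero 2 hCpos.ne') h0)
        convert! (hasDerivAt_hitTime hw (hlt b hb.2)).sub h2 using 1
        field_simp
      refine monotoneOn_of_deriv_nonneg (convex_Ico _ _)
        (fun b hb => (hd b hb).continuousAt.continuousWithinAt)
        (fun b hb => (hd b (interior_subset hb)).differentiableAt.differentiableWithinAt)
        fun b hb => ?_
      have hb := interior_subset hb
      rw [(hd b hb).deriv, sub_nonneg]
      have h3 := hlt b hb.2
      refine one_div_le_one_div_of_le (pow_pos h3 2) (pow_le_pow_left₀ h3.le ?_ 2)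
      rw [mul_comm]
      exact hbound b hb
    set D := max 1 (max (t + (C ^ 2 * (b₁ / 2))⁻¹) (2 / (C ^ 2 * b₁))) with hD
    have hDpos : 0 < D := lt_of_lt_of_le one_pos (le_max_left _ _)
    have hD2 : 2 / (C ^ 2 * b₁) ≤ D := (le_max_right _ _).trans (le_max_right _ _)
    have hD1 : t + (C ^ 2 * (b₁ / 2))⁻¹ ≤ D := (le_max_left _ _).trans (le_max_right _ _)
    have hb : b₁ - 1 / (C ^ 2 * D) ∈ Ico (b₁ / 2) b₁ := by
      constructor
      · rw [div_le_iff₀ (by positivity)] at hD2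
        have : 1 / (C ^ 2 * D) ≤ b₁ / 2 := by
          rw [div_le_iff₀ (by positivity)]
          linarith
        linarith
      · have : 0 < 1 / (C ^ 2 * D) := by positivity
        linarith
    refine ⟨_, hlt _ hb.2, ?_⟩
    have h6 := hmono ⟨le_rfl, by linarith⟩ hb hb.1
    dsimp only at h6
    have h7 : (C ^ 2 * (b₁ - (b₁ - 1 / (C ^ 2 * D))))⁻¹ = D := by
      field_simp
      ring_nf
    rw [h7] at h6
    have h8 : 0 ≤ hitTime w (b₁ / 2) := by
      rw [← hitTime_zero w]
      exact (strictMonoOn_hitTime hw).monotoneOn (mem_domSet_of_nonpos le_rfl) hhalf.2 hhalf.1.le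
    have h9 : b₁ - b₁ / 2 = b₁ / 2 := by ring
    rw [h9] at h6
    linarith

lemma exists_hitTime_eq {w : ℕ → ℝ≥0∞} (hw : IsArmSeries w) (t : ℝ) :
    ∃ b ∈ domSet w, hitTime w b = t := by
  rcases le_or_gt t 0 with ht | ht
  · exact ⟨t, mem_domSet_of_nonpos ht, hitTime_of_nonpos ht⟩
  obtain ⟨b, hb, htb⟩ := exists_hitTime_ge hw t
  have h0 : (0 : ℝ) ∈ domSet w := mem_domSet_of_nonpos le_rfl
  have hb0 : 0 ≤ b := by
    by_contra h
    rw [hitTime_of_nonpos (not_le.1 h).le] at htb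
    linarith
  have hsub : Icc 0 b ⊆ domSet w := fun s hs => domSet_lower hw hs.2 hb
  obtain ⟨s, hs, hst⟩ := intermediate_value_Icc hb0 (f := hitTime w)
    (fun s hs => (hasDerivAt_hitTime hw (hsub hs)).continuousAt.continuousWithinAt)
    (show t ∈ Icc _ _ from ⟨by rw [hitTime_zero]; exact ht.le, htb⟩)
  exact ⟨s, hsub hs, hst⟩

open Classical in
/-- The solution of `β' = M(β)²`, `β(0) = 0`. -/
def flow (w : ℕ → ℝ≥0∞) (t : ℝ) : ℝ :=
  if hw : IsArmSeries w then (exists_hitTime_eq hw t).choose else 0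

lemma flow_mem {w : ℕ → ℝ≥0∞} (hw : IsArmSeries w) (t : ℝ) : flow w t ∈ domSet w := by
  rw [flow, dif_pos hw]
  exact (exists_hitTime_eq hw t).choose_spec.1

lemma hitTime_flow {w : ℕ → ℝ≥0∞} (hw : IsArmSeries w) (t : ℝ) : hitTime w (flow w t) = t := by
  rw [flow, dif_pos hw]
  exact (exists_hitTime_eq hw t).choose_spec.2

lemma flow_hitTime {w : ℕ → ℝ≥0∞} (hw : IsArmSeries w) {b : ℝ} (hb : b ∈ domSet w) :
    flow w (hitTime w b) = b :=
  (strictMonoOn_hitTime hw).injOn (flow_mem hw _) hb (hitTime_flow hw _)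

lemma env_flow_pos {w : ℕ → ℝ≥0∞} (hw : IsArmSeries w) (t : ℝ) : 0 < env w (flow w t) :=
  flow_mem hw t

lemma flow_strictMono {w : ℕ → ℝ≥0∞} (hw : IsArmSeries w) : StrictMono (flow w) := by
  intro s t h
  rw [← (strictMonoOn_hitTime hw).lt_iff_lt (flow_mem hw s) (flow_mem hw t), hitTime_flow hw,
    hitTime_flow hw]
  exact h

lemma flow_zero {w : ℕ → ℝ≥0∞} (hw : IsArmSeries w) : flow w 0 = 0 := by
  have := flow_hitTime hw (mem_domSet_of_nonpos (w := w) le_rfl)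
  rwa [hitTime_zero] at this

lemma flow_pos {w : ℕ → ℝ≥0∞} (hw : IsArmSeries w) {t : ℝ} (ht : 0 < t) : 0 < flow w t := by
  rw [← flow_zero hw]
  exact flow_strictMono hw ht

lemma flow_mem_posSet {w : ℕ → ℝ≥0∞} (hw : IsArmSeries w) {t : ℝ} (ht : 0 < t) :
    flow w t ∈ posSet w := ⟨flow_pos hw ht, env_flow_pos hw t⟩

lemma flow_nonneg {w : ℕ → ℝ≥0∞} (hw : IsArmSeries w) {t : ℝ} (ht : 0 ≤ t) : 0 ≤ flow w t := by
  rw [← flow_zero hw]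
  exact (flow_strictMono hw).monotone ht

lemma continuous_flow {w : ℕ → ℝ≥0∞} (hw : IsArmSeries w) : Continuous (flow w) := by
  rw [continuous_iff_continuousAt]
  intro t
  refine continuousAt_of_monotoneOn_of_image_mem_nhds
    ((flow_strictMono hw).monotone.monotoneOn univ) univ_mem ?_
  refine mem_of_superset ((isOpen_domSet hw).mem_nhds (flow_mem hw t)) fun b hb => ?_
  exact ⟨hitTime w b, mem_univ _, flow_hitTime hw hb⟩

lemma hasDerivAt_flow {w : ℕ → ℝ≥0∞} (hw : IsArmSeries w) (t : ℝ) :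
    HasDerivAt (flow w) (env w (flow w t) ^ 2) t := by
  have h := (hasDerivAt_hitTime hw (flow_mem hw t)).of_local_left_inverse
    (continuous_flow hw).continuousAt
    (one_div_ne_zero (pow_ne_zero 2 (env_flow_pos hw t).ne'))
    (Eventually.of_forall (hitTime_flow hw))
  simpa using h

/-- Uniqueness for `β' = M(β)²`, although `M` need not be Lipschitz at `0`. -/
lemma eq_flow {w : ℕ → ℝ≥0∞} (hw : IsArmSeries w) {γ : ℝ → ℝ} {T : ℝ} (hT : 0 ≤ T)
    (hc : ContinuousOn γ (Icc 0 T)) (h0 : γ 0 = 0) (hpos : ∀ t ∈ Icc 0 T, 0 < env w (γ t))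
    (hd : ∀ t ∈ Ioo 0 T, HasDerivAt γ (env w (γ t) ^ 2) t) : γ T = flow w T := by
  have h1 : ∫ _ in (0 : ℝ)..T, (1 : ℝ) = hitTime w (γ T) - hitTime w (γ 0) := by
    refine intervalIntegral.integral_eq_sub_of_hasDerivAt_of_le (f := fun t => hitTime w (γ t)) hT
      (fun t ht => ?_) (fun t ht => ?_) (by simp)
    · exact (hasDerivAt_hitTime hw (hpos t ht)).continuousAt.comp_continuousWithinAt (hc t ht)
    · have h2 := hpos t (Ioo_subset_Icc_self ht)
      have h3 := (hasDerivAt_hitTime hw h2).comp t (hd t ht)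
      rw [one_div_mul_cancel (pow_ne_zero 2 h2.ne')] at h3
      exact h3
  rw [h0, hitTime_zero] at h1
  have h2 : hitTime w (γ T) = T := by simpa using h1.symm
  rw [← h2, flow_hitTime hw (hpos T ⟨hT, le_rfl⟩), h2]

/-! ### The functions `α = 1 / M(β)` and `A = α' / α` -/

/-- `α_t = 1 / M(β_t)`. -/
def growth (w : ℕ → ℝ≥0∞) (t : ℝ) : ℝ := 1 / env w (flow w t)

lemma growth_pos {w : ℕ → ℝ≥0∞} (hw : IsArmSeries w) (t : ℝ) : 0 < growth w t :=
  one_div_pos.2 (env_flow_pos hw t)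

lemma growth_zero {w : ℕ → ℝ≥0∞} (hw : IsArmSeries w) : growth w 0 = 1 := by
  rw [growth, flow_zero hw, env_of_nonpos le_rfl, div_one]

lemma continuous_growth {w : ℕ → ℝ≥0∞} (hw : IsArmSeries w) : Continuous (growth w) :=
  continuous_const.div ((continuous_env hw).comp (continuous_flow hw))
    fun t => (env_flow_pos hw t).ne'

lemma growth_monotone {w : ℕ → ℝ≥0∞} (hw : IsArmSeries w) : Monotone (growth w) := fun _ t h =>
  one_div_le_one_div_of_le (env_flow_pos hw t) (env_antitone hw ((flow_strictMono hw).monotone h))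

/-- `α' = p(β)`, because `β' = M(β)² = α⁻²` and `M' = -p`. -/
lemma hasDerivAt_growth {w : ℕ → ℝ≥0∞} (hw : IsArmSeries w) {t : ℝ} (ht : 0 < t)
    (hc : ContinuousAt (slp w) (flow w t)) : HasDerivAt (growth w) (slp w (flow w t)) t := by
  have h1 := (hasDerivAt_env hw (flow_mem_posSet hw ht) hc).comp t (hasDerivAt_flow hw t)
  have h2 := h1.inv (env_flow_pos hw t).ne'
  have h3 : growth w = (env w ∘ flow w)⁻¹ := by
    ext s
    simp [growth]
  rw [h3]
  convert! h2 using 1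
  have := (env_flow_pos hw t).ne'
  simp only [Function.comp_apply]
  field_simp

/-- The exceptional times in the differential equation for `α`. -/
def badTimes (w : ℕ → ℝ≥0∞) : Set ℝ := {t | 0 < t ∧ ¬ContinuousAt (slp w) (flow w t)}

lemma countable_badTimes {w : ℕ → ℝ≥0∞} (hw : IsArmSeries w) : (badTimes w).Countable := by
  refine ((countable_not_continuousAt_slp hw).preimage (flow_strictMono hw).injective).mono ?_
  exact fun t ht => ⟨flow_mem_posSet hw ht.1, ht.2⟩

lemma ae_hasDerivAt_growth {w : ℕ → ℝ≥0∞} (hw : IsArmSeries w) :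
    ∀ᵐ t, 0 < t → HasDerivAt (growth w) (slp w (flow w t)) t := by
  have h := (countable_badTimes hw).ae_notMem volume
  filter_upwards [h] with t ht h0
  refine hasDerivAt_growth hw h0 ?_
  by_contra hn
  exact ht ⟨h0, hn⟩

lemma intervalIntegrable_slp_flow {w : ℕ → ℝ≥0∞} (hw : IsArmSeries w) {t : ℝ} (ht : 0 ≤ t) :
    IntervalIntegrable (fun s => slp w (flow w s)) volume 0 t := by
  refine ((growth_monotone hw).monotoneOn (uIcc 0 t)).intervalIntegrable_deriv.congr_ae ?_
  rw [uIoc_of_le ht]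
  filter_upwards [ae_restrict_of_ae (ae_hasDerivAt_growth hw), ae_restrict_mem measurableSet_Ioc]
    with s hs hs'
  exact (hs hs'.1).deriv

/-- The function `α` is the integral of its derivative, which exists outside a countable set. -/
lemma growth_eq {w : ℕ → ℝ≥0∞} (hw : IsArmSeries w) {t : ℝ} (ht : 0 ≤ t) :
    growth w t = 1 + ∫ s in (0 : ℝ)..t, slp w (flow w s) := by
  have h := integral_eq_of_hasDerivAt_off_countable_of_le (growth w) (fun s => slp w (flow w s)) ht
    (countable_badTimes hw) (continuous_growth hw).continuousOn (fun s hs => by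
      refine hasDerivAt_growth hw hs.1.1 ?_
      by_contra hn
      exact hs.2 ⟨hs.1.1, hn⟩) (intervalIntegrable_slp_flow hw ht)
  rw [growth_zero hw] at h
  linarith

/-- `A_t = α_t' / α_t` for `t > 0`. -/
def armFlow (w : ℕ → ℝ≥0∞) (t : ℝ) : ℝ := slp w (flow w t) / growth w t

lemma armFlow_nonneg {w : ℕ → ℝ≥0∞} (hw : IsArmSeries w) (t : ℝ) : 0 ≤ armFlow w t :=
  div_nonneg (slp_nonneg _ _) (growth_pos hw t).le

lemma intervalIntegrable_armFlow {w : ℕ → ℝ≥0∞} (hw : IsArmSeries w) {t : ℝ} (ht : 0 ≤ t) :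
    IntervalIntegrable (armFlow w) volume 0 t := by
  have h : ContinuousOn (fun s => (growth w s)⁻¹) (uIcc 0 t) :=
    ((continuous_growth hw).inv₀ fun s => (growth_pos hw s).ne').continuousOn
  exact (intervalIntegrable_slp_flow hw ht).mul_continuousOn h

lemma flow_eq {w : ℕ → ℝ≥0∞} (hw : IsArmSeries w) (t : ℝ) :
    flow w t = ∫ s in (0 : ℝ)..t, 1 / (growth w s) ^ 2 := by
  have h := intervalIntegral.integral_eq_sub_of_hasDerivAt (a := 0) (b := t)
    (fun s _ => hasDerivAt_flow hw s)
    (((continuous_env hw).comp (continuous_flow hw)).pow 2).continuousOn.intervalIntegrable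
  rw [flow_zero hw, sub_zero] at h
  rw [← h]
  refine intervalIntegral.integral_congr fun s _ => ?_
  simp [growth]

/-! ### Absolutely continuous functions -/

lemma absolutelyContinuousOnInterval_comp {g f : ℝ → ℝ} {a b : ℝ} (hg : ContDiff ℝ 1 g)
    (hf : AbsolutelyContinuousOnInterval f a b) :
    AbsolutelyContinuousOnInterval (fun t => g (f t)) a b := by
  obtain ⟨C, hC⟩ := hf.exists_bound
  obtain ⟨K, hK⟩ := (hg.contDiffOn (s := Icc (-C) C)).exists_lipschitzOnWith (by decide)
    (convex_Icc _ _) isCompact_Icc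
  have hmem : ∀ t ∈ uIcc a b, f t ∈ Icc (-C) C := fun t ht => abs_le.1 (hC t ht)
  rw [absolutelyContinuousOnInterval_iff] at hf ⊢
  intro ε hε
  obtain ⟨δ, hδ, h⟩ := hf (ε / (K + 1)) (by positivity)
  refine ⟨δ, hδ, fun E hE hsum => ?_⟩
  have h1 := h E hE hsum
  calc ∑ i ∈ Finset.range E.1, dist (g (f (E.2 i).1)) (g (f (E.2 i).2))
      ≤ ∑ i ∈ Finset.range E.1, K * dist (f (E.2 i).1) (f (E.2 i).2) := by
        refine Finset.sum_le_sum fun i hi => ?_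
        have h2 := hE.1 i hi
        exact hK.dist_le_mul _ (hmem _ h2.1) _ (hmem _ h2.2)
    _ = K * ∑ i ∈ Finset.range E.1, dist (f (E.2 i).1) (f (E.2 i).2) := by rw [Finset.mul_sum]
    _ ≤ K * (ε / (K + 1)) := by gcongr
    _ < (K + 1) * (ε / (K + 1)) := by
      have : 0 < ε / ((K : ℝ) + 1) := by positivity
      linarith
    _ = ε := by field_simp

/-- The last time before `T` at which `g` is non-negative, if `g` starts non-negative and ends
negative. -/
lemma exists_last_nonneg {g : ℝ → ℝ} {T : ℝ} (hT : 0 ≤ T) (hc : ContinuousOn g (Icc 0 T))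
    (h0 : 0 ≤ g 0) (hneg : g T < 0) :
    ∃ t₀ ∈ Ico 0 T, 0 ≤ g t₀ ∧ ∀ s ∈ Ioc t₀ T, g s < 0 := by
  have hcl : IsClosed (Icc 0 T ∩ g ⁻¹' Ici 0) := hc.preimage_isClosed_of_isClosed isClosed_Icc
    isClosed_Ici
  set Z := Icc 0 T ∩ g ⁻¹' Ici 0 with hZ
  have hb : BddAbove Z := ⟨T, fun s hs => hs.1.2⟩
  have hmem : sSup Z ∈ Z := hcl.csSup_mem ⟨0, ⟨le_rfl, hT⟩, h0⟩ hb
  refine ⟨sSup Z, ⟨hmem.1.1, lt_of_le_of_ne hmem.1.2 ?_⟩, hmem.2, fun s hs => ?_⟩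
  · intro h
    have := hmem.2
    rw [h] at this
    exact absurd hneg (not_lt.2 this)
  · by_contra h
    exact absurd (le_csSup hb ⟨⟨hmem.1.1.trans hs.1.le, hs.2⟩, not_lt.1 h⟩) (not_le.2 hs.1)

/-! ### Every solution is a time change of the system without loss term -/

/-- For concentrations `α^{-a} P_{a,m}(β)` the gain term is `α^{-a-2} P_{a,m}'(β)`; it involves only
masses below `m`. -/
lemma gain_eq {c₀ c : Conc} {α β : ℝ} (hα : 0 < α) (a : ℕ) (m : ℕ+)
    (hc : ∀ m' < m, ∀ a', (c a' m' : ℝ) = (gainPoly c₀ a' m').eval β / α ^ a') :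
    gain c a m = (gainPoly c₀ a m).derivative.eval β / α ^ (a + 2) := by
  rw [derivative_gainPoly, Polynomial.eval_mul, Polynomial.eval_C, gain, mul_div_assoc,
    Polynomial.eval_finsetSum, Finset.sum_div]
  congr 1
  refine Finset.sum_congr rfl fun a' ha' => ?_
  rw [Polynomial.eval_finsetSum, Finset.sum_div]
  refine Finset.sum_congr rfl fun m' hm' => ?_
  have hm := (Finset.mem_Ico.1 hm').2
  have ha := (Finset.mem_Icc.1 ha').2
  have hm2 : m - m' < m := by
    rw [← PNat.coe_lt_coe, PNat.sub_coe, if_pos hm]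
    have := m'.pos
    have := m.pos
    omega
  rw [hc m' hm, hc (m - m') hm2, Polynomial.eval_mul, Polynomial.eval_mul, Polynomial.eval_C]
  have hpow : α ^ (a + 2) = α ^ a' * α ^ (a + 2 - a') := by
    rw [← pow_add]
    congr 1
    omega
  rw [hpow]
  field_simp

lemma arms_eq_genFun (c : Conc) : arms c = genFun c 1 1 := by
  simp [arms, pairing, genFun]

lemma arms_eq_kser (c : Conc) : arms c = kser (armCoeff c 1) 1 := by
  rw [arms_eq_genFun, genFun_eq_kser, ENNReal.ofReal_one]

section Solution

variable {c₀ : Conc} {c : ℝ → Conc}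

lemma IsSolution.conc_eq (h : IsSolution c₀ c) (a : ℕ) (m : ℕ+) {t : ℝ} (ht : 0 ≤ t) :
    (c t a m : ℝ) = (c₀ a m : ℝ) + (∫ s in (0 : ℝ)..t, gain (c s) a m)
      - ∫ s in (0 : ℝ)..t, loss (c s) a m := by
  rcases ht.eq_or_lt with rfl | ht
  · simp [h.initial]
  · exact h.equation a m t ht

lemma IsSolution.absolutelyContinuous (h : IsSolution c₀ c) (a : ℕ) (m : ℕ+) {T : ℝ}
    (hT : 0 < T) : AbsolutelyContinuousOnInterval (fun t => (c₀ a m : ℝ) +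
      (∫ s in (0 : ℝ)..t, gain (c s) a m) - ∫ s in (0 : ℝ)..t, loss (c s) a m) 0 T := by
  have h1 := (h.gain_integrable a m T hT).absolutelyContinuousOnInterval_intervalIntegral
    (c := 0) left_mem_uIcc
  have h2 := (h.loss_integrable a m T hT).absolutelyContinuousOnInterval_intervalIntegral
    (c := 0) left_mem_uIcc
  have h3 : AbsolutelyContinuousOnInterval (fun _ => (c₀ a m : ℝ)) 0 T :=
    (contDiff_const (n := 1)).contDiffOn.absolutelyContinuousOnInterval
  exact (h3.fun_add h1).fun_sub h2

lemma IsSolution.continuousOn_conc (h : IsSolution c₀ c) (a : ℕ) (m : ℕ+) {T : ℝ}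
    (hT : 0 < T) : ContinuousOn (fun t => (c t a m : ℝ)) (Icc 0 T) := by
  have h1 := (h.absolutelyContinuous a m hT).continuousOn
  rw [uIcc_of_le hT.le] at h1
  exact h1.congr fun t ht => h.conc_eq a m ht.1

lemma IsSolution.aemeasurable_arms (h : IsSolution c₀ c) {T : ℝ} (hT : 0 < T) :
    AEMeasurable (fun s => arms (c s)) (volume.restrict (Ioc 0 T)) := by
  unfold arms pairing
  refine AEMeasurable.tsum fun a => AEMeasurable.tsum fun m => ?_
  refine AEMeasurable.const_mul ?_ _
  have h1 : AEMeasurable (fun s => (c s a m : ℝ)) (volume.restrict (Ioc 0 T)) :=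
    (((h.continuousOn_conc a m hT).mono Ioc_subset_Icc_self).aestronglyMeasurable
      measurableSet_Ioc).aemeasurable
  have h2 := h1.ennreal_ofReal
  simpa using h2

lemma IsSolution.ae_arms_lt_top (h : IsSolution c₀ c) {T : ℝ} (hT : 0 < T) :
    ∀ᵐ s, s ∈ Ioc 0 T → arms (c s) < ⊤ := by
  have h1 := ae_lt_top' ((h.aemeasurable_arms hT).pow_const 2) (h.arms_sq T hT).ne
  rw [ae_restrict_iff' measurableSet_Ioc] at h1
  filter_upwards [h1] with s hs hs'
  simpa using hs hs'

lemma IsSolution.intervalIntegrable_arms (h : IsSolution c₀ c) {T : ℝ} (hT : 0 ≤ T) :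
    IntervalIntegrable (fun s => (arms (c s)).toReal) volume 0 T := by
  rcases hT.eq_or_lt with rfl | hT
  · exact IntervalIntegrable.refl
  rw [intervalIntegrable_iff_integrableOn_Ioc_of_le hT.le]
  refine integrable_toReal_of_lintegral_ne_top (h.aemeasurable_arms hT) ?_
  refine ne_of_lt (lt_of_le_of_lt (lintegral_mono fun s => (?_ : _ ≤ 1 + arms (c s) ^ 2)) ?_)
  · rcases le_total (arms (c s)) 1 with h1 | h1
    · exact h1.trans le_self_add
    · refine le_trans ?_ le_add_self
      rw [sq]
      exact le_mul_of_one_le_left' h1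
  · rw [lintegral_add_left measurable_const]
    refine ENNReal.add_lt_top.2 ⟨?_, h.arms_sq T hT⟩
    simp

lemma alpha_pos (c : ℝ → Conc) (t : ℝ) : 0 < alpha c t := Real.exp_pos _

lemma alpha_zero (c : ℝ → Conc) : alpha c 0 = 1 := by simp [alpha]

lemma beta_zero (c : ℝ → Conc) : beta c 0 = 0 := by simp [beta]

lemma IsSolution.integral_arms_ac (h : IsSolution c₀ c) {T : ℝ} (hT : 0 ≤ T) :
    AbsolutelyContinuousOnInterval (fun t => ∫ s in (0 : ℝ)..t, (arms (c s)).toReal) 0 T :=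
  (h.intervalIntegrable_arms hT).absolutelyContinuousOnInterval_intervalIntegral left_mem_uIcc

lemma IsSolution.continuousOn_alpha (h : IsSolution c₀ c) {T : ℝ} (hT : 0 ≤ T) :
    ContinuousOn (alpha c) (Icc 0 T) := by
  have := (h.integral_arms_ac hT).continuousOn
  rw [uIcc_of_le hT] at this
  exact this.rexp

lemma IsSolution.intervalIntegrable_inv_alpha_sq (h : IsSolution c₀ c) {T : ℝ} (hT : 0 ≤ T) :
    IntervalIntegrable (fun s => 1 / (alpha c s) ^ 2) volume 0 T := by
  refine ContinuousOn.intervalIntegrable ?_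
  rw [uIcc_of_le hT]
  exact continuousOn_const.div ((h.continuousOn_alpha hT).pow 2)
    fun s _ => pow_ne_zero 2 (alpha_pos c s).ne'

lemma IsSolution.beta_ac (h : IsSolution c₀ c) {T : ℝ} (hT : 0 ≤ T) :
    AbsolutelyContinuousOnInterval (beta c) 0 T :=
  (h.intervalIntegrable_inv_alpha_sq hT).absolutelyContinuousOnInterval_intervalIntegral
    left_mem_uIcc

lemma IsSolution.beta_sub (h : IsSolution c₀ c) {s t : ℝ} (hs : 0 ≤ s) (ht : 0 ≤ t) :
    beta c t - beta c s = ∫ r in s..t, 1 / (alpha c r) ^ 2 :=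
  intervalIntegral.integral_interval_sub_left (h.intervalIntegrable_inv_alpha_sq ht)
    (h.intervalIntegrable_inv_alpha_sq hs)

lemma IsSolution.beta_pos (h : IsSolution c₀ c) {t : ℝ} (ht : 0 < t) : 0 < beta c t :=
  intervalIntegral.intervalIntegral_pos_of_pos (h.intervalIntegrable_inv_alpha_sq ht.le)
    (fun s => one_div_pos.2 (pow_pos (alpha_pos c s) 2)) ht

/-- Any solution is a time change of the system without loss term. This is proved by induction on
the mass: the production of mass `m` only involves smaller masses, and
`c_t(a,m) α_t^a - P_{a,m}(β_t)` is absolutely continuous with zero derivative. -/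
theorem IsSolution.eq_gainPoly (h : IsSolution c₀ c) (m : ℕ+) : ∀ (a : ℕ) (t : ℝ), 0 ≤ t →
    (c t a m : ℝ) = (gainPoly c₀ a m).eval (beta c t) / (alpha c t) ^ a := by
  induction m using PNat.strongInductionOn with
  | _ m ih =>
    intro a T hT
    rcases hT.eq_or_lt with rfl | hT'
    · rw [h.initial, alpha_zero, beta_zero, eval_gainPoly_zero]
      simp
    set f : ℝ → ℝ := fun t => (c₀ a m : ℝ) +
      (∫ s in (0 : ℝ)..t, gain (c s) a m) - ∫ s in (0 : ℝ)..t, loss (c s) a m with hf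
    set J : ℝ → ℝ := fun t => ∫ s in (0 : ℝ)..t, (arms (c s)).toReal with hJ
    have hexp : ∀ t, Real.exp (a * J t) = alpha c t ^ a := fun t => by
      rw [alpha, ← Real.exp_nat_mul]
    have hac : AbsolutelyContinuousOnInterval
        (fun t => f t * Real.exp (a * J t) - (gainPoly c₀ a m).eval (beta c t)) 0 T :=
      ((h.absolutelyContinuous a m hT').fun_mul (absolutelyContinuousOnInterval_comp
        (g := fun x => Real.exp (a * x)) (by fun_prop) (h.integral_arms_ac hT))).fun_sub
        (absolutelyContinuousOnInterval_comp (g := fun x => (gainPoly c₀ a m).eval x)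
          (by
            simp_rw [← Polynomial.coe_aeval_eq_eval]
            exact Polynomial.contDiff_aeval _ _) (h.beta_ac hT))
    have hd : ∀ᵐ s, s ∈ uIcc 0 T → HasDerivAt
        (fun t => f t * Real.exp (a * J t) - (gainPoly c₀ a m).eval (beta c t)) 0 s := by
      filter_upwards [(h.gain_integrable a m T hT').ae_hasDerivAt_integral,
        (h.loss_integrable a m T hT').ae_hasDerivAt_integral,
        (h.intervalIntegrable_arms hT).ae_hasDerivAt_integral,
        (h.intervalIntegrable_inv_alpha_sq hT).ae_hasDerivAt_integral] with s h1 h2 h3 h4 hs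
      have h1 := h1 hs 0 left_mem_uIcc
      have h2 := h2 hs 0 left_mem_uIcc
      have h3 := h3 hs 0 left_mem_uIcc
      have h4 := h4 hs 0 left_mem_uIcc
      have hs0 : 0 ≤ s := by
        rw [uIcc_of_le hT] at hs
        exact hs.1
      have h5 := ((((hasDerivAt_const s (c₀ a m : ℝ)).add h1).sub h2).mul
        ((h3.const_mul (a : ℝ)).exp)).sub
        (((gainPoly c₀ a m).hasDerivAt (beta c s)).comp s h4)
      convert! h5 using 1
      have hfs : (c₀ a m : ℝ) + (∫ s in (0 : ℝ)..s, gain (c s) a m) -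
          ∫ s in (0 : ℝ)..s, loss (c s) a m = c s a m := (h.conc_eq a m hs0).symm
      have hg := gain_eq (c₀ := c₀) (c := c s) (alpha_pos c s) (β := beta c s) a m
        (fun m' hm' a' => ih m' hm' a' s hs0)
      have hexp' : Real.exp (a * ∫ (x : ℝ) in (0 : ℝ)..s, (arms (c x)).toReal) = alpha c s ^ a :=
        hexp s
      simp only [Pi.add_apply, Pi.sub_apply]
      rw [hfs, hexp', hg, loss]
      have := (alpha_pos c s).ne'
      field_simp
      ring
    obtain ⟨C, hC⟩ := hac.const_of_ae_hasDerivAt_zero hd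
    have e0 := hC 0 left_mem_uIcc
    have eT := hC T right_mem_uIcc
    have hfT : f T = c T a m := (h.conc_eq a m hT).symm
    have hf0 : f 0 = c₀ a m := by simp [hf]
    rw [hexp, alpha_zero, beta_zero, eval_gainPoly_zero, one_pow, mul_one, hf0, sub_self] at e0
    rw [hexp, hfT, ← e0, sub_eq_zero] at eT
    rw [← eT, mul_div_assoc, div_self (pow_ne_zero _ (alpha_pos c T).ne'), mul_one]

/-- The generating function of concentrations of the form `α^{-a} P_{a,m}(β)`. -/
theorem genFun_eq_kser_lfix {c : Conc} {α β : ℝ} (hα : 0 < α) (hβ : 0 ≤ β)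
    (hc : ∀ a m, (c a m : ℝ) = (gainPoly c₀ a m).eval β / α ^ a) {x : ℝ} (y : ℝ) :
    genFun c x y = (ENNReal.ofReal α)⁻¹ * kser (armCoeff c₀ (ENNReal.ofReal y))
      (lfix (armCoeff c₀ (ENNReal.ofReal y)) (ENNReal.ofReal (x / α)) (ENNReal.ofReal β)) := by
  rw [genFun_eq_ev hα hβ hc, ev_gainSeries, ENNReal.ofReal_div_of_pos hα]

lemma arms_eq_kser_lfix {c : Conc} {α β : ℝ} (hα : 0 < α) (hβ : 0 ≤ β)
    (hc : ∀ a m, (c a m : ℝ) = (gainPoly c₀ a m).eval β / α ^ a) :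
    arms c = (ENNReal.ofReal α)⁻¹ * kser (armCoeff c₀ 1)
      (lfix (armCoeff c₀ 1) (ENNReal.ofReal (1 / α)) (ENNReal.ofReal β)) := by
  rw [arms_eq_genFun, genFun_eq_kser_lfix hα hβ hc, ENNReal.ofReal_one]

/-- The number of particles bounds the coefficients, as `w_j = (j+1) ∑_m c₀(j+1,m)`. -/
lemma isArmSeries_armCoeff (hfin : pairing c₀ (fun _ => 1) < ⊤) (hA₀ : 0 < arms c₀) :
    IsArmSeries (armCoeff c₀ 1) := by
  refine ⟨⟨(pairing c₀ (fun _ => 1)).toNNReal, fun j => ?_⟩, ?_⟩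
  · rw [ENNReal.coe_toNNReal hfin.ne, armCoeff]
    gcongr
    refine le_trans (le_of_eq ?_) (ENNReal.le_tsum (j + 1))
    simp
  · by_contra hn
    push Not at hn
    rw [arms_eq_kser, kser] at hA₀
    simp [hn] at hA₀

lemma IsSolution.beta_nonneg (h : IsSolution c₀ c) {t : ℝ} (ht : 0 ≤ t) : 0 ≤ beta c t := by
  rcases ht.eq_or_lt with rfl | ht
  · rw [beta_zero]
  · exact (h.beta_pos ht).le

lemma IsSolution.arms_eq (h : IsSolution c₀ c) {t : ℝ} (ht : 0 ≤ t) :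
    arms (c t) = (ENNReal.ofReal (alpha c t))⁻¹ * kser (armCoeff c₀ 1)
      (lfix (armCoeff c₀ 1) (ENNReal.ofReal (1 / alpha c t)) (ENNReal.ofReal (beta c t))) :=
  arms_eq_kser_lfix (alpha_pos c t) (h.beta_nonneg ht) fun a m => h.eq_gainPoly m a t ht

lemma IsSolution.inv_alpha_sub (h : IsSolution c₀ c) {s t : ℝ} (hs : 0 ≤ s) (hst : s ≤ t) :
    IntervalIntegrable (fun r => (arms (c r)).toReal / alpha c r) volume s t ∧
    1 / alpha c s - 1 / alpha c t = ∫ r in s..t, (arms (c r)).toReal / alpha c r := by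
  have ht := hs.trans hst
  have hsub : uIcc s t ⊆ uIcc 0 t := by
    rw [uIcc_of_le hst, uIcc_of_le ht]
    exact Icc_subset_Icc_left hs
  have hint : IntervalIntegrable (fun r => (arms (c r)).toReal / alpha c r) volume s t := by
    refine IntervalIntegrable.mul_continuousOn
      ((h.intervalIntegrable_arms ht).mono_set hsub) ?_
    refine ((h.continuousOn_alpha ht).mono ?_).inv₀ fun r _ => (alpha_pos c r).ne'
    rwa [uIcc_of_le ht] at hsub
  refine ⟨hint, ?_⟩
  have hac : AbsolutelyContinuousOnInterval (fun t => Real.exp (-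
      ∫ s in (0 : ℝ)..t, (arms (c s)).toReal)) 0 t :=
    absolutelyContinuousOnInterval_comp (g := fun x => Real.exp (-x)) (by fun_prop)
      (h.integral_arms_ac ht)
  have h1 := (hac.mono hsub).integral_deriv_eq_sub
  have hexp : ∀ t, Real.exp (-∫ s in (0 : ℝ)..t, (arms (c s)).toReal) = 1 / alpha c t := by
    intro t
    rw [Real.exp_neg, alpha, one_div]
  have h2 : ∫ r in s..t, deriv (fun t => Real.exp (-
      ∫ s in (0 : ℝ)..t, (arms (c s)).toReal)) r = ∫ r in s..t, -((arms (c r)).toReal / alpha c r)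
      := by
    refine intervalIntegral.integral_congr_ae ?_
    filter_upwards [(h.intervalIntegrable_arms ht).ae_hasDerivAt_integral] with r hr hr'
    have hr'' := hsub (uIoc_subset_uIcc hr')
    have h3 := (hr hr'' 0 left_mem_uIcc).neg.exp
    have h4 : HasDerivAt (fun t => Real.exp (-∫ s in (0 : ℝ)..t, (arms (c s)).toReal)) _ r := h3
    rw [h4.deriv]
    simp only [Pi.neg_apply]
    rw [hexp]
    ring
  rw [h2, intervalIntegral.integral_neg, hexp, hexp] at h1
  linarith

/-- If `1/α_t < x - β_t κ(x)` then the least fixed point defining `A_t` is below `x`, so that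
`A_t ≤ κ(x)/α_t`. -/
lemma IsSolution.arms_le_of_lt (h : IsSolution c₀ c) {x t : ℝ} (ht : 0 ≤ t)
    (hx : kser (armCoeff c₀ 1) (ENNReal.ofReal x) < ⊤)
    (hlt : 1 / alpha c t ≤ x - beta c t * kap (armCoeff c₀ 1) x) :
    (arms (c t)).toReal ≤ kap (armCoeff c₀ 1) x / alpha c t := by
  have hα := alpha_pos c t
  refine ENNReal.toReal_le_of_le_ofReal (div_nonneg (kap_nonneg _ _) hα.le) ?_
  rw [h.arms_eq ht, ENNReal.ofReal_div_of_pos (x := kap _ _) hα, ofReal_kap hx,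
    ENNReal.div_eq_inv_mul]
  gcongr
  exact kser_mono _ (lfix_le_ofReal (h.beta_nonneg ht) (by positivity) hx hlt)

/-- The lower bound `1/α_t ≥ x - β_t κ(x)`: as soon as it fails, the difference increases. -/
lemma IsSolution.le_inv_alpha (h : IsSolution c₀ c) (hw : IsArmSeries (armCoeff c₀ 1)) {x : ℝ}
    (hx0 : 0 ≤ x) (hx1 : x < 1) {T : ℝ} (hT : 0 ≤ T) :
    x - beta c T * kap (armCoeff c₀ 1) x ≤ 1 / alpha c T := by
  by_contra hcon
  set κ := kap (armCoeff c₀ 1) x with hκ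
  have hfin := kser_lt_top hw hx0 hx1
  have hβc : ContinuousOn (beta c) (Icc 0 T) := by
    have := (h.beta_ac hT).continuousOn
    rwa [uIcc_of_le hT] at this
  have hcont : ContinuousOn (fun t => 1 / alpha c t - x + beta c t * κ) (Icc 0 T) :=
    ((continuousOn_const.div (h.continuousOn_alpha hT) fun s _ => (alpha_pos c s).ne').sub
      continuousOn_const).add (hβc.mul continuousOn_const)
  obtain ⟨t₀, ht₀, hg₀, hneg⟩ := exists_last_nonneg hT hcont
    (by rw [alpha_zero, beta_zero]; simp; linarith) (by linarith)
  obtain ⟨hi, he⟩ := h.inv_alpha_sub ht₀.1 ht₀.2.le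
  have hb := h.beta_sub ht₀.1 hT
  have hi2 : IntervalIntegrable (fun r => 1 / (alpha c r) ^ 2) volume t₀ T :=
    (h.intervalIntegrable_inv_alpha_sq hT).mono_set (by
      rw [uIcc_of_le ht₀.2.le, uIcc_of_le hT]
      exact Icc_subset_Icc_left ht₀.1)
  have hle : ∫ r in t₀..T, (arms (c r)).toReal / alpha c r ≤
      ∫ r in t₀..T, 1 / (alpha c r) ^ 2 * κ := by
    refine intervalIntegral.integral_mono_on_of_le_Ioo ht₀.2.le hi (hi2.mul_const κ) fun r hr => ?_
    have hr0 := ht₀.1.trans hr.1.le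
    have h1 := hneg r ⟨hr.1, hr.2.le⟩
    have h2 := h.arms_le_of_lt hr0 hfin (x := x) (by linarith)
    have hα := alpha_pos c r
    calc (arms (c r)).toReal / alpha c r ≤ (κ / alpha c r) / alpha c r := by gcongr
      _ = 1 / (alpha c r) ^ 2 * κ := by field_simp
  rw [intervalIntegral.integral_mul_const, ← he, ← hb] at hle
  linarith

/-- The upper bound `1/α_t ≤ M(β_t)`: where it fails, the least fixed point exceeds `1`, and
`1/α - M(β)` decreases. -/
lemma IsSolution.inv_alpha_le (h : IsSolution c₀ c) (hw : IsArmSeries (armCoeff c₀ 1))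
    {T : ℝ} (hT : 0 ≤ T) : 1 / alpha c T ≤ env (armCoeff c₀ 1) (beta c T) := by
  by_contra hcon
  set w := armCoeff c₀ 1 with hwdef
  have hβc : ContinuousOn (beta c) (Icc 0 T) := by
    have := (h.beta_ac hT).continuousOn
    rwa [uIcc_of_le hT] at this
  have hcont : ContinuousOn (fun t => env w (beta c t) - 1 / alpha c t) (Icc 0 T) :=
    ((continuous_env hw).comp_continuousOn hβc).sub
      (continuousOn_const.div (h.continuousOn_alpha hT) fun s _ => (alpha_pos c s).ne')
  obtain ⟨t₀, ht₀, hg₀, hneg⟩ := exists_last_nonneg hT hcont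
    (by rw [alpha_zero, beta_zero, env_of_nonpos le_rfl]; simp) (by linarith)
  have hT' : 0 < T := ht₀.1.trans_lt ht₀.2
  -- wherever the number of arms is finite, the least fixed point exceeds `1`
  have hgt : ∀ r ∈ Ioc t₀ T, arms (c r) < ⊤ →
      kser w 1 < ⊤ ∧ kap w 1 / alpha c r ≤ (arms (c r)).toReal := by
    intro r hr hfin
    have hr0 : 0 < r := ht₀.1.trans_lt hr.1
    have hα := alpha_pos c r
    have hl : (0 : ℝ) ≤ 1 / alpha c r := by positivity
    have hA := h.arms_eq hr0.le
    have hk : kser w (lfix w (ENNReal.ofReal (1 / alpha c r)) (ENNReal.ofReal (beta c r))) < ⊤ := by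
      by_contra hn
      rw [not_lt, top_le_iff] at hn
      rw [hA, ← hwdef, hn, ENNReal.mul_top (ENNReal.inv_ne_zero.2 ENNReal.ofReal_ne_top)] at hfin
      exact lt_irrefl _ hfin
    have hlf : lfix w (ENNReal.ofReal (1 / alpha c r)) (ENNReal.ofReal (beta c r)) ≠ ⊤ := by
      rw [← lfix_eq]
      exact (ENNReal.add_lt_top.2 ⟨ENNReal.ofReal_lt_top,
        ENNReal.mul_lt_top ENNReal.ofReal_lt_top hk⟩).ne
    have h1 := toReal_lfix (h.beta_pos hr0) hl hlf
    set y := (lfix w (ENNReal.ofReal (1 / alpha c r)) (ENNReal.ofReal (beta c r))).toReal with hy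
    have hyl : ENNReal.ofReal y =
      lfix w (ENNReal.ofReal (1 / alpha c r)) (ENNReal.ofReal (beta c r)) :=
      ENNReal.ofReal_toReal hlf
    have hy1 : 1 < y := by
      by_contra hle
      have hmem : y ∈ finSet w := ⟨⟨ENNReal.toReal_nonneg, not_lt.1 hle⟩, by rwa [hyl]⟩
      have h2 := le_env (h.beta_pos hr0) hmem
      have h3 := hneg r hr
      linarith
    have hle : kser w 1 ≤ kser w (lfix w (ENNReal.ofReal (1 / alpha c r))
        (ENNReal.ofReal (beta c r))) := by
      refine kser_mono w ?_
      rw [← hyl, ← ENNReal.ofReal_one]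
      exact ENNReal.ofReal_le_ofReal hy1.le
    refine ⟨hle.trans_lt hk, ?_⟩
    rw [hA, ENNReal.toReal_mul, ENNReal.toReal_inv, ENNReal.toReal_ofReal hα.le, div_eq_inv_mul]
    gcongr
    rw [kap, ENNReal.ofReal_one]
    exact ENNReal.toReal_mono hk.ne hle
  have hae := h.ae_arms_lt_top hT'
  have hk1 : kser w 1 < ⊤ := by
    have hne : (volume.restrict (Ioc t₀ T)) ≠ 0 := by
      rw [Ne, Measure.restrict_eq_zero, Real.volume_Ioc]
      simpa using ht₀.2
    have hae' : ∀ᵐ r ∂(volume.restrict (Ioc t₀ T)), kser w 1 < ⊤ := by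
      filter_upwards [ae_restrict_of_ae hae, ae_restrict_mem measurableSet_Ioc] with r h1 h2
      exact (hgt r h2 (h1 ⟨ht₀.1.trans_lt h2.1, h2.2⟩)).1
    have : (ae (volume.restrict (Ioc t₀ T))).NeBot := ae_neBot.2 hne
    exact hae'.exists.choose_spec
  have hmem1 : (1 : ℝ) ∈ finSet w := ⟨⟨zero_le_one, le_rfl⟩, by rwa [ENNReal.ofReal_one]⟩
  obtain ⟨hi, he⟩ := h.inv_alpha_sub ht₀.1 ht₀.2.le
  have hb := h.beta_sub ht₀.1 hT
  have hi2 : IntervalIntegrable (fun r => 1 / (alpha c r) ^ 2) volume t₀ T :=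
    (h.intervalIntegrable_inv_alpha_sq hT).mono_set (by
      rw [uIcc_of_le ht₀.2.le, uIcc_of_le hT]
      exact Icc_subset_Icc_left ht₀.1)
  have hle : ∫ r in t₀..T, 1 / (alpha c r) ^ 2 * kap w 1 ≤
      ∫ r in t₀..T, (arms (c r)).toReal / alpha c r := by
    refine intervalIntegral.integral_mono_ae_restrict ht₀.2.le (hi2.mul_const _) hi ?_
    have hne : ∀ᵐ r : ℝ, r ≠ t₀ := by simp [ae_iff, measure_singleton]
    filter_upwards [ae_restrict_of_ae hae, ae_restrict_mem measurableSet_Icc,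
      ae_restrict_of_ae hne] with r h1 h2 h3
    have h2' : r ∈ Ioc t₀ T := ⟨lt_of_le_of_ne h2.1 (Ne.symm h3), h2.2⟩
    have h4 := (hgt r h2' (h1 ⟨ht₀.1.trans_lt h2'.1, h2'.2⟩)).2
    have hα := alpha_pos c r
    calc 1 / (alpha c r) ^ 2 * kap w 1 = kap w 1 / alpha c r / alpha c r := by field_simp
      _ ≤ _ := by gcongr
  rw [intervalIntegral.integral_mul_const, ← he, ← hb] at hle
  -- the envelope decreases at rate at most `κ(1)`
  have henv : env w (beta c t₀) - (beta c T - beta c t₀) * kap w 1 ≤ env w (beta c T) := by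
    have hTpos := h.beta_pos hT'
    rcases (h.beta_nonneg ht₀.1).eq_or_lt with hz | hpos
    · rw [← hz, env_of_nonpos le_rfl]
      have := le_env hTpos hmem1
      linarith
    · obtain ⟨z, hz⟩ := exists_isMaximizer hw hpos
      have h1 := hz.sub_le hTpos
      have h2 : kap w z ≤ kap w 1 := kap_mono hz.mem.1.2 hmem1.2
      have h3 : 0 ≤ beta c T - beta c t₀ := by
        rw [hb]
        exact intervalIntegral.integral_nonneg ht₀.2.le fun r _ => by positivity
      nlinarith
  linarith

/-- Along any solution, `1/α_t = M(β_t)`. -/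
theorem IsSolution.inv_alpha_eq (h : IsSolution c₀ c) (hw : IsArmSeries (armCoeff c₀ 1))
    {t : ℝ} (ht : 0 ≤ t) : 1 / alpha c t = env (armCoeff c₀ 1) (beta c t) := by
  refine le_antisymm (h.inv_alpha_le hw ht) ?_
  rcases ht.eq_or_lt with rfl | ht'
  · rw [alpha_zero, beta_zero, env_of_nonpos le_rfl, div_one]
  have hβ := h.beta_pos ht'
  obtain ⟨z, hz⟩ := exists_isMaximizer hw hβ
  rw [hz.eq]
  -- a maximizer may be the end point `1`, which is approached from the left
  refine le_of_forall_lt fun r hr => ?_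
  have hκ := kap_nonneg (armCoeff c₀ 1) z
  rcases hz.mem.1.2.eq_or_lt with h1 | h1
  · obtain ⟨x, hx0, hx1⟩ := exists_between (max_lt (show r + beta c t * kap (armCoeff c₀ 1) z < z by
      linarith) (show (0 : ℝ) < z by rw [h1]; exact one_pos))
    have h2 := h.le_inv_alpha hw ((le_max_right _ _).trans hx0.le) (hx1.trans_eq h1) ht
    have h3 := kap_mono hx1.le hz.mem.2
    have h4 := (le_max_left _ _).trans_lt hx0
    have h5 := mul_le_mul_of_nonneg_left h3 hβ.le
    linarith
  · exact hr.trans_le (h.le_inv_alpha hw hz.mem.1.1 h1 ht)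

theorem IsSolution.beta_eq_flow (h : IsSolution c₀ c) (hw : IsArmSeries (armCoeff c₀ 1))
    {t : ℝ} (ht : 0 ≤ t) : beta c t = flow (armCoeff c₀ 1) t := by
  refine eq_flow hw ht ?_ (beta_zero c) (fun s hs => ?_) fun s hs => ?_
  · have := (h.beta_ac ht).continuousOn
    rwa [uIcc_of_le ht] at this
  · rw [← h.inv_alpha_eq hw hs.1]
    exact one_div_pos.2 (alpha_pos c s)
  · rw [← h.inv_alpha_eq hw hs.1.le]
    have hn : Icc 0 t ∈ 𝓝 s := Icc_mem_nhds hs.1 hs.2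
    have hco : ContinuousOn (fun s => 1 / (alpha c s) ^ 2) (Icc 0 t) :=
      continuousOn_const.div ((h.continuousOn_alpha ht).pow 2)
        fun s _ => pow_ne_zero 2 (alpha_pos c s).ne'
    have hd := intervalIntegral.integral_hasDerivAt_right
      (h.intervalIntegrable_inv_alpha_sq hs.1.le)
      ((hco.mono Ioo_subset_Icc_self).stronglyMeasurableAtFilter isOpen_Ioo s hs)
      (hco.continuousAt hn)
    rw [one_div_pow]
    exact hd

theorem IsSolution.alpha_eq_growth (h : IsSolution c₀ c) (hw : IsArmSeries (armCoeff c₀ 1))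
    {t : ℝ} (ht : 0 ≤ t) : alpha c t = growth (armCoeff c₀ 1) t := by
  rw [growth, ← h.beta_eq_flow hw ht, ← h.inv_alpha_eq hw ht, one_div_one_div]

end Solution

/-! ### Behaviour of power series at `1` and moments -/

/-- Monotone convergence at the end point, finite or not. -/
lemma tendsto_kser_one (v : ℕ → ℝ≥0∞) :
    Tendsto (fun x : ℝ => kser v (ENNReal.ofReal x)) (𝓝[<] 1) (𝓝 (kser v 1)) := by
  refine tendsto_order.2 ⟨fun a ha => ?_, fun a ha => ?_⟩
  · unfold kser at ha
    rw [ENNReal.tsum_eq_iSup_sum, lt_iSup_iff] at ha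
    obtain ⟨F, hF⟩ := ha
    have h1 : Tendsto (fun x : ℝ => ∑ j ∈ F, v j * ENNReal.ofReal x ^ j) (𝓝[<] 1)
        (𝓝 (∑ j ∈ F, v j * 1 ^ j)) := by
      refine tendsto_finsetSum F fun j _ => ?_
      refine ENNReal.Tendsto.const_mul ?_ (Or.inl (by simp))
      have h2 : ContinuousAt (fun x : ℝ => ENNReal.ofReal x ^ j) 1 :=
        ((ENNReal.continuous_pow j).comp ENNReal.continuous_ofReal).continuousAt
      have h3 := h2.tendsto
      rw [ENNReal.ofReal_one] at h3
      exact h3.mono_left nhdsWithin_le_nhds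
    filter_upwards [h1.eventually_const_lt hF] with x hx
    exact hx.trans_le (ENNReal.sum_le_tsum F)
  · filter_upwards [self_mem_nhdsWithin] with x hx
    refine lt_of_le_of_lt (kser_mono v ?_) ha
    rw [← ENNReal.ofReal_one]
    exact ENNReal.ofReal_le_ofReal (le_of_lt hx)

/-- Coefficients of `x k'(x)`. -/
def eulerCoeff (v : ℕ → ℝ≥0∞) (j : ℕ) : ℝ≥0∞ := (j : ℝ≥0∞) * v j

lemma factorialMoment_eq (c : Conc) : factorialMoment c = kser (eulerCoeff (armCoeff c 1)) 1 := by
  rw [factorialMoment, pairing, tsum_eq_zero_add' ENNReal.summable]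
  simp only [kser, eulerCoeff, armCoeff, one_pow, mul_one]
  simp only [zero_mul, Nat.cast_zero, tsum_zero, zero_add, Nat.add_sub_cancel,
    ENNReal.tsum_mul_left]
  refine tsum_congr fun j => ?_
  push_cast
  ring

lemma secondMoment_eq (c : Conc) : secondMoment c = factorialMoment c + arms c := by
  rw [secondMoment, factorialMoment, arms, pairing, pairing, pairing, ← ENNReal.tsum_add]
  refine tsum_congr fun a => ?_
  rw [← ENNReal.tsum_add]
  refine tsum_congr fun m => ?_
  rw [← add_mul, ← Nat.cast_add]
  congr 2
  cases a with
  | zero => rfl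
  | succ a => simp only [Nat.add_sub_cancel]; ring

/-- The mean value inequality `k(y) - k(x) ≤ k'(1) (y - x)`. -/
lemma kser_le_add (v : ℕ → ℝ≥0∞) {x y : ℝ} (hx : 0 ≤ x) (hxy : x ≤ y) (hy : y ≤ 1) :
    kser v (ENNReal.ofReal y) ≤
      kser v (ENNReal.ofReal x) + kser (eulerCoeff v) 1 * ENNReal.ofReal (y - x) := by
  unfold kser
  rw [← ENNReal.tsum_mul_right, ← ENNReal.tsum_add]
  refine ENNReal.tsum_le_tsum fun j => ?_
  have h1 : y ^ j ≤ x ^ j + j * (y - x) := by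
    have h0 : 0 ≤ y := hx.trans hxy
    have h2 : y ^ j - x ^ j = (∑ i ∈ Finset.range j, y ^ i * x ^ (j - 1 - i)) * (y - x) :=
      (geom_sum₂_mul y x j).symm
    have h3 : ∑ i ∈ Finset.range j, y ^ i * x ^ (j - 1 - i) ≤ ∑ _i ∈ Finset.range j, (1 : ℝ) :=
      Finset.sum_le_sum fun i _ => mul_le_one₀ (pow_le_one₀ h0 hy) (pow_nonneg hx _)
        (pow_le_one₀ hx (hxy.trans hy))
    simp only [Finset.sum_const, Finset.card_range, nsmul_eq_mul, mul_one] at h3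
    have := mul_le_mul_of_nonneg_right h3 (sub_nonneg.2 hxy)
    linarith
  have h2 := ENNReal.ofReal_le_ofReal h1
  rw [ENNReal.ofReal_add (pow_nonneg hx j) (mul_nonneg (Nat.cast_nonneg j) (sub_nonneg.2 hxy)),
    ENNReal.ofReal_mul (Nat.cast_nonneg j), ENNReal.ofReal_natCast, ENNReal.ofReal_pow hx,
    ENNReal.ofReal_pow (hx.trans hxy)] at h2
  calc v j * ENNReal.ofReal y ^ j
      ≤ v j * (ENNReal.ofReal x ^ j + j * ENNReal.ofReal (y - x)) := by gcongr
    _ = _ := by rw [eulerCoeff, one_pow]; ring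

/-- A one-sided Lipschitz bound at `1` bounds the derivative there. -/
lemma kser_eulerCoeff_le {v : ℕ → ℝ≥0∞} (hv : kser v 1 < ⊤) {D : ℝ≥0∞}
    (h : ∀ x : ℝ, 0 ≤ x → x < 1 →
      kser v 1 ≤ kser v (ENNReal.ofReal x) + D * ENNReal.ofReal (1 - x)) :
    kser (eulerCoeff v) 1 ≤ D := by
  refine le_of_tendsto (tendsto_kser_one (eulerCoeff v)) ?_
  filter_upwards [Ioo_mem_nhdsLT (zero_lt_one (α := ℝ))] with x hx
  have hle1 : ENNReal.ofReal x ≤ 1 := ENNReal.ofReal_le_one.2 hx.2.le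
  have h1 : kser v (ENNReal.ofReal x) + kser (eulerCoeff v) (ENNReal.ofReal x) *
      ENNReal.ofReal (1 - x) ≤ kser v 1 := by
    unfold kser
    rw [← ENNReal.tsum_mul_right, ← ENNReal.tsum_add]
    refine ENNReal.tsum_le_tsum fun j => ?_
    have h2 : x ^ j + j * x ^ j * (1 - x) ≤ 1 := by
      have h3 : (∑ i ∈ Finset.range j, x ^ i) * (1 - x) = 1 - x ^ j := geom_sum_mul_neg x j
      have h4 : ∑ _i ∈ Finset.range j, x ^ j ≤ ∑ i ∈ Finset.range j, x ^ i :=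
        Finset.sum_le_sum fun i hi =>
          pow_le_pow_of_le_one hx.1.le hx.2.le (Finset.mem_range.1 hi).le
      simp only [Finset.sum_const, Finset.card_range, nsmul_eq_mul] at h4
      have := mul_le_mul_of_nonneg_right h4 (sub_nonneg.2 hx.2.le)
      linarith
    have h5 := ENNReal.ofReal_le_ofReal h2
    have h6 : (0 : ℝ) ≤ j * x ^ j := mul_nonneg (Nat.cast_nonneg j) (pow_nonneg hx.1.le j)
    rw [ENNReal.ofReal_add (pow_nonneg hx.1.le j) (mul_nonneg h6 (sub_nonneg.2 hx.2.le)),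
      ENNReal.ofReal_mul h6, ENNReal.ofReal_mul (Nat.cast_nonneg j), ENNReal.ofReal_natCast,
      ENNReal.ofReal_pow hx.1.le, ENNReal.ofReal_one] at h5
    calc v j * ENNReal.ofReal x ^ j + eulerCoeff v j * ENNReal.ofReal x ^ j * ENNReal.ofReal (1 - x)
        = v j * (ENNReal.ofReal x ^ j + j * ENNReal.ofReal x ^ j * ENNReal.ofReal (1 - x)) := by
          rw [eulerCoeff]; ring
      _ ≤ v j * 1 ^ j := by rw [one_pow]; gcongr
  have hfx : kser v (ENNReal.ofReal x) ≠ ⊤ := ((kser_mono v hle1).trans_lt hv).ne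
  have h2 := (ENNReal.add_le_add_iff_left hfx).1 (h1.trans (h x hx.1.le hx.2))
  refine (ENNReal.mul_le_mul_iff_left ?_ ENNReal.ofReal_ne_top).1 h2
  simpa using hx.2

/-- The gain terms sum up to half the square of the generating function. -/
lemma two_mul_tsum_gain (c : Conc) (x : ℝ≥0∞) :
    2 * ∑' a : ℕ, (∑' m : ℕ+, ENNReal.ofReal (gain c a m)) * x ^ a =
      kser (armCoeff c 1) x * kser (armCoeff c 1) x := by
  have h1 : ∀ a (m : ℕ+), ENNReal.ofReal (gain c a m) = (gainCoeff c 1 a m : ℝ≥0∞) := by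
    intro a m
    have h3 : gain c a m = (gainCoeff c 1 a m : ℝ) := by
      have h4 := gainCoeff_succ c 0 a m
      rw [Finset.Nat.antidiagonal_zero, Finset.sum_singleton] at h4
      have h5 := congrArg (fun r : ℝ≥0 => (r : ℝ)) h4
      simp only [gainCoeff_zero, NNReal.coe_mul, NNReal.coe_sum,
        NNReal.coe_natCast, NNReal.coe_ofNat, Nat.cast_zero, zero_add, one_mul] at h5
      rw [gain, ← h5]
      ring
    rw [h3, ENNReal.ofReal_coe_nnreal]
  have h6 : ∀ a, 2 * ((∑' m : ℕ+, ENNReal.ofReal (gain c a m)) * x ^ a) =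
      ∑ r ∈ Finset.HasAntidiagonal.antidiagonal a,
        (armCoeff c 1 r.1 * x ^ r.1) * (armCoeff c 1 r.2 * x ^ r.2) := by
    intro a
    have h7 := massSum_succ c 1 0 a
    rw [Finset.Nat.antidiagonal_zero, Finset.sum_singleton] at h7
    simp only [massSum, gainCoeff_zero, one_pow, mul_one, Nat.cast_zero, zero_add, one_mul] at h7
    simp_rw [h1]
    rw [← mul_assoc, h7, Finset.sum_mul]
    refine Finset.sum_congr rfl fun r hr => ?_
    rw [← Finset.HasAntidiagonal.mem_antidiagonal.1 hr, pow_add]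
    simp only [armCoeff, one_pow, mul_one]
    ring
  rw [← ENNReal.tsum_mul_left, tsum_congr h6, tsum_sum_antidiagonal (fun r =>
    (armCoeff c 1 r.1 * x ^ r.1) * (armCoeff c 1 r.2 * x ^ r.2)), ENNReal.tsum_prod']
  simp_rw [ENNReal.tsum_mul_left, ENNReal.tsum_mul_right]
  rfl

lemma tsum_arms (c : Conc) (x : ℝ≥0∞) :
    ∑' a : ℕ, (∑' m : ℕ+, (a : ℝ≥0∞) * (c a m : ℝ≥0∞)) * x ^ a = x * kser (armCoeff c 1) x := by
  rw [tsum_eq_zero_add' ENNReal.summable]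
  simp only [Nat.cast_zero, zero_mul, tsum_zero, zero_add]
  rw [kser, ← ENNReal.tsum_mul_left]
  refine tsum_congr fun j => ?_
  simp only [armCoeff, one_pow, mul_one]
  rw [ENNReal.tsum_mul_left, pow_succ]
  ring

/-! ### Construction of the solution -/

/-- The real number `α_t^{-a} P_{a,m}(β_t)`, where `β' = M(β)²` and `α = 1 / M(β)`. -/
def solReal (c₀ : Conc) (t : ℝ) (a : ℕ) (m : ℕ+) : ℝ :=
  (gainPoly c₀ a m).eval (flow (armCoeff c₀ 1) t) / growth (armCoeff c₀ 1) t ^ a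

/-- The solution of Smoluchowski's equation with arms. -/
def sol (c₀ : Conc) (t : ℝ) : Conc := fun a m => (solReal c₀ t a m).toNNReal

lemma coe_sol {c₀ : Conc} (hw : IsArmSeries (armCoeff c₀ 1)) {t : ℝ} (ht : 0 ≤ t) (a : ℕ) (m : ℕ+) :
    (sol c₀ t a m : ℝ) = solReal c₀ t a m :=
  Real.coe_toNNReal _ (div_nonneg (eval_gainPoly_nonneg c₀ a m (flow_nonneg hw ht))
    (pow_nonneg (growth_pos hw t).le a))

lemma sol_zero {c₀ : Conc} (hw : IsArmSeries (armCoeff c₀ 1)) : sol c₀ 0 = c₀ := by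
  funext a m
  rw [← NNReal.coe_inj, coe_sol hw le_rfl, solReal, flow_zero hw, growth_zero hw,
    eval_gainPoly_zero]
  simp

lemma continuous_solReal {c₀ : Conc} (hw : IsArmSeries (armCoeff c₀ 1)) (a : ℕ) (m : ℕ+) :
    Continuous fun t => solReal c₀ t a m :=
  ((gainPoly c₀ a m).continuous.comp (continuous_flow hw)).div ((continuous_growth hw).pow a)
    fun t => pow_ne_zero a (growth_pos hw t).ne'

lemma kser_lfix_env {w : ℕ → ℝ≥0∞} (hw : IsArmSeries w) {b : ℝ} (hb : b ∈ posSet w) :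
    kser w (lfix w (ENNReal.ofReal (env w b)) (ENNReal.ofReal b)) = ENNReal.ofReal (slp w b) := by
  rw [slp, ofReal_kap (isMaximizer_leastMax hw hb.1 hb.2).mem.2, ofReal_leastMax hw hb.1 hb.2]

lemma genFun_sol {c₀ : Conc} (hw : IsArmSeries (armCoeff c₀ 1)) {t : ℝ} (ht : 0 ≤ t) (x y : ℝ) :
    genFun (sol c₀ t) x y = (ENNReal.ofReal (growth (armCoeff c₀ 1) t))⁻¹ *
      kser (armCoeff c₀ (ENNReal.ofReal y)) (lfix (armCoeff c₀ (ENNReal.ofReal y))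
        (ENNReal.ofReal (x / growth (armCoeff c₀ 1) t))
        (ENNReal.ofReal (flow (armCoeff c₀ 1) t))) :=
  genFun_eq_kser_lfix (growth_pos hw t) (flow_nonneg hw ht) (coe_sol hw ht) y

lemma arms_sol {c₀ : Conc} (hw : IsArmSeries (armCoeff c₀ 1)) {t : ℝ} (ht : 0 < t) :
    arms (sol c₀ t) = ENNReal.ofReal (armFlow (armCoeff c₀ 1) t) := by
  have hα := growth_pos hw t
  have h1 : 1 / growth (armCoeff c₀ 1) t = env (armCoeff c₀ 1) (flow (armCoeff c₀ 1) t) := by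
    rw [growth, one_div_one_div]
  rw [arms_eq_kser_lfix hα (flow_nonneg hw ht.le) (coe_sol hw ht.le), h1,
    kser_lfix_env hw (flow_mem_posSet hw ht), armFlow, ENNReal.ofReal_div_of_pos hα,
    ENNReal.div_eq_inv_mul]

lemma toReal_arms_sol {c₀ : Conc} (hw : IsArmSeries (armCoeff c₀ 1)) {t : ℝ} (ht : 0 < t) :
    (arms (sol c₀ t)).toReal = armFlow (armCoeff c₀ 1) t := by
  rw [arms_sol hw ht, ENNReal.toReal_ofReal (armFlow_nonneg hw t)]

lemma gain_sol {c₀ : Conc} (hw : IsArmSeries (armCoeff c₀ 1)) {t : ℝ} (ht : 0 ≤ t) (a : ℕ)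
    (m : ℕ+) : gain (sol c₀ t) a m = (gainPoly c₀ a m).derivative.eval (flow (armCoeff c₀ 1) t) /
      growth (armCoeff c₀ 1) t ^ (a + 2) :=
  gain_eq (growth_pos hw t) a m fun m' _ a' => coe_sol hw ht a' m'

lemma gain_sol_intervalIntegrable {c₀ : Conc} (hw : IsArmSeries (armCoeff c₀ 1)) {t : ℝ}
    (ht : 0 < t) (a : ℕ) (m : ℕ+) :
    IntervalIntegrable (fun s => gain (sol c₀ s) a m) volume 0 t := by
  have hc : Continuous fun s => (gainPoly c₀ a m).derivative.eval (flow (armCoeff c₀ 1) s) /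
      growth (armCoeff c₀ 1) s ^ (a + 2) :=
    ((gainPoly c₀ a m).derivative.continuous.comp (continuous_flow hw)).div
      ((continuous_growth hw).pow _) fun t => pow_ne_zero _ (growth_pos hw t).ne'
  refine (hc.intervalIntegrable 0 t).congr fun s hs => ?_
  rw [uIoc_of_le ht.le] at hs
  exact (gain_sol hw hs.1.le a m).symm

lemma loss_sol_intervalIntegrable {c₀ : Conc} (hw : IsArmSeries (armCoeff c₀ 1)) {t : ℝ}
    (ht : 0 < t) (a : ℕ) (m : ℕ+) :
    IntervalIntegrable (fun s => loss (sol c₀ s) a m) volume 0 t := by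
  have h1 : IntervalIntegrable (fun s => (a * solReal c₀ s a m) * armFlow (armCoeff c₀ 1) s)
      volume 0 t :=
    (intervalIntegrable_armFlow hw ht.le).continuousOn_mul
      (continuous_const.mul (continuous_solReal hw a m)).continuousOn
  refine h1.congr fun s hs => ?_
  rw [uIoc_of_le ht.le] at hs
  simp only [loss]
  rw [coe_sol hw hs.1.le, toReal_arms_sol hw hs.1]

/-- Both `β` and `α` are differentiable outside a countable set of times, and there the derivative
of `α^{-a} P_{a,m}(β)` is the gain minus the loss term. -/
lemma sol_equation {c₀ : Conc} (hw : IsArmSeries (armCoeff c₀ 1)) {t : ℝ}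
    (ht : 0 < t) (a : ℕ) (m : ℕ+) :
    (sol c₀ t a m : ℝ) = (c₀ a m : ℝ) + (∫ s in (0 : ℝ)..t, gain (sol c₀ s) a m)
      - ∫ s in (0 : ℝ)..t, loss (sol c₀ s) a m := by
  have h1 := gain_sol_intervalIntegrable hw ht a m
  have h2 := loss_sol_intervalIntegrable hw ht a m
  have h := integral_eq_of_hasDerivAt_off_countable_of_le (fun s => solReal c₀ s a m)
    (fun s => gain (sol c₀ s) a m - loss (sol c₀ s) a m) ht.le
    (countable_badTimes hw) (continuous_solReal hw a m).continuousOn (fun s hs => by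
      have hs0 := hs.1.1
      have hd := hasDerivAt_growth hw hs0 (by
        by_contra hn
        exact hs.2 ⟨hs0, hn⟩)
      have hα := growth_pos hw s
      have h3 := (((gainPoly c₀ a m).hasDerivAt _).comp s (hasDerivAt_flow hw s)).div
        (hd.pow a) (pow_ne_zero a hα.ne')
      convert! h3 using 1
      rw [gain_sol hw hs0.le, loss, coe_sol hw hs0.le, toReal_arms_sol hw hs0, armFlow, solReal]
      have h4 : env (armCoeff c₀ 1) (flow (armCoeff c₀ 1) s) = 1 / growth (armCoeff c₀ 1) s := by
        rw [growth, one_div_one_div]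
      rw [h4]
      simp only [Function.comp_apply, Pi.pow_apply]
      rcases a with _ | a
      · simp
        field_simp
      · have h5 := hα.ne'
        rw [Nat.add_sub_cancel]
        field_simp
        ring) (h1.sub h2)
  rw [intervalIntegral.integral_sub h1 h2, ← coe_sol hw ht.le, ← coe_sol hw le_rfl,
    sol_zero hw] at h
  linarith

/-- The generating function of the solution is bounded on compact time intervals, away from `x = 1`.
-/
lemma exists_genFun_sol_le {c₀ : Conc} (hw : IsArmSeries (armCoeff c₀ 1)) {x : ℝ} (hx0 : 0 ≤ x)
    (hx1 : x < 1) : ∃ C : ℝ≥0, ∀ s, 0 < s →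
      kser (armCoeff (sol c₀ s) 1) (ENNReal.ofReal x) ≤ C := by
  set w := armCoeff c₀ 1 with hwdef
  set z := (1 + x) / 2 with hz
  have hz0 : 0 ≤ z := by rw [hz]; linarith
  have hz1 : z < 1 := by rw [hz]; linarith
  have hκ := kser_lt_top hw hz0 hz1
  have hκ0 := kap_nonneg w z
  set δ := (1 - x) / (2 * (kap w z + 1)) with hδ
  have hδ0 : 0 < δ := div_pos (by linarith) (by linarith)
  refine ⟨(max (kap w z) (slp w δ)).toNNReal, fun s hs => ?_⟩
  have hα := growth_pos hw s
  have hα1 : 1 ≤ growth w s := by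
    rw [← growth_zero hw]
    exact growth_monotone hw hs.le
  have hinv : (ENNReal.ofReal (growth w s))⁻¹ ≤ 1 := by
    rw [ENNReal.inv_le_one, ENNReal.one_le_ofReal]
    exact hα1
  have hβ := flow_nonneg hw hs.le
  have hC : ((max (kap w z) (slp w δ)).toNNReal : ℝ≥0∞) =
      ENNReal.ofReal (max (kap w z) (slp w δ)) := rfl
  rw [hC]
  have hgen := genFun_sol hw hs.le x 1
  rw [genFun_eq_kser, ENNReal.ofReal_one, ← hwdef] at hgen
  rw [hgen]
  have hxα : x / growth w s ≤ x := div_le_self hx0 hα1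
  rcases le_or_gt (flow w s) δ with h | h
  · have h1 : lfix w (ENNReal.ofReal (x / growth w s)) (ENNReal.ofReal (flow w s)) ≤
        ENNReal.ofReal z := by
      refine lfix_le_ofReal hβ (div_nonneg hx0 hα.le) hκ ?_
      have h2 : flow w s * kap w z ≤ (1 - x) / 2 := by
        calc flow w s * kap w z ≤ δ * (kap w z + 1) := by gcongr; linarith
          _ = (1 - x) / 2 := by rw [hδ]; field_simp
      rw [hz] at h2 ⊢
      linarith
    calc (ENNReal.ofReal (growth w s))⁻¹ * kser w _ ≤ 1 * kser w (ENNReal.ofReal z) := by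
          gcongr
          exact kser_mono w h1
      _ = ENNReal.ofReal (kap w z) := by rw [one_mul, ofReal_kap hκ]
      _ ≤ _ := ENNReal.ofReal_le_ofReal (le_max_left _ _)
  · have hm := flow_mem_posSet hw hs
    have hδm : δ ∈ posSet w := ⟨hδ0, domSet_lower hw h.le hm.2⟩
    have h1 : lfix w (ENNReal.ofReal (x / growth w s)) (ENNReal.ofReal (flow w s)) ≤
        lfix w (ENNReal.ofReal (env w (flow w s))) (ENNReal.ofReal (flow w s)) := by
      refine lfix_le (le_of_le_of_eq ?_ (lfix_eq _ _ _))
      gcongr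
      rw [growth, div_div_eq_mul_div, div_one]
      exact mul_le_of_le_one_left hm.2.le hx1.le
    calc (ENNReal.ofReal (growth w s))⁻¹ * kser w _ ≤ 1 * ENNReal.ofReal (slp w (flow w s)) := by
          gcongr
          rw [← kser_lfix_env hw hm]
          exact kser_mono w h1
      _ ≤ ENNReal.ofReal (slp w δ) := by
        rw [one_mul]
        exact ENNReal.ofReal_le_ofReal (slp_antitoneOn hw hδm hm h.le)
      _ ≤ _ := ENNReal.ofReal_le_ofReal (le_max_right _ _)

lemma lintegral_loss_sol_le {c₀ : Conc} (hw : IsArmSeries (armCoeff c₀ 1)) {t : ℝ}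
    (ht : 0 < t) (a : ℕ) (m : ℕ+) :
    ∫⁻ s in Ioc 0 t, ENNReal.ofReal (loss (sol c₀ s) a m) ≤
      c₀ a m + ∫⁻ s in Ioc 0 t, ENNReal.ofReal (gain (sol c₀ s) a m) := by
  have h1 := (gain_sol_intervalIntegrable hw ht a m).1
  have h2 := (loss_sol_intervalIntegrable hw ht a m).1
  have hl : ∀ s, 0 ≤ loss (sol c₀ s) a m := fun s => by
    unfold loss
    positivity
  have hg : ∀ s, 0 ≤ gain (sol c₀ s) a m := fun s => by
    unfold gain
    positivity
  have h3 := sol_equation hw ht a m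
  rw [intervalIntegral.integral_of_le ht.le, intervalIntegral.integral_of_le ht.le] at h3
  rw [← ofReal_integral_eq_lintegral_ofReal h1 (Eventually.of_forall hg),
    ← ofReal_integral_eq_lintegral_ofReal h2 (Eventually.of_forall hl),
    ← ENNReal.ofReal_coe_nnreal, ← ENNReal.ofReal_add (NNReal.coe_nonneg _)
      (integral_nonneg hg)]
  refine ENNReal.ofReal_le_ofReal ?_
  have : (0 : ℝ) ≤ sol c₀ t a m := NNReal.coe_nonneg _
  linarith

/-- Each coagulation destroys a particle, which formally gives `∫ A_s² ds ≤ 2 ⟨c₀, 1⟩`. With weights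
`x^a`, `x < 1`, all the sums are finite, and the same count gives this up to a constant. -/
lemma lintegral_genFun_sol_sq_le {c₀ : Conc} (hw : IsArmSeries (armCoeff c₀ 1)) {t : ℝ}
    (ht : 0 < t) {x : ℝ} (hx : 3 / 4 ≤ x) (hx1 : x < 1) :
    ∫⁻ s in Ioc 0 t, kser (armCoeff (sol c₀ s) 1) (ENNReal.ofReal x) ^ 2 ≤
      4 * pairing c₀ (fun _ => 1) := by
  have hx0 : 0 ≤ x := by linarith
  set X := ENNReal.ofReal x with hX
  have hX1 : X ≤ 1 := ENNReal.ofReal_le_one.2 hx1.le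
  set k : ℝ → ℝ≥0∞ := fun s => kser (armCoeff (sol c₀ s) 1) X with hk
  have hloss : ∀ a m, AEMeasurable (fun s => ENNReal.ofReal (loss (sol c₀ s) a m))
      (volume.restrict (Ioc 0 t)) := fun a m =>
    (loss_sol_intervalIntegrable hw ht a m).1.aestronglyMeasurable.aemeasurable.ennreal_ofReal
  have hgain : ∀ a m, AEMeasurable (fun s => ENNReal.ofReal (gain (sol c₀ s) a m))
      (volume.restrict (Ioc 0 t)) := fun a m =>
    (gain_sol_intervalIntegrable hw ht a m).1.aestronglyMeasurable.aemeasurable.ennreal_ofReal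
  -- the weighted sum of the loss terms
  have hL : ∑' a : ℕ, (∑' m : ℕ+, ∫⁻ s in Ioc 0 t, ENNReal.ofReal (loss (sol c₀ s) a m)) * X ^ a =
      ∫⁻ s in Ioc 0 t, arms (sol c₀ s) * (X * k s) := by
    simp_rw [← lintegral_tsum (hloss _)]
    have h1 : ∀ a : ℕ, (∫⁻ s in Ioc 0 t, ∑' m : ℕ+, ENNReal.ofReal (loss (sol c₀ s) a m)) * X ^ a =
        ∫⁻ s in Ioc 0 t, (∑' m : ℕ+, ENNReal.ofReal (loss (sol c₀ s) a m)) * X ^ a := fun a =>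
      (lintegral_mul_const'' _ (AEMeasurable.tsum (hloss a))).symm
    rw [tsum_congr h1, ← lintegral_tsum fun a =>
      (AEMeasurable.tsum (hloss a)).mul_const _]
    refine setLIntegral_congr_fun measurableSet_Ioc fun s hs => ?_
    simp only [hk]
    rw [← tsum_arms, ← ENNReal.tsum_mul_left]
    refine tsum_congr fun a => ?_
    rw [← mul_assoc, ← ENNReal.tsum_mul_left]
    congr 1
    refine tsum_congr fun m => ?_
    have hfin : arms (sol c₀ s) ≠ ⊤ := by
      rw [arms_sol hw hs.1]
      exact ENNReal.ofReal_ne_top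
    rw [loss, ENNReal.ofReal_mul (by positivity), ENNReal.ofReal_mul (by positivity),
      ENNReal.ofReal_natCast, ENNReal.ofReal_coe_nnreal, ENNReal.ofReal_toReal hfin]
    ring
  have hG : 2 * ∑' a : ℕ, (∑' m : ℕ+, ∫⁻ s in Ioc 0 t, ENNReal.ofReal (gain (sol c₀ s) a m)) * X ^ a
      = ∫⁻ s in Ioc 0 t, k s ^ 2 := by
    simp_rw [← lintegral_tsum (hgain _)]
    have h1 : ∀ a : ℕ, (∫⁻ s in Ioc 0 t, ∑' m : ℕ+, ENNReal.ofReal (gain (sol c₀ s) a m)) * X ^ a =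
        ∫⁻ s in Ioc 0 t, (∑' m : ℕ+, ENNReal.ofReal (gain (sol c₀ s) a m)) * X ^ a := fun a =>
      (lintegral_mul_const'' _ (AEMeasurable.tsum (hgain a))).symm
    rw [tsum_congr h1, ← lintegral_tsum fun a => (AEMeasurable.tsum (hgain a)).mul_const _,
      ← lintegral_const_mul'' _ (AEMeasurable.tsum fun a =>
        (AEMeasurable.tsum (hgain a)).mul_const _)]
    refine lintegral_congr fun s => ?_
    rw [two_mul_tsum_gain, sq]
  have h0 : ∑' a : ℕ, (∑' m : ℕ+, (c₀ a m : ℝ≥0∞)) * X ^ a ≤ pairing c₀ (fun _ => 1) := by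
    rw [pairing]
    refine ENNReal.tsum_le_tsum fun a => ?_
    simp only [Nat.cast_one, one_mul]
    exact mul_le_of_le_one_right' (pow_le_one' hX1 a)
  have hmain : ∫⁻ s in Ioc 0 t, arms (sol c₀ s) * (X * k s) ≤ pairing c₀ (fun _ => 1) +
      ∑' a : ℕ, (∑' m : ℕ+, ∫⁻ s in Ioc 0 t, ENNReal.ofReal (gain (sol c₀ s) a m)) * X ^ a := by
    rw [← hL]
    refine le_trans ?_ (add_le_add_left h0 _)
    rw [← ENNReal.tsum_add]
    refine ENNReal.tsum_le_tsum fun a => ?_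
    rw [← add_mul, ← ENNReal.tsum_add]
    gcongr with m
    exact lintegral_loss_sol_le hw ht a m
  have hlow : X * ∫⁻ s in Ioc 0 t, k s ^ 2 ≤ ∫⁻ s in Ioc 0 t, arms (sol c₀ s) * (X * k s) := by
    rw [← lintegral_const_mul' _ _ ENNReal.ofReal_ne_top]
    refine lintegral_mono fun s => ?_
    have h1 : k s ≤ arms (sol c₀ s) := by
      rw [arms_eq_kser]
      exact kser_mono _ hX1
    calc X * k s ^ 2 = k s * (X * k s) := by ring
      _ ≤ _ := by gcongr
  set I := ∫⁻ s in Ioc 0 t, k s ^ 2 with hI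
  have hIfin : I < ⊤ := by
    obtain ⟨C, hC⟩ := exists_genFun_sol_le hw hx0 hx1
    calc I ≤ ∫⁻ _ in Ioc 0 t, (C : ℝ≥0∞) ^ 2 := by
          refine setLIntegral_mono measurable_const fun s hs => ?_
          have := hC s hs.1
          gcongr
      _ < ⊤ := by
        rw [setLIntegral_const]
        exact ENNReal.mul_lt_top (ENNReal.pow_lt_top ENNReal.coe_lt_top) (by simp)
  have h3 : 3 ≤ 4 * X := by
    have : ENNReal.ofReal 3 ≤ ENNReal.ofReal (4 * x) := ENNReal.ofReal_le_ofReal (by linarith)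
    rw [ENNReal.ofReal_mul (by norm_num)] at this
    simpa using this
  have h4 : 3 * I ≤ 4 * pairing c₀ (fun _ => 1) + 2 * I := by
    calc 3 * I ≤ 4 * X * I := by gcongr
      _ = 4 * (X * I) := by ring
      _ ≤ 4 * (pairing c₀ (fun _ => 1) + ∑' a : ℕ, (∑' m : ℕ+, ∫⁻ s in Ioc 0 t,
          ENNReal.ofReal (gain (sol c₀ s) a m)) * X ^ a) := by
        gcongr
        exact hlow.trans hmain
      _ = 4 * pairing c₀ (fun _ => 1) + 2 * I := by
        rw [← hG]
        ring
  have h5 : 3 * I = I + 2 * I := by ring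
  rw [h5] at h4
  exact (ENNReal.add_le_add_iff_right (ENNReal.mul_lt_top (by simp) hIfin).ne).1 h4

lemma lintegral_arms_sol_sq_le {c₀ : Conc} (hw : IsArmSeries (armCoeff c₀ 1)) {t : ℝ}
    (ht : 0 < t) :
    ∫⁻ s in Ioc 0 t, arms (sol c₀ s) ^ 2 ≤ 4 * pairing c₀ (fun _ => 1) := by
  have hlim : Tendsto (fun n : ℕ => 1 - 1 / ((n : ℝ) + 1)) atTop (𝓝[<] 1) := by
    refine tendsto_nhdsWithin_iff.2 ⟨?_, Eventually.of_forall fun n => ?_⟩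
    · simpa using (tendsto_one_div_add_atTop_nhds_zero_nat (𝕜 := ℝ)).const_sub 1
    · have : (0 : ℝ) < 1 / ((n : ℝ) + 1) := by positivity
      simp only [mem_Iio]
      linarith
  have hmeas : ∀ x : ℝ, AEMeasurable
      (fun s => kser (armCoeff (sol c₀ s) 1) (ENNReal.ofReal x) ^ 2)
      (volume.restrict (Ioc 0 t)) := by
    intro x
    refine AEMeasurable.pow_const (AEMeasurable.tsum fun j => AEMeasurable.mul_const
      (AEMeasurable.const_mul (AEMeasurable.tsum fun m => AEMeasurable.mul_const ?_ _) _) _) 2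
    exact (continuous_solReal hw _ m).measurable.real_toNNReal.coe_nnreal_ennreal.aemeasurable
  have h1 : ∀ s, arms (sol c₀ s) ^ 2 = liminf (fun n : ℕ =>
      kser (armCoeff (sol c₀ s) 1) (ENNReal.ofReal (1 - 1 / ((n : ℝ) + 1))) ^ 2) atTop := by
    intro s
    rw [arms_eq_kser]
    exact (((ENNReal.continuous_pow 2).tendsto _).comp
      ((tendsto_kser_one _).comp hlim)).liminf_eq.symm
  simp_rw [h1]
  refine (lintegral_liminf_le' fun n => hmeas _).trans ?_
  refine liminf_le_of_frequently_le' (Eventually.frequently ?_)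
  have h34 : ∀ᶠ x : ℝ in 𝓝[<] 1, 3 / 4 ≤ x ∧ x < 1 := by
    filter_upwards [Ioo_mem_nhdsLT (show (3 / 4 : ℝ) < 1 by norm_num)] with x hx
    exact ⟨hx.1.le, hx.2⟩
  filter_upwards [hlim.eventually h34] with n hn
  exact lintegral_genFun_sol_sq_le hw ht hn.1 hn.2

/-- As long as `β_t K < 1`, where `K = ⟨c₀, a(a-1)⟩`, the factorial moment of the solution is at
most `K / (1 - β_t K)`. -/
lemma factorialMoment_sol_le {c₀ : Conc} (hw : IsArmSeries (armCoeff c₀ 1))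
    (hK : factorialMoment c₀ < ⊤) {t : ℝ} (ht : 0 < t)
    (hb : flow (armCoeff c₀ 1) t * (factorialMoment c₀).toReal < 1) :
    factorialMoment (sol c₀ t) ≤ ENNReal.ofReal ((factorialMoment c₀).toReal /
      (1 - flow (armCoeff c₀ 1) t * (factorialMoment c₀).toReal)) := by
  have harms : arms (sol c₀ t) < ⊤ := by
    rw [arms_sol hw ht]
    exact ENNReal.ofReal_lt_top
  rw [factorialMoment_eq]
  refine kser_eulerCoeff_le (by rwa [← arms_eq_kser]) fun x hx0 hx1 => ?_
  have hgx := genFun_sol hw ht.le x 1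
  have hg1 := genFun_sol hw ht.le 1 1
  rw [genFun_eq_kser] at hgx hg1
  rw [ENNReal.ofReal_one] at hgx hg1
  rw [hgx, hg1]
  set w := armCoeff c₀ 1 with hwdef
  set K := (factorialMoment c₀).toReal with hKdef
  set b := flow w t with hbdef
  have hK0 : 0 ≤ K := ENNReal.toReal_nonneg
  have hm := flow_mem_posSet hw ht
  have hα := growth_pos hw t
  have hinv : 1 / growth w t = env w b := by rw [growth, one_div_one_div]
  have hα1 : 1 ≤ growth w t := by
    rw [← growth_zero hw]
    exact growth_monotone hw ht.le
  set h1 := leastMax w b with hh1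
  have hmax := isMaximizer_leastMax hw hm.1 hm.2
  have hl1 : lfix w (ENNReal.ofReal (1 / growth w t)) (ENNReal.ofReal b) = ENNReal.ofReal h1 := by
    rw [hinv, ofReal_leastMax hw hm.1 hm.2]
  have hxα : x / growth w t ≤ 1 / growth w t := by gcongr
  have hle : lfix w (ENNReal.ofReal (x / growth w t)) (ENNReal.ofReal b) ≤ ENNReal.ofReal h1 := by
    rw [← hl1]
    refine lfix_le (le_of_le_of_eq ?_ (lfix_eq _ _ _))
    gcongr
  have hxtop : lfix w (ENNReal.ofReal (x / growth w t)) (ENNReal.ofReal b) ≠ ⊤ :=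
    (hle.trans_lt ENNReal.ofReal_lt_top).ne
  have hx_eq := toReal_lfix hm.1 (div_nonneg hx0 hα.le) hxtop
  set hx := (lfix w (ENNReal.ofReal (x / growth w t)) (ENNReal.ofReal b)).toReal with hhx
  have hlx : lfix w (ENNReal.ofReal (x / growth w t)) (ENNReal.ofReal b) = ENNReal.ofReal hx :=
    (ENNReal.ofReal_toReal hxtop).symm
  have hxh1 : hx ≤ h1 := ENNReal.toReal_le_of_le_ofReal hmax.mem.1.1 hle
  have hx0' : 0 ≤ hx := ENNReal.toReal_nonneg
  have hfx : kser w (ENNReal.ofReal hx) < ⊤ :=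
    (kser_mono w (ENNReal.ofReal_le_ofReal hxh1)).trans_lt hmax.mem.2
  -- mean value inequality for `κ` between `h_t(x)` and `h_t(1)`
  have hmv : kap w h1 ≤ kap w hx + K * (h1 - hx) := by
    have h2 := kser_le_add w hx0' hxh1 hmax.mem.1.2
    rw [← factorialMoment_eq, ← ofReal_kap hmax.mem.2, ← ofReal_kap hfx,
      ← ENNReal.ofReal_toReal hK.ne, ← ENNReal.ofReal_mul hK0,
      ← ENNReal.ofReal_add (kap_nonneg _ _) (mul_nonneg hK0 (sub_nonneg.2 hxh1))] at h2
    exact (ENNReal.ofReal_le_ofReal_iff (add_nonneg (kap_nonneg _ _)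
      (mul_nonneg hK0 (sub_nonneg.2 hxh1)))).1 h2
  have h1_eq := hmax.eq
  rw [← hinv] at h1_eq
  have hdiff : (1 - b * K) * (h1 - hx) ≤ (1 - x) / growth w t := by
    have : (1 - x) / growth w t = 1 / growth w t - x / growth w t := by ring
    rw [this, h1_eq, hx_eq]
    nlinarith [hm.1]
  have hbK : 0 < 1 - b * K := by linarith
  have hfinal : kap w h1 / growth w t ≤ kap w hx / growth w t + K / (1 - b * K) * (1 - x) := by
    have h3 : h1 - hx ≤ (1 - x) / (1 - b * K) := by
      rw [le_div_iff₀ hbK, mul_comm]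
      exact hdiff.trans (div_le_self (by linarith) hα1)
    have h4 : K * (h1 - hx) / growth w t ≤ K / (1 - b * K) * (1 - x) := by
      calc K * (h1 - hx) / growth w t ≤ K * (h1 - hx) :=
            div_le_self (mul_nonneg hK0 (sub_nonneg.2 hxh1)) hα1
        _ ≤ K * ((1 - x) / (1 - b * K)) := by gcongr
        _ = _ := by ring
    calc kap w h1 / growth w t ≤ (kap w hx + K * (h1 - hx)) / growth w t := by gcongr
      _ = kap w hx / growth w t + K * (h1 - hx) / growth w t := by ring
      _ ≤ _ := by gcongr
  have h5 := ENNReal.ofReal_le_ofReal hfinal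
  rw [ENNReal.ofReal_add (div_nonneg (kap_nonneg _ _) hα.le)
    (mul_nonneg (div_nonneg hK0 hbK.le) (by linarith)), ENNReal.ofReal_mul (div_nonneg hK0 hbK.le),
    ENNReal.ofReal_div_of_pos (x := kap w h1) hα, ENNReal.ofReal_div_of_pos (x := kap w hx) hα,
    ofReal_kap hmax.mem.2, ofReal_kap hfx, ENNReal.div_eq_inv_mul, ENNReal.div_eq_inv_mul] at h5
  rw [hl1, hlx]
  exact h5

/-- The fixed point `h_t(1,1)` is at most `1`, and `α_t ≥ 1`. -/
lemma arms_sol_le {c₀ : Conc} (hw : IsArmSeries (armCoeff c₀ 1)) {t : ℝ}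
    (ht : 0 < t) : arms (sol c₀ t) ≤ arms c₀ := by
  have hm := flow_mem_posSet hw ht
  have hα1 : 1 ≤ growth (armCoeff c₀ 1) t := by
    rw [← growth_zero hw]
    exact growth_monotone hw ht.le
  rw [arms_sol hw ht]
  calc ENNReal.ofReal (armFlow (armCoeff c₀ 1) t)
      ≤ ENNReal.ofReal (slp (armCoeff c₀ 1) (flow (armCoeff c₀ 1) t)) :=
        ENNReal.ofReal_le_ofReal (div_le_self (slp_nonneg _ _) hα1)
    _ ≤ arms c₀ := by
      have hmax := isMaximizer_leastMax hw hm.1 hm.2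
      rw [slp, ofReal_kap hmax.mem.2, arms_eq_kser]
      exact kser_mono _ (ENNReal.ofReal_le_one.2 hmax.mem.1.2)

/-- The constructed concentrations solve Smoluchowski's equation with arms. -/
theorem isSolution_sol {c₀ : Conc} (hfin : pairing c₀ (fun _ => 1) < ⊤)
    (hw : IsArmSeries (armCoeff c₀ 1)) : IsSolution c₀ (sol c₀) where
  initial := sol_zero hw
  arms_sq t ht := (lintegral_arms_sol_sq_le hw ht).trans_lt (ENNReal.mul_lt_top (by simp) hfin)
  gain_integrable a m t ht := gain_sol_intervalIntegrable hw ht a m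
  loss_integrable a m t ht := loss_sol_intervalIntegrable hw ht a m
  equation a m t ht := sol_equation hw ht a m
  second_moment h2 := by
    rw [secondMoment_eq, ENNReal.add_lt_top] at h2
    set K := (factorialMoment c₀).toReal with hK
    have hK0 : 0 ≤ K := ENNReal.toReal_nonneg
    have hc : Tendsto (fun t => flow (armCoeff c₀ 1) t * K) (𝓝 0) (𝓝 0) := by
      have := ((continuous_flow hw).tendsto 0).mul_const K
      simpa [flow_zero hw] using this
    obtain ⟨ε, hε, hball⟩ := Metric.eventually_nhds_iff.1
      (hc.eventually_lt_const (show (0 : ℝ) < 1 / 2 by norm_num))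
    refine ⟨ε / 2, half_pos hε, (2 * K).toNNReal + (arms c₀).toNNReal, fun t ht => ?_⟩
    have hC : (((2 * K).toNNReal + (arms c₀).toNNReal : ℝ≥0) : ℝ≥0∞) =
        ENNReal.ofReal (2 * K) + arms c₀ := by
      rw [ENNReal.coe_add, ENNReal.coe_toNNReal h2.2.ne]
      rfl
    rw [hC, secondMoment_eq]
    rcases ht.1.eq_or_lt with rfl | ht0
    · rw [sol_zero hw]
      gcongr
      rw [← ENNReal.ofReal_toReal h2.1.ne]
      exact ENNReal.ofReal_le_ofReal (by rw [← hK]; linarith)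
    · have hlt := hball (y := t) (by
        rw [Real.dist_eq, sub_zero, abs_of_pos ht0]
        linarith [ht.2])
      refine add_le_add ((factorialMoment_sol_le hw h2.1 ht0 (by linarith)).trans ?_)
        (arms_sol_le hw ht0)
      refine ENNReal.ofReal_le_ofReal ?_
      rw [← hK, div_le_iff₀ (by linarith)]
      nlinarith

/-- Uniqueness: every solution is the constructed one. -/
theorem IsSolution.eq_sol {c₀ : Conc} {c : ℝ → Conc} (h : IsSolution c₀ c)
    (hw : IsArmSeries (armCoeff c₀ 1)) {t : ℝ} (ht : 0 ≤ t) : c t = sol c₀ t := by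
  funext a m
  rw [← NNReal.coe_inj, coe_sol hw ht, h.eq_gainPoly m a t ht, h.beta_eq_flow hw ht,
    h.alpha_eq_growth hw ht, solReal]

/-! ### Calculus of the arm series -/

/-- The coefficients of the derivative of a power series. -/
def derCoeff (v : ℕ → ℝ≥0∞) (j : ℕ) : ℝ≥0∞ := ((j + 1 : ℕ) : ℝ≥0∞) * v (j + 1)

lemma kser_eulerCoeff (v : ℕ → ℝ≥0∞) (u : ℝ≥0∞) :
    kser (eulerCoeff v) u = u * kser (derCoeff v) u := by
  rw [kser, tsum_eq_zero_add' ENNReal.summable, kser, ← ENNReal.tsum_mul_left]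
  simp only [eulerCoeff, derCoeff, Nat.cast_zero, zero_mul, zero_add]
  refine tsum_congr fun j => ?_
  rw [pow_succ]
  ring

/-- A power series with non-negative coefficients lies above its tangents. -/
lemma kser_add_derCoeff_mul_le (v : ℕ → ℝ≥0∞) {x y : ℝ} (hx : 0 ≤ x) (hxy : x ≤ y) :
    kser v (ENNReal.ofReal x) + kser (derCoeff v) (ENNReal.ofReal x) * ENNReal.ofReal (y - x) ≤
      kser v (ENNReal.ofReal y) := by
  have hy : 0 ≤ y := hx.trans hxy
  rw [kser, kser, kser, tsum_eq_zero_add' (f := fun j => v j * _ ^ j) ENNReal.summable,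
    tsum_eq_zero_add' (f := fun j => v j * ENNReal.ofReal y ^ j) ENNReal.summable,
    ← ENNReal.tsum_mul_right, add_assoc, ← ENNReal.tsum_add, pow_zero, pow_zero]
  gcongr _ + ?_
  refine ENNReal.tsum_le_tsum fun j => ?_
  have h1 : x ^ (j + 1) + ((j + 1 : ℕ) : ℝ) * x ^ j * (y - x) ≤ y ^ (j + 1) := by
    induction j with
    | zero => simp
    | succ j ih =>
      have h2 : 0 ≤ ((j + 1 : ℕ) : ℝ) * x ^ j * (y - x) * (y - x) := by
        have := sub_nonneg.2 hxy
        positivity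
      calc _ ≤ (x ^ (j + 1) + ((j + 1 : ℕ) : ℝ) * x ^ j * (y - x)) * y := by
            push_cast at h2 ⊢
            rw [pow_succ x (j + 1), pow_succ x j]
            nlinarith
        _ ≤ y ^ (j + 1) * y := by gcongr
        _ = _ := (pow_succ y (j + 1)).symm
  have h4 := ENNReal.ofReal_le_ofReal h1
  rw [ENNReal.ofReal_add (by positivity)
    (mul_nonneg (by positivity) (sub_nonneg.2 hxy)), ENNReal.ofReal_mul (by positivity),
    ENNReal.ofReal_mul (by positivity), ENNReal.ofReal_natCast, ENNReal.ofReal_pow hx,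
    ENNReal.ofReal_pow hx, ENNReal.ofReal_pow hy] at h4
  calc v (j + 1) * ENNReal.ofReal x ^ (j + 1) +
        derCoeff v j * ENNReal.ofReal x ^ j * ENNReal.ofReal (y - x)
      = v (j + 1) * (ENNReal.ofReal x ^ (j + 1) +
          ((j + 1 : ℕ) : ℝ≥0∞) * ENNReal.ofReal x ^ j * ENNReal.ofReal (y - x)) := by
        rw [derCoeff]; ring
    _ ≤ _ := by gcongr

/-- The power series converges on `[0,1)`. -/
def IsFinite (v : ℕ → ℝ≥0∞) : Prop := ∀ x : ℝ, 0 ≤ x → x < 1 → kser v (ENNReal.ofReal x) < ⊤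

lemma IsArmSeries.isFinite {w : ℕ → ℝ≥0∞} (hw : IsArmSeries w) : IsFinite w :=
  fun _ h0 h1 => kser_lt_top hw h0 h1

lemma IsFinite.derCoeff {v : ℕ → ℝ≥0∞} (hv : IsFinite v) : IsFinite (derCoeff v) := by
  intro x h0 h1
  have h2 : x ≤ (x + 1) / 2 := by linarith
  by_contra h
  rw [not_lt, top_le_iff] at h
  have h3 := (le_add_self.trans (kser_add_derCoeff_mul_le v h0 h2)).trans_lt
    (hv _ (by linarith) (by linarith))
  rw [h, ENNReal.top_mul (by rw [Ne, ENNReal.ofReal_eq_zero]; linarith)] at h3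
  exact lt_irrefl _ h3

lemma IsFinite.ne_top {v : ℕ → ℝ≥0∞} (hv : IsFinite v) (j : ℕ) : v j ≠ ⊤ := by
  have h := hv (1 / 2) (by norm_num) (by norm_num)
  intro ht
  have h1 := (ENNReal.le_tsum (f := fun j => v j * ENNReal.ofReal (1 / 2) ^ j) j).trans_lt h
  rw [ht, ENNReal.top_mul (pow_ne_zero _ (by simp))] at h1
  exact lt_irrefl _ h1

lemma IsFinite.hasSum {v : ℕ → ℝ≥0∞} (hv : IsFinite v) {x : ℝ} (h0 : 0 ≤ x) (h1 : x < 1) :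
    HasSum (fun j => (v j).toReal * x ^ j) (kap v x) := by
  have h := hv x h0 h1
  have h2 : ∀ j, (v j * ENNReal.ofReal x ^ j).toReal = (v j).toReal * x ^ j := fun j => by
    rw [ENNReal.toReal_mul, ENNReal.toReal_pow, ENNReal.toReal_ofReal h0]
  have h3 := ENNReal.hasSum_toReal h.ne
  rw [← ENNReal.tsum_toReal_eq (fun j => (ENNReal.ne_top_of_tsum_ne_top h.ne j))] at h3
  simp only [h2] at h3
  exact h3

lemma IsFinite.hasDerivAt_kap {v : ℕ → ℝ≥0∞} (hv : IsFinite v) {x : ℝ} (h0 : 0 < x)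
    (h1 : x < 1) : HasDerivAt (kap v) (kap (ArmsCoag.derCoeff v) x) x := by
  obtain ⟨r, hxr, hr1⟩ := exists_between h1
  have hr0 : 0 < r := h0.trans hxr
  have hu := (hv.derCoeff.hasSum hr0.le hr1).summable
  have hterm : ∀ (j : ℕ) (y : ℝ), ((ArmsCoag.derCoeff v) j).toReal * y ^ j =
      (v (j + 1)).toReal * (((j + 1 : ℕ) : ℝ) * y ^ j) := fun j y => by
    rw [ArmsCoag.derCoeff, ENNReal.toReal_mul, ENNReal.toReal_natCast]
    ring
  have key := hasDerivAt_tsum_of_isPreconnected hu (isOpen_Ioo (a := (0 : ℝ)) (b := r))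
    isPreconnected_Ioo (g := fun j y => (v (j + 1)).toReal * y ^ (j + 1))
    (g' := fun j y => (v (j + 1)).toReal * (((j + 1 : ℕ) : ℝ) * y ^ j))
    (fun j y _ => by simpa using (hasDerivAt_pow (j + 1) y).const_mul (v (j + 1)).toReal)
    (fun j y hy => by
      rw [hterm, Real.norm_of_nonneg (by have := hy.1; positivity)]
      have := hy.1
      have := hy.2.le
      gcongr)
    (y₀ := x) ⟨h0, hxr⟩
    ((summable_nat_add_iff 1).2 (hv.hasSum h0.le h1).summable) ⟨h0, hxr⟩
  have hsum : ∑' j, (v (j + 1)).toReal * (((j + 1 : ℕ) : ℝ) * x ^ j) =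
      kap (ArmsCoag.derCoeff v) x := by
    rw [← (hv.derCoeff.hasSum h0.le h1).tsum_eq]
    exact tsum_congr fun j => (hterm j x).symm
  rw [hsum] at key
  refine (key.const_add (v 0).toReal).congr_of_eventuallyEq ?_
  filter_upwards [Ioo_mem_nhds h0 h1] with y hy
  have h := (hv.hasSum hy.1.le hy.2)
  rw [← h.tsum_eq, h.summable.tsum_eq_zero_add]
  simp

lemma kap_strictMono {v : ℕ → ℝ≥0∞} (hv : IsFinite v) {j : ℕ} (hj : 1 ≤ j) (hvj : v j ≠ 0)
    {x y : ℝ} (h0 : 0 ≤ x) (hxy : x < y) (hy : kser v (ENNReal.ofReal y) < ⊤) :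
    kap v x < kap v y := by
  refine ENNReal.toReal_strict_mono hy.ne ?_
  refine ENNReal.tsum_lt_tsum (i := j)
    ((kser_mono v (ENNReal.ofReal_le_ofReal hxy.le)).trans_lt hy).ne
    (fun i => by gcongr) ?_
  rw [ENNReal.mul_lt_mul_iff_right hvj (hv.ne_top j)]
  refine ENNReal.pow_lt_pow_left (by omega) ?_
  rwa [ENNReal.ofReal_lt_ofReal_iff (h0.trans_lt hxy)]

/-- The end point `1`, where the series may diverge. -/
lemma kser_strictMono_one {v : ℕ → ℝ≥0∞} (hv : IsFinite v) {j : ℕ} (hj : 1 ≤ j) (hvj : v j ≠ 0)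
    {x : ℝ} (h0 : 0 ≤ x) (hx : x < 1) : kser v (ENNReal.ofReal x) < kser v 1 := by
  refine ENNReal.tsum_lt_tsum (i := j) (hv x h0 hx).ne
    (fun i => by
      have := ENNReal.ofReal_le_one.2 hx.le
      gcongr) ?_
  rw [ENNReal.mul_lt_mul_iff_right hvj (hv.ne_top j)]
  exact ENNReal.pow_lt_pow_left (by omega) (by simpa using hx)

/-! ### Gelling series and the critical parameter -/

/-- The series of the initial data with finite gelation time: `κ(1) < κ'(1)` or `κ'(1) = ∞`. -/
structure IsGelling (w : ℕ → ℝ≥0∞) : Prop extends IsArmSeries w where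
  gel : kser (derCoeff w) 1 = ⊤ ∨ kser w 1 < kser (derCoeff w) 1

lemma IsGelling.exists_ne_zero {w : ℕ → ℝ≥0∞} (hw : IsGelling w) : ∃ j, 2 ≤ j ∧ w j ≠ 0 := by
  by_contra! h
  have h1 : kser (derCoeff w) 1 = w 1 := by
    rw [kser, tsum_eq_single 0]
    · simp [derCoeff]
    · intro j hj
      rw [derCoeff, h (j + 1) (by omega)]
      simp
  have h2 : w 1 ≤ kser w 1 := by
    simpa [kser] using ENNReal.le_tsum (f := fun j => w j * 1 ^ j) 1
  rcases hw.gel with h3 | h3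
  · exact hw.toIsArmSeries.ne_top 1 (h1.symm.trans h3)
  · exact (h1 ▸ h3).not_ge h2

lemma IsGelling.exists_derCoeff_ne_zero {w : ℕ → ℝ≥0∞} (hw : IsGelling w) :
    ∃ j, 1 ≤ j ∧ derCoeff w j ≠ 0 := by
  obtain ⟨j, hj, h⟩ := hw.exists_ne_zero
  refine ⟨j - 1, by omega, ?_⟩
  rw [derCoeff, Nat.sub_add_cancel (by omega)]
  exact mul_ne_zero (Nat.cast_ne_zero.2 (by omega)) h

lemma IsGelling.strictMonoOn_kap_derCoeff {w : ℕ → ℝ≥0∞} (hw : IsGelling w) :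
    StrictMonoOn (kap (derCoeff w)) (Ico 0 1) := by
  obtain ⟨j, hj, h⟩ := hw.exists_derCoeff_ne_zero
  exact fun x hx y hy hxy => kap_strictMono hw.isFinite.derCoeff hj h hx.1 hxy
    (hw.isFinite.derCoeff y hy.1 hy.2)

lemma IsGelling.kap_derCoeff_pos {w : ℕ → ℝ≥0∞} (hw : IsGelling w) {x : ℝ} (h0 : 0 < x)
    (h1 : x < 1) : 0 < kap (derCoeff w) x :=
  (kap_nonneg _ 0).trans_lt
    (hw.strictMonoOn_kap_derCoeff ⟨le_rfl, one_pos⟩ ⟨h0.le, h1⟩ h0)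

/-- The critical parameter `b = 1/K`, where `K = κ'(1)`; it is `0` if `K = ∞`. -/
def critB (w : ℕ → ℝ≥0∞) : ℝ := (kser (derCoeff w) 1).toReal⁻¹

lemma critB_nonneg (w : ℕ → ℝ≥0∞) : 0 ≤ critB w := inv_nonneg.2 ENNReal.toReal_nonneg

lemma IsGelling.kser_derCoeff_pos {w : ℕ → ℝ≥0∞} (hw : IsGelling w) : 0 < kser (derCoeff w) 1 := by
  rcases hw.gel with h | h
  · rw [h]; exact ENNReal.zero_lt_top
  · exact pos_of_gt h

/-- A maximizer in the open interval is a critical point. -/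
lemma IsMaximizer.mul_kap_derCoeff {w : ℕ → ℝ≥0∞} {b x : ℝ} (hm : IsMaximizer w b x)
    (hw : IsArmSeries w) (hb : 0 < b) (h0 : 0 < x) (h1 : x < 1) :
    b * kap (derCoeff w) x = 1 := by
  have hd : HasDerivAt (fun x => x - b * kap w x) (1 - b * kap (derCoeff w) x) x :=
    (hasDerivAt_id _).sub ((hw.isFinite.hasDerivAt_kap h0 h1).const_mul b)
  have hloc : IsLocalMax (fun x => x - b * kap w x) x := by
    filter_upwards [Ioo_mem_nhds h0 h1] with z hz
    rw [← hm.eq]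
    exact le_env hb (mem_finSet hw hz.1.le hz.2)
  linarith [hloc.hasDerivAt_eq_zero hd]

/-- At or below the critical parameter the only maximizer is `1`. -/
lemma IsGelling.leastMax_eq_one {w : ℕ → ℝ≥0∞} (hw : IsGelling w) {b : ℝ} (hb : b ∈ posSet w)
    (hbc : b ≤ critB w) : leastMax w b = 1 := by
  have hm := isMaximizer_leastMax hw.toIsArmSeries hb.1 hb.2
  have h0 : 0 < leastMax w b := hb.2.trans_le (env_le_leastMax hw.toIsArmSeries hb.1 hb.2)
  refine le_antisymm hm.mem.1.2 (not_lt.1 fun h1 => ?_)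
  have h2 := hm.mul_kap_derCoeff hw.toIsArmSeries hb.1 h0 h1
  obtain ⟨j, hj, h⟩ := hw.exists_derCoeff_ne_zero
  have h3 := kser_strictMono_one hw.isFinite.derCoeff hj h h0.le h1
  have hK : kser (derCoeff w) 1 ≠ ⊤ := by
    intro hK
    rw [critB, hK, ENNReal.toReal_top, inv_zero] at hbc
    exact hbc.not_gt hb.1
  have h4 : kap (derCoeff w) (leastMax w b) < (kser (derCoeff w) 1).toReal :=
    ENNReal.toReal_strict_mono hK h3
  have h5 : b * (kser (derCoeff w) 1).toReal ≤ 1 := by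
    rw [critB] at hbc
    have hpos := ENNReal.toReal_pos hw.kser_derCoeff_pos.ne' hK
    calc b * _ ≤ (kser (derCoeff w) 1).toReal⁻¹ * (kser (derCoeff w) 1).toReal := by gcongr
      _ = 1 := inv_mul_cancel₀ hpos.ne'
  nlinarith [hb.1]

/-- Above the critical parameter every maximizer is smaller than `1`: otherwise `κ` would have slope
at most `1/b` at `1`. -/
lemma IsGelling.lt_one_of_isMaximizer {w : ℕ → ℝ≥0∞} (hw : IsGelling w) {b x : ℝ} (hb : 0 < b)
    (hbc : critB w < b) (hm : IsMaximizer w b x) : x < 1 := by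
  refine lt_of_le_of_ne hm.mem.1.2 fun h1 => ?_
  subst h1
  have hA : kser w 1 < ⊤ := by simpa using hm.mem.2
  have hA' : ENNReal.ofReal (kap w 1) = kser w 1 := by
    rw [ofReal_kap hm.mem.2, ENNReal.ofReal_one]
  have h := kser_eulerCoeff_le hA (D := ENNReal.ofReal b⁻¹) fun x h0 hx => by
    have h2 := le_env hb (mem_finSet hw.toIsArmSeries h0 hx)
    rw [hm.eq] at h2
    rw [← hA', ← ofReal_kap (kser_lt_top hw.toIsArmSeries h0 hx),
      ← ENNReal.ofReal_mul (inv_nonneg.2 hb.le), ← ENNReal.ofReal_add (kap_nonneg _ _)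
        (mul_nonneg (inv_nonneg.2 hb.le) (by linarith))]
    refine ENNReal.ofReal_le_ofReal ?_
    rw [inv_mul_eq_div, ← sub_le_iff_le_add', le_div_iff₀ hb]
    linarith
  rw [kser_eulerCoeff, one_mul] at h
  have hpos := ENNReal.toReal_pos hw.kser_derCoeff_pos.ne' (h.trans_lt ENNReal.ofReal_lt_top).ne
  have h3 := ENNReal.toReal_le_of_le_ofReal (inv_nonneg.2 hb.le) h
  refine hbc.not_ge ?_
  rw [critB, le_inv_comm₀ hb hpos]
  exact h3

lemma IsGelling.leastMax_mem_Ioo {w : ℕ → ℝ≥0∞} (hw : IsGelling w) {b : ℝ} (hb : b ∈ posSet w)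
    (hbc : critB w < b) : leastMax w b ∈ Ioo (0 : ℝ) 1 :=
  ⟨hb.2.trans_le (env_le_leastMax hw.toIsArmSeries hb.1 hb.2),
    hw.lt_one_of_isMaximizer hb.1 hbc (isMaximizer_leastMax hw.toIsArmSeries hb.1 hb.2)⟩

lemma IsGelling.mul_kap_derCoeff_leastMax {w : ℕ → ℝ≥0∞} (hw : IsGelling w) {b : ℝ}
    (hb : b ∈ posSet w) (hbc : critB w < b) : b * kap (derCoeff w) (leastMax w b) = 1 := by
  obtain ⟨h0, h1⟩ := hw.leastMax_mem_Ioo hb hbc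
  exact (isMaximizer_leastMax hw.toIsArmSeries hb.1 hb.2).mul_kap_derCoeff hw.toIsArmSeries hb.1
    h0 h1

lemma IsGelling.critB_lt {w : ℕ → ℝ≥0∞} (hw : IsGelling w) {x : ℝ} (h0 : 0 < x) (h1 : x < 1) :
    critB w < (kap (derCoeff w) x)⁻¹ := by
  have hp := hw.kap_derCoeff_pos h0 h1
  rw [critB]
  by_cases hK : kser (derCoeff w) 1 = ⊤
  · rw [hK, ENNReal.toReal_top, inv_zero]
    positivity
  · obtain ⟨j, hj, h⟩ := hw.exists_derCoeff_ne_zero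
    have h3 := kser_strictMono_one hw.isFinite.derCoeff hj h h0.le h1
    exact inv_strictAnti₀ hp (ENNReal.toReal_strict_mono hK h3)

lemma IsGelling.leastMax_eq {w : ℕ → ℝ≥0∞} (hw : IsGelling w) {b x : ℝ} (hb : b ∈ posSet w)
    (h0 : 0 < x) (h1 : x < 1) (hx : b * kap (derCoeff w) x = 1) : leastMax w b = x := by
  have hbc : critB w < b := by
    rw [eq_inv_of_mul_eq_one_left hx]
    exact hw.critB_lt h0 h1
  obtain ⟨h2, h3⟩ := hw.leastMax_mem_Ioo hb hbc
  refine hw.strictMonoOn_kap_derCoeff.injOn ⟨h2.le, h3⟩ ⟨h0.le, h1⟩ ?_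
  have h4 := hw.mul_kap_derCoeff_leastMax hb hbc
  exact mul_left_cancel₀ hb.1.ne' (h4.trans hx.symm)

lemma IsGelling.leastMax_strictAntiOn {w : ℕ → ℝ≥0∞} (hw : IsGelling w) :
    StrictAntiOn (leastMax w) (posSet w ∩ Ioi (critB w)) := by
  intro b hb b' hb' hbb'
  obtain ⟨h0, h1⟩ := hw.leastMax_mem_Ioo hb.1 hb.2
  obtain ⟨h0', h1'⟩ := hw.leastMax_mem_Ioo hb'.1 hb'.2
  refine (hw.strictMonoOn_kap_derCoeff.lt_iff_lt ⟨h0'.le, h1'⟩ ⟨h0.le, h1⟩).1 ?_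
  rw [eq_inv_of_mul_eq_one_right (hw.mul_kap_derCoeff_leastMax hb.1 hb.2),
    eq_inv_of_mul_eq_one_right (hw.mul_kap_derCoeff_leastMax hb'.1 hb'.2)]
  exact inv_strictAnti₀ hb.1.1 hbb'

/-- The least maximizer is monotone in `b`, and its range contains a neighbourhood of each of its
values `x`, namely at the parameters `1/κ'(x)`. -/
lemma IsGelling.continuousAt_leastMax {w : ℕ → ℝ≥0∞} (hw : IsGelling w) {b : ℝ} (hb : b ∈ posSet w)
    (hbc : critB w < b) : ContinuousAt (leastMax w) b := by
  have hU : posSet w ∩ Ioi (critB w) ∈ 𝓝 b :=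
    ((isOpen_posSet hw.toIsArmSeries).inter isOpen_Ioi).mem_nhds ⟨hb, hbc⟩
  obtain ⟨h0, h1⟩ := hw.leastMax_mem_Ioo hb hbc
  have hinv : (kap (derCoeff w) (leastMax w b))⁻¹ = b :=
    (eq_inv_of_mul_eq_one_left (hw.mul_kap_derCoeff_leastMax hb hbc)).symm
  have hc : ContinuousAt (fun x => (kap (derCoeff w) x)⁻¹) (leastMax w b) :=
    (hw.isFinite.derCoeff.hasDerivAt_kap h0 h1).continuousAt.inv₀ (hw.kap_derCoeff_pos h0 h1).ne'
  have himg : leastMax w '' (posSet w ∩ Ioi (critB w)) ∈ 𝓝 (leastMax w b) := by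
    have h2 := hc.preimage_mem_nhds (t := posSet w) (by
      rw [hinv]
      exact (isOpen_posSet hw.toIsArmSeries).mem_nhds hb)
    filter_upwards [h2, Ioo_mem_nhds h0 h1] with x hx hx1
    exact ⟨_, ⟨hx, hw.critB_lt hx1.1 hx1.2⟩, hw.leastMax_eq hx hx1.1 hx1.2
      (inv_mul_cancel₀ (hw.kap_derCoeff_pos hx1.1 hx1.2).ne')⟩
  have hneg : ContinuousAt (fun b => -leastMax w b) b := by
    refine continuousAt_of_monotoneOn_of_image_mem_nhds
      (fun x hx y hy hxy => neg_le_neg (hw.leastMax_strictAntiOn.antitoneOn hx hy hxy)) hU ?_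
    have h3 : (fun b => -leastMax w b) '' (posSet w ∩ Ioi (critB w)) =
        Neg.neg '' (leastMax w '' (posSet w ∩ Ioi (critB w))) := by
      rw [image_image]
    rw [h3]
    exact (Homeomorph.neg ℝ).isOpenMap.image_mem_nhds himg
  exact hneg.neg.congr (Eventually.of_forall fun b => neg_neg (leastMax w b))

lemma IsGelling.continuousAt_slp {w : ℕ → ℝ≥0∞} (hw : IsGelling w) {b : ℝ} (hb : b ∈ posSet w)
    (hbc : critB w < b) : ContinuousAt (slp w) b := by
  obtain ⟨h0, h1⟩ := hw.leastMax_mem_Ioo hb hbc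
  exact ContinuousAt.comp (g := kap w) (hw.isFinite.hasDerivAt_kap h0 h1).continuousAt
    (hw.continuousAt_leastMax hb hbc)

/-! ### Tangent lines -/

/-- The function `G(x) = x - κ(x)/κ'(x)`, the point where the tangent to `κ` at `x` meets the
axis. -/
def tangentRoot (w : ℕ → ℝ≥0∞) (x : ℝ) : ℝ := x - kap w x / kap (derCoeff w) x

lemma IsGelling.hasDerivAt_tangentRoot {w : ℕ → ℝ≥0∞} (hw : IsGelling w) {x : ℝ} (h0 : 0 < x)
    (h1 : x < 1) : HasDerivAt (tangentRoot w)
      (kap w x * kap (derCoeff (derCoeff w)) x / kap (derCoeff w) x ^ 2) x := by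
  have hp := hw.kap_derCoeff_pos h0 h1
  have h := (hasDerivAt_id x).sub ((hw.isFinite.hasDerivAt_kap h0 h1).div
    (hw.isFinite.derCoeff.hasDerivAt_kap h0 h1) hp.ne')
  refine h.congr_deriv ?_
  field_simp
  ring

lemma IsGelling.strictMonoOn_tangentRoot {w : ℕ → ℝ≥0∞} (hw : IsGelling w) :
    StrictMonoOn (tangentRoot w) (Ioo 0 1) := by
  refine strictMonoOn_of_deriv_pos (convex_Ioo 0 1)
    (fun x hx => (hw.hasDerivAt_tangentRoot hx.1 hx.2).continuousAt.continuousWithinAt)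
    fun x hx => ?_
  rw [interior_Ioo] at hx
  rw [(hw.hasDerivAt_tangentRoot hx.1 hx.2).deriv]
  have h1 := kap_pos hw.toIsArmSeries hx.1 (hw.isFinite x hx.1.le hx.2)
  have h2 := hw.kap_derCoeff_pos hx.1 hx.2
  obtain ⟨j, hj, h⟩ := hw.exists_derCoeff_ne_zero
  have h3 : 0 < kap (derCoeff (derCoeff w)) x := by
    have hfin := hw.isFinite.derCoeff.derCoeff x hx.1.le hx.2
    refine ENNReal.toReal_pos (lt_of_lt_of_le ?_ (ENNReal.le_tsum (j - 1))).ne' hfin.ne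
    refine ENNReal.mul_pos ?_ (pow_ne_zero _ (by simpa using hx.1))
    rw [derCoeff, Nat.sub_add_cancel hj]
    exact mul_ne_zero (Nat.cast_ne_zero.2 (by omega)) h
  positivity

lemma IsGelling.tangentRoot_leastMax {w : ℕ → ℝ≥0∞} (hw : IsGelling w) {b : ℝ} (hb : b ∈ posSet w)
    (hbc : critB w < b) : tangentRoot w (leastMax w b) = env w b := by
  rw [(isMaximizer_leastMax hw.toIsArmSeries hb.1 hb.2).eq, tangentRoot,
    eq_inv_of_mul_eq_one_right (hw.mul_kap_derCoeff_leastMax hb hbc), div_inv_eq_mul, mul_comm b]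

/-- `G(x)` is the value of `x - b κ(x)` at `b = 1/κ'(x) > 1/K`. -/
lemma IsGelling.tangentRoot_le {w : ℕ → ℝ≥0∞} (hw : IsGelling w) {x : ℝ} (h0 : 0 < x)
    (h1 : x < 1) : tangentRoot w x ≤ env w (critB w) := by
  have hp := hw.kap_derCoeff_pos h0 h1
  calc tangentRoot w x = x - (kap (derCoeff w) x)⁻¹ * kap w x := by rw [tangentRoot]; ring
    _ ≤ env w (kap (derCoeff w) x)⁻¹ :=
      le_env (inv_pos.2 hp) (mem_finSet hw.toIsArmSeries h0.le h1)
    _ ≤ _ := env_antitone hw.toIsArmSeries (hw.critB_lt h0 h1).le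

lemma IsGelling.kser_one_lt {w : ℕ → ℝ≥0∞} (hw : IsGelling w) (hc : 0 < critB w) :
    kser (derCoeff w) 1 ≠ ⊤ ∧ kser w 1 < kser (derCoeff w) 1 := by
  have hK : kser (derCoeff w) 1 ≠ ⊤ := fun h => by
    rw [critB, h, ENNReal.toReal_top, inv_zero] at hc
    exact lt_irrefl _ hc
  exact ⟨hK, hw.gel.resolve_left hK⟩

/-- Up to the critical parameter, `M(b) = 1 - b κ(1) > 0`. -/
lemma IsGelling.env_eq {w : ℕ → ℝ≥0∞} (hw : IsGelling w) {b : ℝ} (hb : 0 ≤ b)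
    (hbc : b ≤ critB w) : 0 < env w b ∧ env w b = 1 - b * (kser w 1).toReal := by
  rcases hb.eq_or_lt with rfl | hb
  · rw [env_of_nonpos le_rfl]
    simp
  obtain ⟨hK, hAK⟩ := hw.kser_one_lt (hb.trans_le hbc)
  have hA : kser w 1 ≠ ⊤ := (hAK.trans_le le_top).ne
  have hfin : (1 : ℝ) ∈ finSet w := ⟨by simp, by simpa using hA.lt_top⟩
  have hk1 : kap w 1 = (kser w 1).toReal := by rw [kap, ENNReal.ofReal_one]
  have hpos : 0 < env w b := by
    refine lt_of_lt_of_le ?_ (le_env hb hfin)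
    have h1 := ENNReal.toReal_strict_mono hK hAK
    have h2 : 0 < (kser (derCoeff w) 1).toReal := ENNReal.toReal_nonneg.trans_lt h1
    have h3 : b * (kser w 1).toReal < 1 := by
      calc b * (kser w 1).toReal < b * (kser (derCoeff w) 1).toReal := by gcongr
        _ ≤ critB w * (kser (derCoeff w) 1).toReal := by gcongr
        _ = 1 := inv_mul_cancel₀ h2.ne'
    rw [hk1]
    linarith
  refine ⟨hpos, ?_⟩
  rw [(isMaximizer_leastMax hw.toIsArmSeries hb hpos).eq, hw.leastMax_eq_one ⟨hb, hpos⟩ hbc, hk1]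

/-- The values of `G` come arbitrarily close to `M(1/K)`, as `G(h) = M(b)` at the maximizer `h` for
the parameter `b > 1/K`. -/
lemma IsGelling.exists_lt_tangentRoot {w : ℕ → ℝ≥0∞} (hw : IsGelling w) {r : ℝ}
    (hr : r < env w (critB w)) : ∃ x ∈ Ioo (0 : ℝ) 1, r < tangentRoot w x := by
  have hpos := (hw.env_eq (critB_nonneg w) le_rfl).1
  have h1 : ∀ᶠ b in 𝓝[>] critB w, max r 0 < env w b :=
    ((continuous_env hw.toIsArmSeries).continuousWithinAt.tendsto).eventually_const_lt
      (max_lt hr hpos)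
  obtain ⟨b, hb, hbc⟩ := (h1.and self_mem_nhdsWithin).exists
  have hbp : b ∈ posSet w :=
    ⟨(critB_nonneg w).trans_lt hbc, (le_max_right _ _).trans_lt hb⟩
  refine ⟨leastMax w b, hw.leastMax_mem_Ioo hbp hbc, ?_⟩
  rw [hw.tangentRoot_leastMax hbp hbc]
  exact (le_max_left _ _).trans_lt hb

/-! ### The gelation time -/

/-- The time at which the flow reaches the critical parameter. -/
def critT (w : ℕ → ℝ≥0∞) : ℝ := hitTime w (critB w)

lemma IsGelling.flow_critT {w : ℕ → ℝ≥0∞} (hw : IsGelling w) : flow w (critT w) = critB w :=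
  flow_hitTime hw.toIsArmSeries (hw.env_eq (critB_nonneg w) le_rfl).1

lemma IsGelling.critT_nonneg {w : ℕ → ℝ≥0∞} (hw : IsGelling w) : 0 ≤ critT w := by
  rw [← (flow_strictMono hw.toIsArmSeries).le_iff_le, flow_zero hw.toIsArmSeries, hw.flow_critT]
  exact critB_nonneg w

lemma IsGelling.critB_lt_flow {w : ℕ → ℝ≥0∞} (hw : IsGelling w) {t : ℝ} :
    critB w < flow w t ↔ critT w < t := by
  rw [← hw.flow_critT, (flow_strictMono hw.toIsArmSeries).lt_iff_lt]

lemma IsGelling.hitTime_eq {w : ℕ → ℝ≥0∞} (hw : IsGelling w) {b : ℝ} (hb : 0 ≤ b)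
    (hbc : b ≤ critB w) : hitTime w b = b / (1 - b * (kser w 1).toReal) := by
  set A := (kser w 1).toReal
  have hA : 0 ≤ A := ENNReal.toReal_nonneg
  have hne : ∀ s ∈ Icc 0 b, 0 < 1 - s * A := fun s hs => by
    have := hw.env_eq hs.1 (hs.2.trans hbc)
    linarith
  have h1 := intervalIntegral.integral_eq_sub_of_hasDerivAt (a := 0) (b := b)
    (f := fun s => s / (1 - s * A)) (f' := fun s => 1 / (env w s) ^ 2) (fun s hs => ?_)
    (intervalIntegrable_inv_env_sq hw.toIsArmSeries (mem_domSet_of_nonpos le_rfl)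
      (hw.env_eq hb hbc).1)
  · rw [hitTime, h1]
    simp
  · rw [uIcc_of_le hb] at hs
    have h2 := hne s hs
    have h3 := (hasDerivAt_id s).div (((hasDerivAt_id s).mul_const A).const_sub 1) h2.ne'
    refine h3.congr_deriv ?_
    rw [(hw.env_eq hs.1 (hs.2.trans hbc)).2]
    simp only [id_eq]
    congr 1
    ring

lemma IsGelling.growth_eq {w : ℕ → ℝ≥0∞} (hw : IsGelling w) {t : ℝ} (ht : 0 ≤ t)
    (htc : t ≤ critT w) : growth w t = 1 + (kser w 1).toReal * t := by
  have hb : flow w t ≤ critB w := not_lt.1 fun h => htc.not_gt (hw.critB_lt_flow.1 h)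
  have hb0 := flow_nonneg hw.toIsArmSeries ht
  obtain ⟨h0, h1⟩ := hw.env_eq hb0 hb
  have h2 := hw.hitTime_eq hb0 hb
  rw [hitTime_flow hw.toIsArmSeries] at h2
  rw [h1] at h0
  rw [growth, h1]
  calc 1 / (1 - flow w t * (kser w 1).toReal)
      = 1 + (kser w 1).toReal * (flow w t / (1 - flow w t * (kser w 1).toReal)) := by
        field_simp
        ring
    _ = _ := by rw [← h2]

lemma IsGelling.leastMax_flow_eq_one {w : ℕ → ℝ≥0∞} (hw : IsGelling w) {t : ℝ} (ht : 0 < t)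
    (htc : t ≤ critT w) : leastMax w (flow w t) = 1 :=
  hw.leastMax_eq_one (flow_mem_posSet hw.toIsArmSeries ht)
    (not_lt.1 fun h => htc.not_gt (hw.critB_lt_flow.1 h))

lemma critT_eq_zero {w : ℕ → ℝ≥0∞} (h : kser (derCoeff w) 1 = ⊤) : critT w = 0 := by
  rw [critT, critB, h, ENNReal.toReal_top, inv_zero, hitTime_zero]

lemma IsGelling.critT_eq {w : ℕ → ℝ≥0∞} (hw : IsGelling w) (h : kser (derCoeff w) 1 ≠ ⊤) :
    critT w = ((kser (derCoeff w) 1).toReal - (kser w 1).toReal)⁻¹ := by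
  rw [critT, hw.hitTime_eq (critB_nonneg w) le_rfl, critB]
  have h1 := ENNReal.toReal_strict_mono h (hw.gel.resolve_left h)
  have h2 : 0 < (kser (derCoeff w) 1).toReal := ENNReal.toReal_nonneg.trans_lt h1
  have h3 := sub_pos.2 h1
  have h4 : 1 - (kser (derCoeff w) 1).toReal⁻¹ * (kser w 1).toReal ≠ 0 := by
    rw [inv_mul_eq_div, ne_eq, sub_eq_zero, eq_comm, div_eq_one_iff_eq h2.ne']
    exact h1.ne
  field_simp

/-! ### The functions `G` and `H` -/

lemma arms_le_factorialMoment_add (c : Conc) :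
    arms c ≤ factorialMoment c + pairing c (fun _ => 1) := by
  rw [arms, factorialMoment, pairing, pairing, pairing, ← ENNReal.tsum_add]
  refine ENNReal.tsum_le_tsum fun a => ?_
  rw [← ENNReal.tsum_add]
  refine ENNReal.tsum_le_tsum fun m => ?_
  rw [← add_mul, ← Nat.cast_add]
  gcongr
  rcases a with _ | _ | a
  · simp
  · simp
  · simp only [Nat.add_sub_cancel]
    nlinarith

lemma factorialMoment_eq_kser_derCoeff (c : Conc) :
    factorialMoment c = kser (derCoeff (armCoeff c 1)) 1 := by
  rw [factorialMoment_eq, kser_eulerCoeff, one_mul]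

lemma isGelling_armCoeff {c₀ : Conc} (hw : IsArmSeries (armCoeff c₀ 1)) (h : tGel c₀ < ⊤) :
    IsGelling (armCoeff c₀ 1) := by
  refine ⟨hw, ?_⟩
  rw [← factorialMoment_eq_kser_derCoeff, ← arms_eq_kser]
  rw [tGel] at h
  split_ifs at h with h1 h2
  · exact .inl h1
  · exact .inr h2
  · exact absurd h (lt_irrefl _)

lemma tGel_eq {c₀ : Conc} (hw : IsGelling (armCoeff c₀ 1)) :
    tGel c₀ = ENNReal.ofReal (critT (armCoeff c₀ 1)) := by
  have hg := hw.gel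
  rw [tGel, factorialMoment_eq_kser_derCoeff, arms_eq_kser]
  split_ifs with h1 h2
  · rw [critT_eq_zero h1, ENNReal.ofReal_zero]
  · have h3 := ENNReal.toReal_strict_mono h1 h2
    rw [hw.critT_eq h1, ENNReal.ofReal_inv_of_pos (sub_pos.2 h3),
      ENNReal.ofReal_sub _ ENNReal.toReal_nonneg, ENNReal.ofReal_toReal h1,
      ENNReal.ofReal_toReal (h2.trans_le le_top).ne]
  · exact absurd (hg.resolve_left h1) h2

lemma genFunOne_eq (c₀ : Conc) : genFunOne c₀ = kap (armCoeff c₀ 1) := by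
  funext x
  rw [genFunOne, genFun_eq_kser, ENNReal.ofReal_one, kap]

lemma preG_eq {c₀ : Conc} (hw : IsGelling (armCoeff c₀ 1)) {x : ℝ} (hx : x ∈ Ioo (0 : ℝ) 1) :
    preG c₀ x = tangentRoot (armCoeff c₀ 1) x := by
  rw [preG, genFunOne_eq, (hw.isFinite.hasDerivAt_kap hx.1 hx.2).deriv, tangentRoot]

lemma strictMonoOn_preG {c₀ : Conc} (hw : IsGelling (armCoeff c₀ 1)) :
    StrictMonoOn (fun x => (preG c₀ x : EReal)) (Ioo 0 1) := by
  intro x hx y hy hxy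
  simp only
  rw [preG_eq hw hx, preG_eq hw hy, EReal.coe_lt_coe_iff]
  exact hw.strictMonoOn_tangentRoot hx hy hxy

lemma fnG_of_mem {c₀ : Conc} (hw : IsGelling (armCoeff c₀ 1)) {x : ℝ} (hx : x ∈ Ioo (0 : ℝ) 1) :
    fnG c₀ x = (tangentRoot (armCoeff c₀ 1) x : EReal) := by
  rw [fnG, if_neg hx.1.ne', if_neg hx.2.ne, preG_eq hw hx]

lemma tendsto_preG_zero {c₀ : Conc} (hw : IsGelling (armCoeff c₀ 1)) :
    Tendsto (fun x => (preG c₀ x : EReal)) (𝓝[>] 0)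
      (𝓝 (sInf ((fun x => (preG c₀ x : EReal)) '' Ioo 0 1))) :=
  (strictMonoOn_preG hw).monotoneOn.tendsto_nhdsWithin_Ioo_right (nonempty_Ioo.2 one_pos)
    (OrderBot.bddBelow _)

lemma fnG_zero {c₀ : Conc} (hw : IsGelling (armCoeff c₀ 1)) :
    fnG c₀ 0 = sInf ((fun x => (preG c₀ x : EReal)) '' Ioo 0 1) := by
  rw [fnG, if_pos rfl]
  exact (tendsto_preG_zero hw).limUnder_eq

lemma tendsto_preG_one {c₀ : Conc} (hw : IsGelling (armCoeff c₀ 1)) :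
    Tendsto (fun x => (preG c₀ x : EReal)) (𝓝[<] 1)
      (𝓝 (env (armCoeff c₀ 1) (critB (armCoeff c₀ 1)) : EReal)) := by
  refine tendsto_order.2 ⟨fun a ha => ?_, fun a ha => ?_⟩
  · obtain ⟨r, har, hr⟩ := EReal.lt_iff_exists_real_btwn.1 ha
    obtain ⟨x, hx, hrx⟩ := hw.exists_lt_tangentRoot (EReal.coe_lt_coe_iff.1 hr)
    filter_upwards [Ioo_mem_nhdsLT hx.2] with z hz
    have hz' : z ∈ Ioo (0 : ℝ) 1 := ⟨hx.1.trans hz.1, hz.2⟩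
    refine har.trans ?_
    rw [preG_eq hw hz', EReal.coe_lt_coe_iff]
    exact hrx.trans (hw.strictMonoOn_tangentRoot hx hz' hz.1)
  · filter_upwards [Ioo_mem_nhdsLT (zero_lt_one (α := ℝ))] with z hz
    refine lt_of_le_of_lt ?_ ha
    rw [preG_eq hw hz, EReal.coe_le_coe_iff]
    exact hw.tangentRoot_le hz.1 hz.2

lemma fnG_one {c₀ : Conc} (hw : IsGelling (armCoeff c₀ 1)) :
    fnG c₀ 1 = (env (armCoeff c₀ 1) (critB (armCoeff c₀ 1)) : EReal) := by
  rw [fnG, if_neg one_ne_zero, if_pos rfl]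
  exact (tendsto_preG_one hw).limUnder_eq

lemma fnG_zero_le {c₀ : Conc} (hw : IsGelling (armCoeff c₀ 1)) : fnG c₀ 0 ≤ 0 := by
  have h1 : Tendsto (fun x : ℝ => (x : EReal)) (𝓝[>] 0) (𝓝 ((0 : ℝ) : EReal)) :=
    (continuous_coe_real_ereal.tendsto 0).mono_left nhdsWithin_le_nhds
  rw [fnG_zero hw]
  refine le_of_tendsto_of_tendsto (tendsto_preG_zero hw) h1 ?_
  filter_upwards [Ioo_mem_nhdsGT (zero_lt_one (α := ℝ))] with x hx
  rw [preG_eq hw hx, EReal.coe_le_coe_iff, tangentRoot]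
  exact sub_le_self _ (div_nonneg (kap_nonneg _ _) (kap_nonneg _ _))

lemma strictMonoOn_fnG {c₀ : Conc} (hw : IsGelling (armCoeff c₀ 1)) :
    StrictMonoOn (fnG c₀) (Ico 0 1) := by
  intro x hx y hy hxy
  have hy' : y ∈ Ioo (0 : ℝ) 1 := ⟨hx.1.trans_lt hxy, hy.2⟩
  rcases hx.1.eq_or_lt with rfl | h0
  · have hz : y / 2 ∈ Ioo (0 : ℝ) 1 := ⟨half_pos hy'.1, by linarith [hy'.1, hy'.2]⟩
    calc fnG c₀ 0 ≤ (preG c₀ (y / 2) : EReal) := by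
          rw [fnG_zero hw]
          exact sInf_le ⟨_, hz, rfl⟩
      _ < fnG c₀ y := by
        rw [preG_eq hw hz, fnG_of_mem hw hy', EReal.coe_lt_coe_iff]
        exact hw.strictMonoOn_tangentRoot hz hy' (half_lt_self hy'.1)
  · rw [fnG_of_mem hw ⟨h0, hx.2⟩, fnG_of_mem hw hy', EReal.coe_lt_coe_iff]
    exact hw.strictMonoOn_tangentRoot ⟨h0, hx.2⟩ hy' hxy

lemma bijOn_fnG {c₀ : Conc} (hw : IsGelling (armCoeff c₀ 1)) :
    BijOn (fnG c₀) (Ico 0 1) (Ico (fnG c₀ 0) (fnG c₀ 1)) := by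
  have h00 : (0 : ℝ) ∈ Ico (0 : ℝ) 1 := ⟨le_rfl, one_pos⟩
  have hlt : ∀ x ∈ Ioo (0 : ℝ) 1, fnG c₀ x < fnG c₀ 1 := fun x hx => by
    have hz : (x + 1) / 2 ∈ Ioo (0 : ℝ) 1 := ⟨by linarith [hx.1], by linarith [hx.2]⟩
    rw [fnG_one hw, fnG_of_mem hw hx, EReal.coe_lt_coe_iff]
    exact (hw.strictMonoOn_tangentRoot hx hz (by linarith [hx.2])).trans_le
      (hw.tangentRoot_le hz.1 hz.2)
  refine ⟨fun x hx => ⟨(strictMonoOn_fnG hw).monotoneOn h00 hx hx.1, ?_⟩,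
    (strictMonoOn_fnG hw).injOn, fun v hv => ?_⟩
  · have hz : (x + 1) / 2 ∈ Ioo (0 : ℝ) 1 := ⟨by linarith [hx.1], by linarith [hx.2]⟩
    exact (strictMonoOn_fnG hw hx ⟨hz.1.le, hz.2⟩ (by linarith [hx.2])).trans (hlt _ hz)
  · rcases hv.1.eq_or_lt with rfl | h0
    · exact ⟨0, h00, rfl⟩
    obtain ⟨_, ⟨x, hx, rfl⟩, hxv⟩ := sInf_lt_iff.1 ((fnG_zero hw).symm ▸ h0)
    obtain ⟨r, hvr, hr⟩ := EReal.lt_iff_exists_real_btwn.1 ((fnG_one hw) ▸ hv.2)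
    obtain ⟨y, hy, hry⟩ := hw.exists_lt_tangentRoot (EReal.coe_lt_coe_iff.1 hr)
    simp only [preG_eq hw hx] at hxv
    lift v to ℝ using ⟨(hvr.trans (EReal.coe_lt_top r)).ne, ((EReal.bot_lt_coe _).trans hxv).ne'⟩
    rw [EReal.coe_lt_coe_iff] at hxv hvr
    have hxy : x < y := (hw.strictMonoOn_tangentRoot.lt_iff_lt hx hy).1
      (hxv.trans (hvr.trans hry))
    have hsub : Icc x y ⊆ Ioo (0 : ℝ) 1 := fun z hz => ⟨hx.1.trans_le hz.1, hz.2.trans_lt hy.2⟩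
    obtain ⟨z, hz, hzv⟩ := intermediate_value_Icc hxy.le
      (fun z hz => (hw.hasDerivAt_tangentRoot (hsub hz).1
        (hsub hz).2).continuousAt.continuousWithinAt) ⟨hxv.le, (hvr.trans hry).le⟩
    exact ⟨z, Ioo_subset_Ico_self (hsub hz), by rw [fnG_of_mem hw (hsub hz), hzv]⟩

lemma fnH_fnG {c₀ : Conc} (hw : IsGelling (armCoeff c₀ 1)) {x : ℝ} (hx : x ∈ Ico (0 : ℝ) 1) :
    fnH c₀ (fnG c₀ x) = x :=
  (strictMonoOn_fnG hw).injOn.leftInvOn_invFunOn hx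

/-- After the gelation time the least maximizer `ℓ_t` is `H(1/α_t)`. -/
lemma fnG_leastMax_flow {c₀ : Conc} (hw : IsGelling (armCoeff c₀ 1)) {t : ℝ}
    (ht : critT (armCoeff c₀ 1) < t) :
    fnG c₀ (leastMax (armCoeff c₀ 1) (flow (armCoeff c₀ 1) t)) =
      ((1 / growth (armCoeff c₀ 1) t : ℝ) : EReal) := by
  have hb := flow_mem_posSet hw.toIsArmSeries (hw.critT_nonneg.trans_lt ht)
  have hbc := hw.critB_lt_flow.2 ht
  rw [fnG_of_mem hw (hw.leastMax_mem_Ioo hb hbc), hw.tangentRoot_leastMax hb hbc, growth,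
    one_div_one_div]

lemma fnH_growth {c₀ : Conc} (hw : IsGelling (armCoeff c₀ 1)) {t : ℝ}
    (ht : critT (armCoeff c₀ 1) < t) :
    fnH c₀ ((1 / growth (armCoeff c₀ 1) t : ℝ) : EReal) =
      leastMax (armCoeff c₀ 1) (flow (armCoeff c₀ 1) t) := by
  have hb := flow_mem_posSet hw.toIsArmSeries (hw.critT_nonneg.trans_lt ht)
  rw [← fnG_leastMax_flow hw ht, fnH_fnG hw
    (Ioo_subset_Ico_self (hw.leastMax_mem_Ioo hb (hw.critB_lt_flow.2 ht)))]

/-! ### The function `Γ` -/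

lemma startPoint_eq {c₀ : Conc} (hw : IsGelling (armCoeff c₀ 1)) :
    startPoint c₀ = growth (armCoeff c₀ 1) (critT (armCoeff c₀ 1)) := by
  rw [hw.growth_eq hw.critT_nonneg le_rfl, startPoint, tGel_eq hw, ENNReal.toReal_mul,
    ENNReal.toReal_ofReal hw.critT_nonneg, arms_eq_kser]

lemma integrandΓ_growth {c₀ : Conc} (hw : IsGelling (armCoeff c₀ 1)) {t : ℝ}
    (ht : critT (armCoeff c₀ 1) < t) :
    integrandΓ c₀ (growth (armCoeff c₀ 1) t) =
      1 / slp (armCoeff c₀ 1) (flow (armCoeff c₀ 1) t) := by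
  rw [integrandΓ, fnH_growth hw ht, genFunOne_eq, slp]

lemma growth_strictMonoOn {w : ℕ → ℝ≥0∞} (hw : IsArmSeries w) :
    StrictMonoOn (growth w) (Ici 0) := by
  intro s hs t ht hst
  have hs' : (0 : ℝ) ≤ s := hs
  have hst2 : 0 < (s + t) / 2 := by linarith
  have hmt := flow_mem_posSet hw (hs'.trans_lt hst)
  have hm := flow_mem_posSet hw hst2
  rw [growth, growth]
  refine one_div_lt_one_div_of_lt hmt.2 ?_
  -- `M(β_t) + (β_t - β_u) p(β_t) ≤ M(β_u) ≤ M(β_s)` for the midpoint `u`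
  have h1 := env_sub_le hw hmt hm.1
  have h2 := slp_pos hw hmt.1 hmt.2
  have h3 := flow_strictMono hw (show (s + t) / 2 < t by linarith)
  have h4 := env_antitone hw ((flow_strictMono hw).monotone (show s ≤ (s + t) / 2 by linarith))
  nlinarith

/-- If `α` stayed bounded, the flow `β' = α⁻²` would reach parameters at which `M(β) = 1/α` is
small. -/
lemma tendsto_growth {w : ℕ → ℝ≥0∞} (hw : IsArmSeries w) : Tendsto (growth w) atTop atTop := by
  refine tendsto_atTop_atTop_of_monotone (growth_monotone hw) fun B => ?_
  by_contra! h
  have hB : 0 < B := (growth_pos hw 0).trans (h 0)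
  have h1 : ∀ t, 1 / B < env w (flow w t) := fun t => by
    rw [one_div_lt hB (env_flow_pos hw t)]
    exact h t
  obtain ⟨b, hb, hb'⟩ := exists_env_lt hw (one_div_pos.2 hB)
  -- the flow has speed at least `1/B²`, hence reaches every parameter
  have h2 : ∀ t, 0 ≤ t → 1 / B ^ 2 * t ≤ flow w t := fun t ht => by
    rw [flow_eq hw t]
    have h3 : ∫ _ in (0 : ℝ)..t, 1 / B ^ 2 = 1 / B ^ 2 * t := by
      rw [intervalIntegral.integral_const, smul_eq_mul]
      ring
    rw [← h3]
    refine intervalIntegral.integral_mono_on ht (by simp) ?_ fun s _ => ?_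
    · exact ((continuous_const.div ((continuous_growth hw).pow 2)
        fun s => pow_ne_zero 2 (growth_pos hw s).ne')).intervalIntegrable _ _
    · exact one_div_le_one_div_of_le (pow_pos (growth_pos hw s) 2)
        (pow_le_pow_left₀ (growth_pos hw s).le (h s).le 2)
  have h3 := h2 (b * B ^ 2) (by positivity)
  have h4 : 1 / B ^ 2 * (b * B ^ 2) = b := by field_simp
  exact (hb' _ (h4 ▸ h3)).not_gt (h1 _)

/-- `t ↦ α_t` maps `[T, ∞)` onto `[α_T, ∞)`. -/
lemma image_growth_Ici {w : ℕ → ℝ≥0∞} (hw : IsArmSeries w) {T r : ℝ} (hr : growth w T ≤ r) :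
    ∃ t, T ≤ t ∧ growth w t = r := by
  obtain ⟨u, hTu, hu⟩ := ((eventually_ge_atTop T).and
    ((tendsto_growth hw).eventually_ge_atTop r)).exists
  obtain ⟨t, ht, h⟩ := intermediate_value_Icc hTu (continuous_growth hw).continuousOn ⟨hr, hu⟩
  exact ⟨t, ht.1, h⟩

lemma image_growth_Ioc {w : ℕ → ℝ≥0∞} (hw : IsArmSeries w) {T t : ℝ} (hT : 0 ≤ T) (ht : T ≤ t) :
    growth w '' Ioc T t = Ioc (growth w T) (growth w t) := by
  have hm := growth_strictMonoOn hw
  ext r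
  constructor
  · rintro ⟨s, hs, rfl⟩
    exact ⟨hm hT (hT.trans hs.1.le) hs.1, growth_monotone hw hs.2⟩
  · intro hr
    obtain ⟨s, hs, rfl⟩ := image_growth_Ici hw hr.1.le
    have h1 : T < s := lt_of_le_of_ne hs fun h => hr.1.ne (by rw [h])
    exact ⟨s, ⟨h1, (hm.le_iff_le (hT.trans hs) (hT.trans ht)).1 hr.2⟩, rfl⟩

/-- The substitution `r = α_s` turns `dr / k₀(H(1/r))` into `ds`, because `α' = k₀(ℓ)`. -/
lemma integrandΓ_integral {c₀ : Conc} (hw : IsGelling (armCoeff c₀ 1)) {t : ℝ}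
    (ht : critT (armCoeff c₀ 1) ≤ t) :
    IntervalIntegrable (integrandΓ c₀) volume (startPoint c₀) (growth (armCoeff c₀ 1) t) ∧
      fnΓ c₀ (growth (armCoeff c₀ 1) t) = startPoint c₀ + (t - critT (armCoeff c₀ 1)) := by
  set w := armCoeff c₀ 1 with hwdef
  have hT := hw.critT_nonneg
  have hle := growth_monotone hw.toIsArmSeries ht
  have hd : ∀ s ∈ Ioc (critT w) t,
      HasDerivWithinAt (growth w) (slp w (flow w s)) (Ioc (critT w) t) s := fun s hs =>
    (hasDerivAt_growth hw.toIsArmSeries (hT.trans_lt hs.1)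
      (hw.continuousAt_slp (flow_mem_posSet hw.toIsArmSeries (hT.trans_lt hs.1))
        (hw.critB_lt_flow.2 hs.1))).hasDerivWithinAt
  have hinj : InjOn (growth w) (Ioc (critT w) t) :=
    (growth_strictMonoOn hw.toIsArmSeries).injOn.mono fun s hs => hT.trans hs.1.le
  have hone : ∀ s ∈ Ioc (critT w) t, |slp w (flow w s)| • integrandΓ c₀ (growth w s) = 1 := by
    intro s hs
    have hp := slp_pos hw.toIsArmSeries (flow_pos hw.toIsArmSeries (hT.trans_lt hs.1))
      (env_flow_pos hw.toIsArmSeries s)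
    rw [integrandΓ_growth hw hs.1, abs_of_pos hp, smul_eq_mul, mul_one_div_cancel hp.ne']
  have himg := image_growth_Ioc hw.toIsArmSeries hT ht
  have h1 := integrableOn_image_iff_integrableOn_abs_deriv_smul measurableSet_Ioc hd hinj
    (integrandΓ c₀)
  have h2 := integral_image_eq_integral_abs_deriv_smul measurableSet_Ioc hd hinj (integrandΓ c₀)
  rw [himg, ← startPoint_eq hw] at h1 h2
  rw [startPoint_eq hw] at *
  refine ⟨(intervalIntegrable_iff_integrableOn_Ioc_of_le hle).2 (h1.2 ?_), ?_⟩
  · exact (integrableOn_const (C := (1 : ℝ)) (by simp)).congr_fun (fun s hs => (hone s hs).symm)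
      measurableSet_Ioc
  · rw [fnΓ, startPoint_eq hw, intervalIntegral.integral_of_le hle, h2,
      setIntegral_congr_fun measurableSet_Ioc hone]
    simp [ht]

lemma injOn_fnΓ {c₀ : Conc} (hw : IsGelling (armCoeff c₀ 1)) :
    InjOn (fnΓ c₀) (Ici (startPoint c₀)) := by
  intro r hr r' hr' h
  rw [mem_Ici, startPoint_eq hw] at hr hr'
  obtain ⟨t, ht, rfl⟩ := image_growth_Ici hw.toIsArmSeries hr
  obtain ⟨t', ht', rfl⟩ := image_growth_Ici hw.toIsArmSeries hr'
  rw [(integrandΓ_integral hw ht).2, (integrandΓ_integral hw ht').2] at h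
  rw [show t = t' by linarith]

lemma bijOn_fnΓ {c₀ : Conc} (hw : IsGelling (armCoeff c₀ 1)) :
    BijOn (fnΓ c₀) (Ici (startPoint c₀)) (Ici (startPoint c₀)) := by
  refine ⟨fun r hr => ?_, injOn_fnΓ hw, fun r hr => ?_⟩
  · rw [mem_Ici, startPoint_eq hw] at hr
    obtain ⟨t, ht, rfl⟩ := image_growth_Ici hw.toIsArmSeries hr
    rw [(integrandΓ_integral hw ht).2, mem_Ici]
    linarith
  · have hr' : startPoint c₀ ≤ r := hr
    have ht : critT (armCoeff c₀ 1) ≤ critT (armCoeff c₀ 1) + (r - startPoint c₀) := by linarith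
    refine ⟨_, ?_, ((integrandΓ_integral hw ht).2.trans (by ring))⟩
    rw [mem_Ici, startPoint_eq hw]
    exact growth_monotone hw.toIsArmSeries (by rwa [← startPoint_eq hw])

lemma invΓ_eq {c₀ : Conc} (hw : IsGelling (armCoeff c₀ 1)) {t : ℝ}
    (ht : critT (armCoeff c₀ 1) ≤ t) :
    invΓ c₀ (startPoint c₀ + (t - critT (armCoeff c₀ 1))) = growth (armCoeff c₀ 1) t := by
  rw [← (integrandΓ_integral hw ht).2]
  refine (injOn_fnΓ hw).leftInvOn_invFunOn ?_
  rw [mem_Ici, startPoint_eq hw]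
  exact growth_monotone hw.toIsArmSeries ht

/-! ### The number of arms -/

lemma lowerSemicontinuous_arms_sol {c₀ : Conc} (hw : IsArmSeries (armCoeff c₀ 1)) :
    LowerSemicontinuous fun t => arms (sol c₀ t) := by
  refine lowerSemicontinuous_tsum fun a => lowerSemicontinuous_tsum fun m => ?_
  refine Continuous.lowerSemicontinuous ?_
  exact (ENNReal.continuous_const_mul (ENNReal.natCast_ne_top a)).comp
    (ENNReal.continuous_ofReal.comp (continuous_solReal hw a m))

lemma arms_sol_strictAntiOn {c₀ : Conc} (hw : IsArmSeries (armCoeff c₀ 1)) :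
    StrictAntiOn (fun t => arms (sol c₀ t)) (Ici 0) := by
  have h : ∀ s t, 0 < s → s < t → arms (sol c₀ t) < arms (sol c₀ s) := by
    intro s t hs hst
    have ht := hs.trans hst
    have h1 := flow_mem_posSet hw hs
    have h2 := flow_mem_posSet hw ht
    have h3 := slp_pos hw h2.1 h2.2
    have h4 := growth_strictMonoOn hw hs.le ht.le hst
    have h5 := growth_pos hw s
    have h6 := slp_antitoneOn hw h1 h2 ((flow_strictMono hw).monotone hst.le)
    rw [arms_sol hw hs, arms_sol hw ht]
    refine (ENNReal.ofReal_lt_ofReal_iff (div_pos (h3.trans_le h6) h5)).2 ?_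
    calc slp (armCoeff c₀ 1) (flow (armCoeff c₀ 1) t) / growth (armCoeff c₀ 1) t
        < slp (armCoeff c₀ 1) (flow (armCoeff c₀ 1) t) / growth (armCoeff c₀ 1) s := by gcongr
      _ ≤ _ := by gcongr
  intro s hs t ht hst
  rcases (show (0 : ℝ) ≤ s from hs).eq_or_lt with rfl | hs0
  · dsimp only
    rw [sol_zero hw]
    exact (h (t / 2) t (half_pos hst) (half_lt_self hst)).trans_le (arms_sol_le hw (half_pos hst))
  · exact h s t hs0 hst

/-- Continuity from the right holds at all times, including `0` and the gelation time, because `A`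
is decreasing and lower semicontinuous. -/
lemma continuousOn_arms_sol {c₀ : Conc} (hw : IsGelling (armCoeff c₀ 1)) :
    ContinuousOn (fun t => arms (sol c₀ t)) (Ici 0) := by
  have hw' := hw.toIsArmSeries
  have hright : ∀ t, 0 ≤ t → ContinuousWithinAt (fun t => arms (sol c₀ t)) (Ici t) t := by
    intro t ht
    refine tendsto_order.2 ⟨fun a ha => ?_, fun a ha => ?_⟩
    · exact (lowerSemicontinuous_arms_sol hw' t a ha).filter_mono nhdsWithin_le_nhds
    · filter_upwards [self_mem_nhdsWithin] with s hs
      exact ((arms_sol_strictAntiOn hw').antitoneOn ht (ht.trans hs) hs).trans_lt ha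
  have hleft : ∀ t, 0 < t → ContinuousWithinAt (fun t => arms (sol c₀ t)) (Iic t) t := by
    intro t ht
    have hcg := continuous_growth hw'
    suffices h : ContinuousWithinAt (fun s => slp (armCoeff c₀ 1) (flow (armCoeff c₀ 1) s))
        (Iic t) t by
      have h1 : ContinuousWithinAt (fun s => ENNReal.ofReal (armFlow (armCoeff c₀ 1) s))
          (Iic t) t :=
        ENNReal.continuous_ofReal.continuousAt.comp_continuousWithinAt
          (h.div hcg.continuousWithinAt (growth_pos hw' t).ne')
      refine h1.congr_of_eventuallyEq ?_ (arms_sol hw' ht)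
      filter_upwards [mem_nhdsWithin_of_mem_nhds (Ioi_mem_nhds ht)] with s hs
      exact arms_sol hw' hs
    rcases le_or_gt t (critT (armCoeff c₀ 1)) with htc | htc
    · refine (continuousWithinAt_const (b := kap (armCoeff c₀ 1) 1)).congr_of_eventuallyEq ?_ ?_
      · filter_upwards [mem_nhdsWithin_of_mem_nhds (Ioi_mem_nhds ht), self_mem_nhdsWithin]
          with s hs hs'
        rw [slp, hw.leastMax_flow_eq_one hs (hs'.out.trans htc)]
      · rw [slp, hw.leastMax_flow_eq_one ht htc]
    · exact (ContinuousAt.comp (hw.continuousAt_slp (flow_mem_posSet hw' ht)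
        (hw.critB_lt_flow.2 htc)) (continuous_flow hw').continuousAt).continuousWithinAt
  intro t ht
  rcases (show (0 : ℝ) ≤ t from ht).eq_or_lt with rfl | ht0
  · exact hright 0 le_rfl
  · exact (continuousAt_iff_continuous_left_right.2
      ⟨hleft t ht0, hright t ht0.le⟩).continuousWithinAt

/-- As `s ↦ p(β_s)` decreases, `α_t = 1 + ∫_0^t p(β_s) ds` is at least `1 + t p(β_t)`. -/
lemma one_add_mul_slp_le_growth {w : ℕ → ℝ≥0∞} (hw : IsArmSeries w) {t : ℝ} (ht : 0 < t) :
    1 + t * slp w (flow w t) ≤ growth w t := by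
  rw [growth_eq hw ht.le]
  have h3 : ∫ _ in (0 : ℝ)..t, slp w (flow w t) = t * slp w (flow w t) := by
    rw [intervalIntegral.integral_const, smul_eq_mul, sub_zero]
  rw [← h3]
  gcongr
  refine intervalIntegral.integral_mono_on_of_le_Ioo ht.le (by simp)
    (intervalIntegrable_slp_flow hw ht.le) fun s hs => ?_
  exact slp_antitoneOn hw (flow_mem_posSet hw hs.1) (flow_mem_posSet hw ht)
    ((flow_strictMono hw).monotone hs.2.le)

lemma armFlow_le {w : ℕ → ℝ≥0∞} (hw : IsArmSeries w) {t : ℝ} (ht : 0 < t) :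
    armFlow w t ≤ slp w (flow w t) / (1 + t * slp w (flow w t)) := by
  have := slp_nonneg w (flow w t)
  exact div_le_div_of_nonneg_left this (by positivity) (one_add_mul_slp_le_growth hw ht)

lemma arms_sol_le_div {c₀ : Conc} (hw : IsArmSeries (armCoeff c₀ 1)) (hA : arms c₀ < ⊤) {t : ℝ}
    (ht : 0 < t) : arms (sol c₀ t) ≤ arms c₀ / (1 + ENNReal.ofReal t * arms c₀) := by
  have hb := flow_mem_posSet hw ht
  have hp := slp_nonneg (armCoeff c₀ 1) (flow (armCoeff c₀ 1) t)
  have hle : slp (armCoeff c₀ 1) (flow (armCoeff c₀ 1) t) ≤ (arms c₀).toReal := by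
    have hm := isMaximizer_leastMax hw hb.1 hb.2
    have h1 : kser (armCoeff c₀ 1) 1 ≠ ⊤ := by rw [← arms_eq_kser]; exact hA.ne
    rw [arms_eq_kser]
    exact ENNReal.toReal_mono h1 (kser_mono _ (ENNReal.ofReal_le_one.2 hm.mem.1.2))
  have hA0 : 0 ≤ (arms c₀).toReal := ENNReal.toReal_nonneg
  have h2 : arms c₀ / (1 + ENNReal.ofReal t * arms c₀) =
      ENNReal.ofReal ((arms c₀).toReal / (1 + t * (arms c₀).toReal)) := by
    rw [ENNReal.ofReal_div_of_pos (by positivity), ENNReal.ofReal_add one_pos.le (by positivity),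
      ENNReal.ofReal_mul ht.le, ENNReal.ofReal_toReal hA.ne, ENNReal.ofReal_one]
  rw [arms_sol hw ht, h2]
  refine ENNReal.ofReal_le_ofReal ((armFlow_le hw ht).trans ?_)
  rw [div_le_div_iff₀ (by positivity) (by positivity)]
  nlinarith

lemma arms_sol_le_one_div {c₀ : Conc} (hw : IsArmSeries (armCoeff c₀ 1)) {t : ℝ}
    (ht : 0 < t) : arms (sol c₀ t) ≤ 1 / ENNReal.ofReal t := by
  have hp := slp_nonneg (armCoeff c₀ 1) (flow (armCoeff c₀ 1) t)
  have h1 : 1 / ENNReal.ofReal t = ENNReal.ofReal (1 / t) := by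
    rw [ENNReal.ofReal_div_of_pos ht, ENNReal.ofReal_one]
  rw [arms_sol hw ht, h1]
  refine ENNReal.ofReal_le_ofReal ((armFlow_le hw ht).trans ?_)
  rw [div_le_div_iff₀ (by positivity) ht]
  nlinarith

/-! ### The functions `φ_t` and their inverses -/

lemma phi_eq_coe {c₀ : Conc} {c : ℝ → Conc} {t x y : ℝ} (h : genFun c₀ x y < ⊤) :
    phi c₀ c t x y = ((alpha c t * (x - beta c t * (genFun c₀ x y).toReal) : ℝ) : EReal) := by
  have h1 : (genFun c₀ x y : EReal) = (((genFun c₀ x y).toReal : ℝ) : EReal) := by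
    lift genFun c₀ x y to ℝ≥0 using h.ne with g
    rfl
  rw [phi, h1]
  norm_cast

lemma phi_eq_bot {c₀ : Conc} {c : ℝ → Conc} {t x y : ℝ} (hb : 0 < beta c t)
    (h : genFun c₀ x y = ⊤) : phi c₀ c t x y = ⊥ := by
  rw [phi, h, EReal.coe_ennreal_top, EReal.coe_mul_top_of_pos hb, EReal.sub_top,
    EReal.coe_mul_bot_of_pos (alpha_pos c t)]

lemma phi_of_beta_eq_zero {c₀ : Conc} {c : ℝ → Conc} {t x y : ℝ} (hb : beta c t = 0) :
    phi c₀ c t x y = ((alpha c t * x : ℝ) : EReal) := by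
  rw [phi, hb, EReal.coe_zero, zero_mul, sub_zero, EReal.coe_mul]

/-- The equation `φ_t(z,y) = x` as a fixed point equation for `z` in `[0,∞]`. -/
lemma phi_eq_iff {c₀ : Conc} {c : ℝ → Conc} {t x y z : ℝ} (hb : 0 ≤ beta c t) (hz : 0 ≤ z)
    (hx : 0 ≤ x) : phi c₀ c t z y = x ↔
      ENNReal.ofReal (x / alpha c t) + ENNReal.ofReal (beta c t) * genFun c₀ z y =
        ENNReal.ofReal z := by
  have hα := alpha_pos c t
  have hxα := div_nonneg hx hα.le
  rcases hb.eq_or_lt with hb | hb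
  · rw [phi_of_beta_eq_zero hb.symm, ← hb, ENNReal.ofReal_zero, zero_mul, add_zero,
      EReal.coe_eq_coe_iff, ENNReal.ofReal_eq_ofReal_iff hxα hz, div_eq_iff hα.ne', mul_comm,
      eq_comm]
  by_cases h : genFun c₀ z y = ⊤
  · rw [phi_eq_bot hb h, h, ENNReal.mul_top (by simpa using hb), add_top]
    simp
  · have h0 : 0 ≤ (genFun c₀ z y).toReal := ENNReal.toReal_nonneg
    rw [phi_eq_coe (lt_top_iff_ne_top.2 h), EReal.coe_eq_coe_iff]
    conv_rhs => rw [← ENNReal.ofReal_toReal h]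
    rw [← ENNReal.ofReal_mul hb.le, ← ENNReal.ofReal_add hxα (mul_nonneg hb.le h0),
      ENNReal.ofReal_eq_ofReal_iff (add_nonneg hxα (mul_nonneg hb.le h0)) hz,
      ← eq_sub_iff_add_eq, div_eq_iff hα.ne', mul_comm (alpha c t), eq_comm]

/-- The least maximizer `ℓ_t` of `φ_t(·,1)`. -/
def peak (w : ℕ → ℝ≥0∞) (t : ℝ) : ℝ := leastMax w (flow w t)

/-- The least solution `h_t(x,y)` of `φ_t(h,y) = x`, by way of the fixed point equation
`h = x / α_t + β_t k₀(h,y)`. -/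
def leastInv (c₀ : Conc) (t x y : ℝ) : ℝ :=
  (lfix (armCoeff c₀ (ENNReal.ofReal y)) (ENNReal.ofReal (x / growth (armCoeff c₀ 1) t))
    (ENNReal.ofReal (flow (armCoeff c₀ 1) t))).toReal

lemma peak_zero {w : ℕ → ℝ≥0∞} (hw : IsArmSeries w) : peak w 0 = 1 := by
  rw [peak, flow_zero hw, leastMax, env_of_nonpos le_rfl, ← lfix_eq]
  simp

lemma lfix_le_peak {c₀ : Conc} (hw : IsArmSeries (armCoeff c₀ 1)) {t x y : ℝ} (ht : 0 ≤ t)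
    (hx : x ≤ 1) (hy : y ≤ 1) :
    lfix (armCoeff c₀ (ENNReal.ofReal y)) (ENNReal.ofReal (x / growth (armCoeff c₀ 1) t))
      (ENNReal.ofReal (flow (armCoeff c₀ 1) t)) ≤ ENNReal.ofReal (peak (armCoeff c₀ 1) t) := by
  have hα := growth_pos hw t
  rcases ht.eq_or_lt with rfl | ht
  · rw [peak_zero hw, growth_zero hw, flow_zero hw, ← lfix_eq]
    simpa using hx
  have hb := flow_mem_posSet hw ht
  have h1 := lfix_eq (armCoeff c₀ 1) (ENNReal.ofReal (env (armCoeff c₀ 1) (flow (armCoeff c₀ 1) t)))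
    (ENNReal.ofReal (flow (armCoeff c₀ 1) t))
  rw [← ofReal_leastMax hw hb.1 hb.2] at h1
  refine lfix_le (le_of_le_of_eq ?_ h1)
  have h2 : x / growth (armCoeff c₀ 1) t ≤ env (armCoeff c₀ 1) (flow (armCoeff c₀ 1) t) := by
    rw [growth, div_div_eq_mul_div, div_one]
    exact mul_le_of_le_one_left hb.2.le hx
  have h3 : kser (armCoeff c₀ (ENNReal.ofReal y)) (ENNReal.ofReal (peak (armCoeff c₀ 1) t)) ≤
      kser (armCoeff c₀ 1) (ENNReal.ofReal (peak (armCoeff c₀ 1) t)) := by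
    refine ENNReal.tsum_le_tsum fun j => ?_
    have := ENNReal.ofReal_le_one.2 hy
    unfold armCoeff
    gcongr
  gcongr
  exact h3

lemma peak_mem {w : ℕ → ℝ≥0∞} (hw : IsArmSeries w) {t : ℝ} (ht : 0 ≤ t) :
    peak w t ∈ Icc (0 : ℝ) 1 := by
  rcases ht.eq_or_lt with rfl | ht
  · rw [peak_zero hw]
    simp
  · have hb := flow_mem_posSet hw ht
    exact (isMaximizer_leastMax hw hb.1 hb.2).mem.1

lemma ofReal_leastInv {c₀ : Conc} (hw : IsArmSeries (armCoeff c₀ 1)) {t x y : ℝ} (ht : 0 ≤ t)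
    (hx : x ≤ 1) (hy : y ≤ 1) : ENNReal.ofReal (leastInv c₀ t x y) =
    lfix (armCoeff c₀ (ENNReal.ofReal y)) (ENNReal.ofReal (x / growth (armCoeff c₀ 1) t))
      (ENNReal.ofReal (flow (armCoeff c₀ 1) t)) :=
  ENNReal.ofReal_toReal ((lfix_le_peak hw ht hx hy).trans_lt ENNReal.ofReal_lt_top).ne

lemma leastInv_mem {c₀ : Conc} (hw : IsArmSeries (armCoeff c₀ 1)) {t x y : ℝ} (ht : 0 ≤ t)
    (hx : x ≤ 1) (hy : y ≤ 1) : leastInv c₀ t x y ∈ Icc (0 : ℝ) 1 :=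
  ⟨ENNReal.toReal_nonneg, (ENNReal.toReal_le_of_le_ofReal (peak_mem hw ht).1
    (lfix_le_peak hw ht hx hy)).trans (peak_mem hw ht).2⟩

variable {c₀ : Conc} {c : ℝ → Conc} {t : ℝ}

lemma phi_leastInv (hw : IsArmSeries (armCoeff c₀ 1)) (ht : 0 ≤ t)
    (hα : alpha c t = growth (armCoeff c₀ 1) t) (hβ : beta c t = flow (armCoeff c₀ 1) t)
    {x y : ℝ} (hx : x ∈ Icc (0 : ℝ) 1) (hy : y ≤ 1) :
    phi c₀ c t (leastInv c₀ t x y) y = x := by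
  rw [phi_eq_iff (hβ ▸ flow_nonneg hw ht) (leastInv_mem hw ht hx.2 hy).1 hx.1, hα, hβ,
    genFun_eq_kser, ofReal_leastInv hw ht hx.2 hy]
  exact lfix_eq _ _ _

lemma leastInv_le (hw : IsArmSeries (armCoeff c₀ 1)) (ht : 0 ≤ t)
    (hα : alpha c t = growth (armCoeff c₀ 1) t) (hβ : beta c t = flow (armCoeff c₀ 1) t)
    {x y z : ℝ} (hx : 0 ≤ x) (hz : 0 ≤ z) (h : phi c₀ c t z y = x) :
    leastInv c₀ t x y ≤ z := by
  rw [phi_eq_iff (hβ ▸ flow_nonneg hw ht) hz hx, hα, hβ, genFun_eq_kser] at h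
  exact ENNReal.toReal_le_of_le_ofReal hz (lfix_le h.le)

lemma genFun_sol_leastInv (hw : IsArmSeries (armCoeff c₀ 1)) (ht : 0 ≤ t) {x y : ℝ}
    (hx : x ≤ 1) (hy : y ≤ 1) : genFun (sol c₀ t) x y =
      (ENNReal.ofReal (growth (armCoeff c₀ 1) t))⁻¹ * genFun c₀ (leastInv c₀ t x y) y := by
  rw [genFun_sol hw ht, genFun_eq_kser, ofReal_leastInv hw ht hx hy]

lemma genFun_one_lt_top_iff {x : ℝ} :
    genFun c₀ x 1 < ⊤ ↔ kser (armCoeff c₀ 1) (ENNReal.ofReal x) < ⊤ := by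
  rw [genFun_eq_kser, ENNReal.ofReal_one]

lemma phi_one_eq_coe (hα : alpha c t = growth (armCoeff c₀ 1) t)
    (hβ : beta c t = flow (armCoeff c₀ 1) t) {x : ℝ}
    (h : kser (armCoeff c₀ 1) (ENNReal.ofReal x) < ⊤) :
    phi c₀ c t x 1 = ((growth (armCoeff c₀ 1) t *
      (x - flow (armCoeff c₀ 1) t * kap (armCoeff c₀ 1) x) : ℝ) : EReal) := by
  rw [phi_eq_coe (genFun_one_lt_top_iff.2 h), hα, hβ, ← genFunOne_eq, genFunOne]

lemma phi_peak (hw : IsArmSeries (armCoeff c₀ 1)) (ht : 0 ≤ t)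
    (hα : alpha c t = growth (armCoeff c₀ 1) t) (hβ : beta c t = flow (armCoeff c₀ 1) t) :
    phi c₀ c t (peak (armCoeff c₀ 1) t) 1 = 1 := by
  rcases ht.eq_or_lt with rfl | ht
  · rw [phi_of_beta_eq_zero (hβ.trans (flow_zero hw)), hα, growth_zero hw, peak_zero hw]
    norm_num
  · have hb := flow_mem_posSet hw ht
    have hm := isMaximizer_leastMax hw hb.1 hb.2
    rw [peak, phi_one_eq_coe hα hβ hm.mem.2, ← hm.eq, growth, one_div_mul_cancel hb.2.ne']
    rfl

lemma phi_le_one (hw : IsArmSeries (armCoeff c₀ 1)) (ht : 0 ≤ t)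
    (hα : alpha c t = growth (armCoeff c₀ 1) t) (hβ : beta c t = flow (armCoeff c₀ 1) t)
    {x : ℝ} (hx : x ∈ Icc (0 : ℝ) 1) : phi c₀ c t x 1 ≤ 1 := by
  rcases ht.eq_or_lt with rfl | ht
  · rw [phi_of_beta_eq_zero (hβ.trans (flow_zero hw)), hα, growth_zero hw, one_mul]
    exact_mod_cast hx.2
  · have hb := flow_mem_posSet hw ht
    by_cases h : kser (armCoeff c₀ 1) (ENNReal.ofReal x) < ⊤
    · rw [phi_one_eq_coe hα hβ h, ← EReal.coe_one, EReal.coe_le_coe_iff, growth,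
        one_div_mul_eq_div, div_le_one hb.2]
      exact le_env hb.1 ⟨hx, h⟩
    · rw [phi_eq_bot (hβ ▸ hb.1) (not_lt_top_iff.1 (genFun_one_lt_top_iff.not.2 h))]
      exact bot_le

lemma hasDerivAt_phi_peak (hw : IsGelling (armCoeff c₀ 1)) (ht : critT (armCoeff c₀ 1) < t)
    (hα : alpha c t = growth (armCoeff c₀ 1) t) (hβ : beta c t = flow (armCoeff c₀ 1) t) :
    HasDerivAt (fun x => (phi c₀ c t x 1).toReal) 0 (peak (armCoeff c₀ 1) t) := by
  have hb := flow_mem_posSet hw.toIsArmSeries (hw.critT_nonneg.trans_lt ht)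
  have hbc := hw.critB_lt_flow.2 ht
  obtain ⟨h0, h1⟩ := hw.leastMax_mem_Ioo hb hbc
  have hd : HasDerivAt (fun x => growth (armCoeff c₀ 1) t *
      (x - flow (armCoeff c₀ 1) t * kap (armCoeff c₀ 1) x)) 0 (peak (armCoeff c₀ 1) t) := by
    refine (((hasDerivAt_id _).sub ((hw.isFinite.hasDerivAt_kap h0 h1).const_mul
      (flow (armCoeff c₀ 1) t))).const_mul (growth (armCoeff c₀ 1) t)).congr_deriv ?_
    rw [hw.mul_kap_derCoeff_leastMax hb hbc, sub_self, mul_zero]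
  refine hd.congr_of_eventuallyEq ?_
  filter_upwards [Ioo_mem_nhds h0 h1] with x hx
  rw [phi_one_eq_coe hα hβ (hw.isFinite x hx.1.le hx.2), EReal.toReal_coe]

lemma genFun_peak (hw : IsArmSeries (armCoeff c₀ 1)) (ht : 0 < t) :
    genFun c₀ (peak (armCoeff c₀ 1) t) 1 =
      ENNReal.ofReal (slp (armCoeff c₀ 1) (flow (armCoeff c₀ 1) t)) := by
  have hb := flow_mem_posSet hw ht
  rw [slp, ofReal_kap (isMaximizer_leastMax hw hb.1 hb.2).mem.2, genFun_eq_kser, ENNReal.ofReal_one,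
    peak]

lemma growth_mul_arms_sol (hw : IsArmSeries (armCoeff c₀ 1)) (ht : 0 < t) :
    ENNReal.ofReal (growth (armCoeff c₀ 1) t) * arms (sol c₀ t) =
      genFun c₀ (peak (armCoeff c₀ 1) t) 1 := by
  have hα := growth_pos hw t
  rw [arms_sol hw ht, genFun_peak hw ht, ← ENNReal.ofReal_mul hα.le, armFlow,
    mul_div_cancel₀ _ hα.ne']

lemma ofReal_growth (hw : IsArmSeries (armCoeff c₀ 1)) (ht : 0 < t) :
    ENNReal.ofReal (growth (armCoeff c₀ 1) t) =
      1 + ∫⁻ s in Ioc 0 t, genFun c₀ (peak (armCoeff c₀ 1) s) 1 := by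
  have h1 := intervalIntegrable_slp_flow hw ht.le
  have hn : ∀ s, 0 ≤ slp (armCoeff c₀ 1) (flow (armCoeff c₀ 1) s) := fun s => slp_nonneg _ _
  rw [growth_eq hw ht.le, intervalIntegral.integral_of_le ht.le,
    ENNReal.ofReal_add one_pos.le (integral_nonneg hn), ENNReal.ofReal_one,
    ofReal_integral_eq_lintegral_ofReal h1.1 (Eventually.of_forall hn)]
  congr 1
  exact setLIntegral_congr_fun measurableSet_Ioc fun s hs => (genFun_peak hw hs.1).symm

lemma arms_sol_eq_div (hw : IsArmSeries (armCoeff c₀ 1)) (ht : 0 < t) :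
    arms (sol c₀ t) = genFun c₀ (peak (armCoeff c₀ 1) t) 1 /
      (1 + ∫⁻ s in Ioc 0 t, genFun c₀ (peak (armCoeff c₀ 1) s) 1) := by
  have hα := growth_pos hw t
  rw [← ofReal_growth hw ht, ← growth_mul_arms_sol hw ht, mul_comm,
    ENNReal.mul_div_cancel_right (by simpa using hα) ENNReal.ofReal_ne_top]

/-! ### The second moment -/

lemma secondMoment_sol_lt_top (hw : IsGelling (armCoeff c₀ 1)) (ht : 0 ≤ t)
    (htc : t < critT (armCoeff c₀ 1)) : secondMoment (sol c₀ t) < ⊤ := by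
  have hbc : flow (armCoeff c₀ 1) t < critB (armCoeff c₀ 1) := by
    rw [← hw.flow_critT]
    exact flow_strictMono hw.toIsArmSeries htc
  obtain ⟨hK, hAK⟩ := hw.kser_one_lt ((flow_nonneg hw.toIsArmSeries ht).trans_lt hbc)
  have hA : arms c₀ < ⊤ := by
    rw [arms_eq_kser]
    exact hAK.trans_le le_top
  have hK' : factorialMoment c₀ < ⊤ := by
    rw [factorialMoment_eq_kser_derCoeff]
    exact lt_top_iff_ne_top.2 hK
  rw [secondMoment_eq, ENNReal.add_lt_top]
  rcases ht.eq_or_lt with rfl | ht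
  · rw [sol_zero hw.toIsArmSeries]
    exact ⟨hK', hA⟩
  · refine ⟨(factorialMoment_sol_le hw.toIsArmSeries hK' ht ?_).trans_lt ENNReal.ofReal_lt_top,
      (arms_sol_le hw.toIsArmSeries ht).trans_lt hA⟩
    have hpos := ENNReal.toReal_pos hw.kser_derCoeff_pos.ne' hK
    rw [critB, lt_inv_comm₀ (flow_pos hw.toIsArmSeries ht) hpos] at hbc
    rw [factorialMoment_eq_kser_derCoeff]
    calc _ < flow (armCoeff c₀ 1) t * (flow (armCoeff c₀ 1) t)⁻¹ :=
          mul_lt_mul_of_pos_left hbc (flow_pos hw.toIsArmSeries ht)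
      _ = 1 := mul_inv_cancel₀ (flow_pos hw.toIsArmSeries ht).ne'

/-- Below its least maximizer, `x ↦ x - b κ(x)` is strictly increasing. -/
lemma IsGelling.strictMonoOn_sub {w : ℕ → ℝ≥0∞} (hw : IsGelling w) {b : ℝ} (hb : b ∈ posSet w) :
    StrictMonoOn (fun x => x - b * kap w x) (Ioo 0 (leastMax w b)) := by
  have hm := isMaximizer_leastMax hw.toIsArmSeries hb.1 hb.2
  have hd : ∀ x ∈ Ioo 0 (leastMax w b),
      HasDerivAt (fun x => x - b * kap w x) (1 - b * kap (derCoeff w) x) x := fun x hx =>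
    (hasDerivAt_id _).sub
      ((hw.isFinite.hasDerivAt_kap hx.1 (hx.2.trans_le hm.mem.1.2)).const_mul b)
  refine strictMonoOn_of_deriv_pos (convex_Ioo _ _)
    (fun x hx => (hd x hx).continuousAt.continuousWithinAt) fun x hx => ?_
  rw [interior_Ioo] at hx
  rw [(hd x hx).deriv, sub_pos]
  have hx1 := hx.2.trans_le hm.mem.1.2
  have hp := hw.kap_derCoeff_pos hx.1 hx1
  rw [← lt_div_iff₀ hp, one_div]
  rcases le_or_gt b (critB w) with h | h
  · exact h.trans_lt (hw.critB_lt hx.1 hx1)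
  · obtain ⟨h0, h1⟩ := hw.leastMax_mem_Ioo hb h
    rw [eq_inv_of_mul_eq_one_left (hw.mul_kap_derCoeff_leastMax hb h)]
    exact inv_strictAnti₀ hp (hw.strictMonoOn_kap_derCoeff ⟨hx.1.le, hx1⟩ ⟨h0.le, h1⟩ hx.2)

/-- For `b ≥ 1/K` the slope of `κ` below the least maximizer comes arbitrarily close to `1/b`. -/
lemma IsGelling.inv_le_of_kap_derCoeff_le {w : ℕ → ℝ≥0∞} (hw : IsGelling w) {b : ℝ}
    (hb : b ∈ posSet w) (hbc : critB w ≤ b) {D : ℝ} (hD : 0 ≤ D)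
    (h : ∀ᶠ x in 𝓝[<] (leastMax w b), kap (derCoeff w) x ≤ D) : b⁻¹ ≤ D := by
  rcases hbc.eq_or_lt with hbc | hbc
  · have hm : leastMax w b = 1 := hw.leastMax_eq_one hb hbc.ge
    rw [hm] at h
    have h1 : kser (derCoeff w) 1 ≤ ENNReal.ofReal D := by
      refine le_of_tendsto (tendsto_kser_one (derCoeff w)) ?_
      filter_upwards [h, Ioo_mem_nhdsLT (zero_lt_one (α := ℝ))] with x hx hx1
      rw [← ofReal_kap (hw.isFinite.derCoeff x hx1.1.le hx1.2)]
      exact ENNReal.ofReal_le_ofReal hx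
    rw [← hbc, critB, inv_inv]
    exact ENNReal.toReal_le_of_le_ofReal hD h1
  · obtain ⟨h0, h1⟩ := hw.leastMax_mem_Ioo hb hbc
    rw [← eq_inv_of_mul_eq_one_right (hw.mul_kap_derCoeff_leastMax hb hbc)]
    exact le_of_tendsto ((hw.isFinite.derCoeff.hasDerivAt_kap h0 h1).continuousAt.tendsto.mono_left
      nhdsWithin_le_nhds) h

/-- From the gelation time on, a finite factorial moment `C` of the solution would give `k_t(·,1)`
slope at most `C` at `1`, and in the coordinate `h_t` the slope of `κ` below `ℓ_t` would stay away
from `1/β_t`. -/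
lemma factorialMoment_sol_eq_top (hw : IsGelling (armCoeff c₀ 1)) (ht : 0 < t)
    (htc : critT (armCoeff c₀ 1) ≤ t) : factorialMoment (sol c₀ t) = ⊤ := by
  by_contra hC
  have hbc : critB (armCoeff c₀ 1) ≤ flow (armCoeff c₀ 1) t := by
    rw [← hw.flow_critT]
    exact (flow_strictMono hw.toIsArmSeries).monotone htc
  have hb := flow_mem_posSet hw.toIsArmSeries ht
  have hα := growth_pos hw.toIsArmSeries t
  have hgen := fun x => genFun_sol hw.toIsArmSeries ht.le x 1
  simp only [ENNReal.ofReal_one, genFun_eq_kser] at hgen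
  have hinv : 1 / growth (armCoeff c₀ 1) t = env (armCoeff c₀ 1) (flow (armCoeff c₀ 1) t) := by
    rw [growth, one_div_one_div]
  set w := armCoeff c₀ 1 with hwdef
  set b := flow w t with hbdef
  set α := growth w t with hαdef
  set C := (factorialMoment (sol c₀ t)).toReal with hCdef
  have hC0 : 0 ≤ C := ENNReal.toReal_nonneg
  have hm := isMaximizer_leastMax hw.toIsArmSeries hb.1 hb.2
  have hl0 : 0 < leastMax w b := hb.2.trans_le (env_le_leastMax hw.toIsArmSeries hb.1 hb.2)
  have hfix1 : lfix w (ENNReal.ofReal (1 / α)) (ENNReal.ofReal b) =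
      ENNReal.ofReal (leastMax w b) := by
    rw [hinv, ofReal_leastMax hw.toIsArmSeries hb.1 hb.2]
  have hub : b * kap w (leastMax w b) < leastMax w b := by linarith [hm.eq, hb.2]
  have hbk := mul_nonneg hb.1.le (kap_nonneg w (leastMax w b))
  have hkey : ∀ u ∈ Ioo (b * kap w (leastMax w b)) (leastMax w b),
      kap (derCoeff w) u ≤ α ^ 2 * C / (1 + α ^ 2 * C * b) := by
    intro u hu
    have hu0 : 0 < u := hbk.trans_lt hu.1
    have hu1 : u < 1 := hu.2.trans_le hm.mem.1.2
    have hfin := hw.isFinite u hu0.le hu1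
    have hmono := kap_mono hu.2.le hm.mem.2
    have hfu : 0 < u - b * kap w u := by
      have := mul_le_mul_of_nonneg_left hmono hb.1.le
      linarith [hu.1]
    -- `u` is the least solution of its fixed point equation
    have hfix : lfix w (ENNReal.ofReal (u - b * kap w u)) (ENNReal.ofReal b) =
        ENNReal.ofReal u := by
      have hle := lfix_le_ofReal hb.1.le hfu.le hfin le_rfl
      have htop := (hle.trans_lt ENNReal.ofReal_lt_top).ne
      have heq := toReal_lfix hb.1 hfu.le htop
      have hle' := ENNReal.toReal_le_of_le_ofReal hu0.le hle
      rw [← ENNReal.ofReal_toReal htop]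
      congr 1
      refine (hw.strictMonoOn_sub hb).injOn ⟨?_, hle'.trans_lt hu.2⟩ ⟨hu0, hu.2⟩ heq.symm
      exact hfu.trans_le (heq.trans_le (sub_le_self _ (mul_nonneg hb.1.le (kap_nonneg _ _))))
    set x := α * (u - b * kap w u) with hx
    have hxα : x / α = u - b * kap w u := by rw [hx, mul_div_cancel_left₀ _ hα.ne']
    have hx0 : 0 ≤ x := by positivity
    have hx1 : x ≤ 1 := by
      have h1 := le_env hb.1 (mem_finSet hw.toIsArmSeries hu0.le hu1)
      rw [← hinv, le_div_iff₀ hα] at h1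
      linarith
    have hsl := kser_le_add (armCoeff (sol c₀ t) 1) hx0 hx1 le_rfl
    rw [← factorialMoment_eq, hgen, hgen, hfix1, hxα, hfix, ← ofReal_kap hm.mem.2,
      ← ofReal_kap hfin, ← ENNReal.ofReal_inv_of_pos hα, ← ENNReal.ofReal_toReal hC, ← hCdef,
      ← ENNReal.ofReal_mul (inv_pos.2 hα).le, ← ENNReal.ofReal_mul (inv_pos.2 hα).le,
      ← ENNReal.ofReal_mul hC0, ← ENNReal.ofReal_add (mul_nonneg (inv_pos.2 hα).le (kap_nonneg _ _))
        (mul_nonneg hC0 (by linarith)), ENNReal.ofReal_le_ofReal_iff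
        (add_nonneg (mul_nonneg (inv_pos.2 hα).le (kap_nonneg _ _))
        (mul_nonneg hC0 (by linarith)))] at hsl
    have h1x : 1 - x = α * ((leastMax w b - u) - b * (kap w (leastMax w b) - kap w u)) := by
      have h1 : 1 = α * (leastMax w b - b * kap w (leastMax w b)) := by
        rw [← hm.eq, ← hinv, mul_one_div_cancel hα.ne']
      rw [hx]
      linarith
    have hsl2 : kap w (leastMax w b) - kap w u ≤
        α ^ 2 * C * ((leastMax w b - u) - b * (kap w (leastMax w b) - kap w u)) := by
      have h2 := mul_le_mul_of_nonneg_left hsl hα.le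
      rw [mul_add, ← mul_assoc, ← mul_assoc, mul_inv_cancel₀ hα.ne', one_mul, one_mul, h1x] at h2
      linarith
    -- `κ` lies above its tangent at `u`
    have htan : kap (derCoeff w) u * (leastMax w b - u) ≤ kap w (leastMax w b) - kap w u := by
      have h3 := kser_add_derCoeff_mul_le w hu0.le hu.2.le
      rw [← ofReal_kap hm.mem.2, ← ofReal_kap hfin,
        ← ofReal_kap (hw.isFinite.derCoeff u hu0.le hu1), ← ENNReal.ofReal_mul (kap_nonneg _ _),
        ← ENNReal.ofReal_add (kap_nonneg _ _) (mul_nonneg (kap_nonneg _ _) (sub_nonneg.2 hu.2.le)),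
        ENNReal.ofReal_le_ofReal_iff (kap_nonneg _ _)] at h3
      linarith
    have hpos : 0 < 1 + α ^ 2 * C * b := by
      have := hb.1
      positivity
    rw [le_div_iff₀ hpos]
    refine le_of_mul_le_mul_right ?_ (sub_pos.2 hu.2)
    have := mul_le_mul_of_nonneg_right htan hpos.le
    linarith
  have hD : 0 ≤ α ^ 2 * C / (1 + α ^ 2 * C * b) := by
    have := hb.1
    positivity
  have h := hw.inv_le_of_kap_derCoeff_le hb hbc hD (by
    filter_upwards [Ioo_mem_nhdsLT hub] with u hu using hkey u hu)
  rw [inv_le_iff_one_le_mul₀ hb.1, div_mul_eq_mul_div, le_div_iff₀ (by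
    have := hb.1
    positivity)] at h
  linarith

lemma secondMoment_sol_eq_top (hw : IsGelling (armCoeff c₀ 1)) (ht : 0 ≤ t)
    (htc : critT (armCoeff c₀ 1) ≤ t) : secondMoment (sol c₀ t) = ⊤ := by
  rw [secondMoment_eq, ENNReal.add_eq_top]
  left
  rcases ht.eq_or_lt with rfl | ht
  · have h0 : critB (armCoeff c₀ 1) = 0 := by
      rw [← hw.flow_critT, le_antisymm htc hw.critT_nonneg, flow_zero hw.toIsArmSeries]
    rw [critB, inv_eq_zero, ENNReal.toReal_eq_zero_iff] at h0
    rw [sol_zero hw.toIsArmSeries, factorialMoment_eq_kser_derCoeff]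
    exact h0.resolve_left hw.kser_derCoeff_pos.ne'
  · exact factorialMoment_sol_eq_top hw ht htc

end ArmsCoag

end

theorem mainTheorem1 (c₀ : ℕ → ℕ+ → ℝ≥0)
    (hfin : pairing c₀ (fun _ => 1) < ⊤) (hA₀ : 0 < arms c₀) :
    (arms c₀ = ⊤ → factorialMoment c₀ = ⊤) ∧
    -- existence and uniqueness of a global solution
    ∃ c : ℝ → ℕ → ℕ+ → ℝ≥0, IsSolution c₀ c ∧
      (∀ c' : ℝ → ℕ → ℕ+ → ℝ≥0, IsSolution c₀ c' → ∀ t : ℝ, 0 ≤ t → c' t = c t) ∧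
      (tGel c₀ < ⊤ →
        -- (1) the number of arms
        (ContinuousOn (fun t => arms (c t)) (Ici 0) ∧
          StrictAntiOn (fun t => arms (c t)) (Ici 0) ∧
          (∀ t : ℝ, 0 < t →
            (arms c₀ < ⊤ → arms (c t) ≤ arms c₀ / (1 + ENNReal.ofReal t * arms c₀)) ∧
            (arms c₀ = ⊤ → arms (c t) ≤ 1 / ENNReal.ofReal t)) ∧
          -- the function `G`
          (∀ x ∈ Ioo (0 : ℝ) 1, genFun c₀ x 1 < ⊤ ∧ DifferentiableAt ℝ (genFunOne c₀) x ∧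
            0 < deriv (genFunOne c₀) x) ∧
          Tendsto (fun x => (preG c₀ x : EReal)) (𝓝[>] 0) (𝓝 (fnG c₀ 0)) ∧
          fnG c₀ 0 ≤ 0 ∧
          Tendsto (fun x => (preG c₀ x : EReal)) (𝓝[<] 1) (𝓝 (fnG c₀ 1)) ∧
          0 < fnG c₀ 1 ∧
          (arms c₀ < ⊤ →
            fnG c₀ 1 = ((1 - (arms c₀ / factorialMoment c₀).toReal : ℝ) : EReal)) ∧
          (arms c₀ = ⊤ → fnG c₀ 1 = 1) ∧
          StrictMonoOn (fnG c₀) (Ico 0 1) ∧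
          BijOn (fnG c₀) (Ico 0 1) (Ico (fnG c₀ 0) (fnG c₀ 1)) ∧
          -- its right inverse `H`
          MapsTo (fnH c₀) (Ico (fnG c₀ 0) (fnG c₀ 1)) (Ico 0 1) ∧
          RightInvOn (fnH c₀) (fnG c₀) (Ico (fnG c₀ 0) (fnG c₀ 1)) ∧
          -- the function `Γ`
          (∀ x : ℝ, startPoint c₀ ≤ x →
            IntervalIntegrable (integrandΓ c₀) volume (startPoint c₀) x) ∧
          BijOn (fnΓ c₀) (Ici (startPoint c₀)) (Ici (startPoint c₀)) ∧
          -- the formula for `α`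
          (∀ t : ℝ, 0 ≤ t → ENNReal.ofReal t < tGel c₀ →
            alpha c t = 1 + (arms c₀).toReal * t) ∧
          (∀ t : ℝ, 0 ≤ t → tGel c₀ ≤ ENNReal.ofReal t →
            (arms c₀ < ⊤ → alpha c t =
              invΓ c₀ (1 + (arms c₀).toReal * (tGel c₀).toReal + t - (tGel c₀).toReal)) ∧
            (arms c₀ = ⊤ → alpha c t = invΓ c₀ (1 + t)))) ∧
        -- (2) and (3)
        (∃ (ℓ : ℝ → ℝ) (h : ℝ → ℝ → ℝ → ℝ),
          -- the maximum of `φ_t(·,1)`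
          (∀ t : ℝ, 0 ≤ t → ℓ t ∈ Icc (0 : ℝ) 1 ∧
            IsMaxOn (fun x => phi c₀ c t x 1) (Icc 0 1) (ℓ t) ∧ phi c₀ c t (ℓ t) 1 = 1) ∧
          (∀ t : ℝ, 0 ≤ t → ENNReal.ofReal t ≤ tGel c₀ → ℓ t = 1) ∧
          (∀ t : ℝ, 0 ≤ t → tGel c₀ < ENNReal.ofReal t →
            ℓ t ∈ Ioo (0 : ℝ) 1 ∧
            HasDerivAt (fun x => (phi c₀ c t x 1).toReal) 0 (ℓ t) ∧
            ((1 / alpha c t : ℝ) : EReal) ∈ Ico (fnG c₀ 0) (fnG c₀ 1) ∧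
            ℓ t = fnH c₀ ((1 / alpha c t : ℝ) : EReal)) ∧
          -- the right inverse `h_t(·,y)` of `φ_t(·,y)` on `[0,1]`: the smallest preimage
          (∀ t : ℝ, 0 ≤ t → ∀ y ∈ Icc (0 : ℝ) 1, ∀ x ∈ Icc (0 : ℝ) 1,
            h t x y ∈ Icc (0 : ℝ) 1 ∧ phi c₀ c t (h t x y) y = (x : EReal) ∧
            ∀ z ∈ Icc (0 : ℝ) 1, phi c₀ c t z y = (x : EReal) → h t x y ≤ z) ∧
          -- the representation of the generating function
          (∀ t : ℝ, 0 ≤ t → ∀ y ∈ Icc (0 : ℝ) 1, ∀ x ∈ Icc (0 : ℝ) 1,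
            genFun (c t) x y = (ENNReal.ofReal (alpha c t))⁻¹ * genFun c₀ (h t x y) y) ∧
          (∀ t : ℝ, 0 < t →
            arms (c t) = genFun (c t) 1 1 ∧
            ENNReal.ofReal (alpha c t) * genFun (c t) 1 1 = genFun c₀ (ℓ t) 1 ∧
            arms (c t) =
              genFun c₀ (ℓ t) 1 / (1 + ∫⁻ s in Ioc 0 t, genFun c₀ (ℓ s) 1))) ∧
        -- (4) the second moment
        (∀ t : ℝ, 0 ≤ t →
          (ENNReal.ofReal t < tGel c₀ → secondMoment (c t) < ⊤) ∧
          (tGel c₀ ≤ ENNReal.ofReal t → secondMoment (c t) = ⊤))) := by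
  have hw := isArmSeries_armCoeff hfin hA₀
  have hsol := isSolution_sol hfin hw
  have hα : ∀ t, 0 ≤ t → alpha (sol c₀) t = growth (armCoeff c₀ 1) t := fun t ht =>
    hsol.alpha_eq_growth hw ht
  have hβ : ∀ t, 0 ≤ t → beta (sol c₀) t = flow (armCoeff c₀ 1) t := fun t ht =>
    hsol.beta_eq_flow hw ht
  have hfact : arms c₀ = ⊤ → factorialMoment c₀ = ⊤ := fun h => by
    have h1 := arms_le_factorialMoment_add c₀
    rw [h, top_le_iff, ENNReal.add_eq_top] at h1
    exact h1.resolve_right hfin.ne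
  refine ⟨hfact, sol c₀, hsol, fun c' hc' t ht => hc'.eq_sol hw ht, fun hgel => ?_⟩
  have hg := isGelling_armCoeff hw hgel
  have hT := tGel_eq hg
  have hT0 := hg.critT_nonneg
  have hsp : startPoint c₀ = 1 + (arms c₀ * tGel c₀).toReal := rfl
  have hlt : ∀ t, 0 ≤ t → (ENNReal.ofReal t < tGel c₀ ↔ t < critT (armCoeff c₀ 1)) := fun t ht => by
    rw [hT, ENNReal.ofReal_lt_ofReal_iff_of_nonneg ht]
  have hle : ∀ t, 0 ≤ t → (tGel c₀ ≤ ENNReal.ofReal t ↔ critT (armCoeff c₀ 1) ≤ t) :=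
    fun t ht => by rw [hT, ENNReal.ofReal_le_ofReal_iff ht]
  have hA1 : arms c₀ < ⊤ → fnG c₀ 1 =
      ((1 - (arms c₀ / factorialMoment c₀).toReal : ℝ) : EReal) := fun _ => by
    rw [fnG_one hg, (hg.env_eq (critB_nonneg _) le_rfl).2, arms_eq_kser,
      factorialMoment_eq_kser_derCoeff, ENNReal.toReal_div, critB, inv_mul_eq_div]
  have hpos1 : 0 < fnG c₀ 1 := by
    rw [fnG_one hg]
    exact_mod_cast (hg.env_eq (critB_nonneg _) le_rfl).1
  refine ⟨⟨continuousOn_arms_sol hg, arms_sol_strictAntiOn hw,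
    fun t ht => ⟨fun hA => arms_sol_le_div hw hA ht, fun _ => arms_sol_le_one_div hw ht⟩,
    fun x hx => ?_, ?_, fnG_zero_le hg, ?_, hpos1, hA1, fun hA => ?_, strictMonoOn_fnG hg,
    bijOn_fnG hg, ?_, (bijOn_fnG hg).surjOn.rightInvOn_invFunOn, fun x hx => ?_, bijOn_fnΓ hg,
    fun t ht htT => ?_, fun t ht htT => ⟨fun hA => ?_, fun hA => ?_⟩⟩,
    ⟨peak (armCoeff c₀ 1), leastInv c₀, fun t ht => ⟨peak_mem hw ht, fun x hx => ?_,
      phi_peak hw ht (hα t ht) (hβ t ht)⟩, fun t ht htT => ?_, fun t ht htT => ?_,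
      fun t ht y hy x hx => ⟨leastInv_mem hw ht hx.2 hy.2,
        phi_leastInv hw ht (hα t ht) (hβ t ht) hx hy.2,
        fun z hz h => leastInv_le hw ht (hα t ht) (hβ t ht) hx.1 hz.1 h⟩,
      fun t ht y hy x hx => ?_, fun t ht => ⟨arms_eq_genFun _, ?_, arms_sol_eq_div hw ht⟩⟩,
    fun t ht => ⟨fun h => secondMoment_sol_lt_top hg ht ((hlt t ht).1 h),
      fun h => secondMoment_sol_eq_top hg ht ((hle t ht).1 h)⟩⟩
  · rw [genFunOne_eq, genFun_one_lt_top_iff]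
    have hd := hg.isFinite.hasDerivAt_kap hx.1 hx.2
    exact ⟨hg.isFinite x hx.1.le hx.2, hd.differentiableAt,
      hd.deriv.symm ▸ hg.kap_derCoeff_pos hx.1 hx.2⟩
  · rw [fnG_zero hg]
    exact tendsto_preG_zero hg
  · rw [fnG_one hg]
    exact tendsto_preG_one hg
  · have hK := hfact hA
    rw [factorialMoment_eq_kser_derCoeff] at hK
    rw [fnG_one hg, critB, hK, ENNReal.toReal_top, inv_zero, env_of_nonpos le_rfl]
    rfl
  · exact (bijOn_fnG hg).surjOn.mapsTo_invFunOn
  · rw [startPoint_eq hg] at hx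
    obtain ⟨t, ht, rfl⟩ := image_growth_Ici hw hx
    exact (integrandΓ_integral hg ht).1
  · rw [hα t ht, hg.growth_eq ht ((hlt t ht).1 htT).le, arms_eq_kser]
  · rw [hα t ht, ← invΓ_eq hg ((hle t ht).1 htT), hsp, ENNReal.toReal_mul, hT,
      ENNReal.toReal_ofReal hT0, add_sub_assoc]
  · have hK := hfact hA
    rw [factorialMoment_eq_kser_derCoeff] at hK
    have h0 := critT_eq_zero hK
    rw [hα t ht, ← invΓ_eq hg ((hle t ht).1 htT), hsp, hT, h0]
    simp
  · exact (phi_le_one hw ht (hα t ht) (hβ t ht) hx).trans_eq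
      (phi_peak hw ht (hα t ht) (hβ t ht)).symm
  · rcases ht.eq_or_lt with rfl | ht0
    · exact peak_zero hw
    · refine hg.leastMax_flow_eq_one ht0 ?_
      rwa [hT, ENNReal.ofReal_le_ofReal_iff hT0] at htT
  · have htc : critT (armCoeff c₀ 1) < t := not_le.1 fun h => htT.not_ge (by
      rw [hT]
      exact ENNReal.ofReal_le_ofReal h)
    have hb := flow_mem_posSet hw (hT0.trans_lt htc)
    have hm := hg.leastMax_mem_Ioo hb (hg.critB_lt_flow.2 htc)
    refine ⟨hm, hasDerivAt_phi_peak hg htc (hα t ht) (hβ t ht), ?_, ?_⟩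
    · rw [hα t ht, ← fnG_leastMax_flow hg htc]
      exact (bijOn_fnG hg).mapsTo (Ioo_subset_Ico_self hm)
    · rw [hα t ht, fnH_growth hg htc, peak]
  · rw [hα t ht]
    exact genFun_sol_leastInv hw ht hx.2 hy.2
  · rw [hα t ht.le, ← arms_eq_genFun]
    exact growth_mul_arms_sol hw ht
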